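/- Let $\mathbb T=\mathbb R/\mathbb Z$ be the circle with its standard circular order $[a,b,c]$, let $\mathbb Q_\circ=\mathbb Q/\mathbb Z\subset\mathbb T$ be its set of rational points and $D_\circ\subset\mathbb T$ its set of dyadic rational points (both with the induced circular order). For a topological group $G$, a *$G$-system* is a nonempty compact Hausdorff space with a continuous action of $G$. A $G$-system $X$ is *circularly ordered* if its topology is the interval topology of a circular order on $X$ (the topology with base $X$ and the sets $X\setminus[a,b]$, where $[a,b]=\{a,b\}\cup\{x:[a,x,b]\}$) that is preserved by every element of $G$. It is *tame* if for no continuous $f:X\to\mathbb R$ the family $\{x\mapsto f(gx)\}_{g\in G}$ contains an independent sequence; here a sequence $(f_n)$ of real functions on $X$ is independent if there are reals $a<b$ such that $\bigcap_{n\in P}f_n^{-1}(-\infty,a)\cap\bigcap_{n\in M}f_n^{-1}(b,\infty)\neq\emptyset$ for all finite disjoint $P,M\subset\mathbb N$. Let $M(G)$ be the universal minimal $G$-system, i.e. the minimal $G$-system (unique up to isomorphism) that maps continuously and $G$-equivariantly onto every minimal $G$-system. An *affine $G$-system* is a nonempty compact convex subset of a Hausdorff locally convex real vector space with a continuous action of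 $G$ by affine maps; it is *irreducible* if it has no proper nonempty closed convex $G$-invariant subset. Let $I\!A(G)$ be the universal irreducible affine $G$-system, i.e. the irreducible one (unique up to isomorphism) that maps onto every irreducible affine $G$-system by a continuous affine $G$-equivariant map. The group $G$ is *intrinsically circularly ordered* if $M(G)$ is a circularly ordered $G$-system, *intrinsically tame* if $M(G)$ is tame, and *convexly intrinsically tame* if $I\!A(G)$ is tame. Then each of the following is a topological group that is intrinsically circularly ordered, intrinsically tame and convexly intrinsically tame: 1. the group $G=\mathrm{Aut}(\mathbb Q_\circ)$ of all circular order automorphisms of $\mathbb Q_\circ$, with the topology of pointwise convergence on the discrete set $\mathbb Q_\circ$; this group is Polish and, furthermore, $M(G)$ is metrizable; 2. Thompson's circular group $T$, that is, the group of all piecewise linear homeomorphisms of $\mathbb T$ that map $D_\circ$ onto itself, with finitely many break points, all in $D_\circ$, and with all slopes integer powers of $2$; its topology is that of pointwise convergence on the discrete set $D_\circ$; 3. the group $H_+(\mathbb T)$ of all circular order preserving homeomorphisms of $\mathbb T$, with the topology of pointwise convergence on the set $\mathbb T$ taken as a discrete space; this topological group is not Polish; 4. the group $H_+(\mathbb T)$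 with the compact-open topology; this group is Polish. -/

import Mathlib

open Topology

universe u

/-! ### Compact dynamical systems -/

/-- A dynamical `G`-system: a nonempty compact Hausdorff space with a (jointly) continuous action
of the topological group `G`. -/
structure GSystem (G : Type u) [Group G] [TopologicalSpace G] where
  carrier : Type u
  [top : TopologicalSpace carrier]
  [compact : CompactSpace carrier]
  [t2 : T2Space carrier]
  [nonempty : Nonempty carrier]
  [act : MulAction G carrier]
  [cont : ContinuousSMul G carrier]

attribute [instance] GSystem.top GSystem.compact GSystem.t2 GSystem.nonempty GSystem.act
  GSystem.cont

/-- A sequence of real functions on `X` is independent if for some reals `a < b` and all finite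
disjoint `P, Q ⊆ ℕ` some point satisfies `f n < a` for `n ∈ P` and `f n > b` for `n ∈ Q`. -/
def IsIndependentSeq {X : Type*} (f : ℕ → X → ℝ) : Prop :=
  ∃ a b : ℝ, a < b ∧ ∀ P Q : Finset ℕ, Disjoint P Q →
    ∃ x : X, (∀ n ∈ P, f n x < a) ∧ (∀ n ∈ Q, b < f n x)

/-- The system `X` is tame: for every continuous `f : X → ℝ` the family of the functions
`x ↦ f (g • x)`, `g ∈ G`, contains no independent sequence. -/
def IsTameSystem (G X : Type*) [Group G] [TopologicalSpace X] [MulAction G X] : Prop :=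
  ∀ f : X → ℝ, Continuous f → ∀ g : ℕ → G, ¬ IsIndependentSeq fun n x => f (g n • x)

/-- The closed oriented interval `[a, b] = {a, b} ∪ {x | [a, x, b]}` of a circular order.
(In contrast to `Set.cIcc`, this gives `[a, a] = {a}`.) -/
def closedArc {X : Type*} [CircularOrder X] (a b : X) : Set X :=
  {x | x = a ∨ x = b ∨ sbtw a x b}

/-- The interval topology of a circular order, generated by the complements of closed
intervals. -/
abbrev circularIntervalTopology (X : Type*) [CircularOrder X] : TopologicalSpace X :=
  TopologicalSpace.generateFrom {U | ∃ a b : X, U = (closedArc a b)ᶜ}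

/-- The system `X` is circularly ordered: its topology is the interval topology of some circular
order that is preserved by every element of `G`. -/
def IsCOrderedSystem (G X : Type*) [Group G] [t : TopologicalSpace X] [MulAction G X] : Prop :=
  ∃ _ : CircularOrder X, t = circularIntervalTopology X ∧
    ∀ (g : G) (a b c : X), sbtw a b c → sbtw (g • a) (g • b) (g • c)

/-- `M` is a universal minimal `G`-system `M(G)`: it is minimal and admits a continuous
`G`-equivariant map to every minimal `G`-system (automatically onto). Such an `M` exists and is
unique up to isomorphism; since every minimal system has a dense orbit, it is isomorphic to one
that lives in the universe of `G`. -/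
def GSystem.IsUniversalMinimal {G : Type u} [Group G] [TopologicalSpace G] (M : GSystem G) :
    Prop :=
  MulAction.IsMinimal G M.carrier ∧
    ∀ Y : GSystem G, MulAction.IsMinimal G Y.carrier →
      ∃ φ : M.carrier → Y.carrier, Continuous φ ∧ ∀ (g : G) (x : M.carrier), φ (g • x) = g • φ x

/-- `G` is intrinsically circularly ordered: `M(G)` is a circularly ordered system. -/
def IntrinsicallyCOrdered (G : Type u) [Group G] [TopologicalSpace G] : Prop :=
  ∃ M : GSystem G, M.IsUniversalMinimal ∧ IsCOrderedSystem G M.carrier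

/-- `G` is intrinsically tame: `M(G)` is a tame system. -/
def IntrinsicallyTame (G : Type u) [Group G] [TopologicalSpace G] : Prop :=
  ∃ M : GSystem G, M.IsUniversalMinimal ∧ IsTameSystem G M.carrier

/-- `M(G)` is metrizable. -/
def HasMetrizableUniversalMinimal (G : Type u) [Group G] [TopologicalSpace G] : Prop :=
  ∃ M : GSystem G, M.IsUniversalMinimal ∧ TopologicalSpace.MetrizableSpace M.carrier

/-! ### Affine systems -/

/-- A map between subsets (in practice convex ones) of real vector spaces is affine if it
respects convex combinations. -/
def IsAffineOnConvex {E F : Type*} [AddCommGroup E] [Module ℝ E] [AddCommGroup F] [Module ℝ F]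
    {K : Set E} {L : Set F} (φ : K → L) : Prop :=
  ∀ (x y z : K) (a b : ℝ), 0 ≤ a → 0 ≤ b → a + b = 1 → (z : E) = a • (x : E) + b • (y : E) →
    (φ z : F) = a • (φ x : F) + b • (φ y : F)

/-- An affine `G`-system: a nonempty compact convex subset of a Hausdorff locally convex real
vector space with a (jointly) continuous action of `G` by affine maps. -/
structure AffineGSystem (G : Type u) [Group G] [TopologicalSpace G] where
  space : Type u
  [addCommGroup : AddCommGroup space]
  [module : Module ℝ space]
  [top : TopologicalSpace space]
  [topAddGroup : IsTopologicalAddGroup space]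
  [contScalar : ContinuousSMul ℝ space]
  [locallyConvex : LocallyConvexSpace ℝ space]
  [t2 : T2Space space]
  carrier : Set space
  nonempty : carrier.Nonempty
  isCompact : IsCompact carrier
  convex : Convex ℝ carrier
  [act : MulAction G carrier]
  [cont : ContinuousSMul G carrier]
  affine : ∀ g : G, IsAffineOnConvex fun x : carrier => g • x

attribute [instance] AffineGSystem.addCommGroup AffineGSystem.module AffineGSystem.top
  AffineGSystem.topAddGroup AffineGSystem.contScalar AffineGSystem.locallyConvex
  AffineGSystem.t2 AffineGSystem.act AffineGSystem.cont

/-- An affine system is irreducible if it has no proper affine subsystem, i.e. no proper nonempty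
closed convex `G`-invariant subset. -/
def AffineGSystem.IsIrreducible {G : Type u} [Group G] [TopologicalSpace G]
    (Q : AffineGSystem G) : Prop :=
  ∀ C : Set Q.carrier, C.Nonempty → IsClosed C → Convex ℝ ((↑) '' C : Set Q.space) →
    (∀ (g : G), ∀ x ∈ C, g • x ∈ C) → C = Set.univ

/-- `Q` is a universal irreducible affine `G`-system `IA(G)`: it is irreducible and admits a
continuous affine `G`-equivariant map to every irreducible affine `G`-system (automatically
onto). Such a `Q` exists and is unique up to isomorphism. -/
def AffineGSystem.IsUniversalIrreducible {G : Type u} [Group G] [TopologicalSpace G]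
    (Q : AffineGSystem G) : Prop :=
  Q.IsIrreducible ∧
    ∀ R : AffineGSystem G, R.IsIrreducible →
      ∃ φ : Q.carrier → R.carrier, Continuous φ ∧ IsAffineOnConvex φ ∧
        ∀ (g : G) (x : Q.carrier), φ (g • x) = g • φ x

/-- `G` is convexly intrinsically tame: `IA(G)` is a tame system. -/
def ConvexlyIntrinsicallyTame (G : Type u) [Group G] [TopologicalSpace G] : Prop :=
  ∃ Q : AffineGSystem G, Q.IsUniversalIrreducible ∧ IsTameSystem G Q.carrier

/-! ### The groups -/

/-- The topology of pointwise convergence on a set `G` of transformations of the *discrete* set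
`X`, given by the evaluation `G → X → X`. -/
abbrev pointwiseTopology {G X : Type*} (ev : G → X → X) : TopologicalSpace G :=
  TopologicalSpace.induced ev (@Pi.topologicalSpace X (fun _ => X) (fun _ => ⊥))

/-- `ℚ_∘`: the rational points of the circle `ℝ / ℤ`. -/
def rationalCircle : Set UnitAddCircle :=
  {x | ∃ q : ℚ, x = ((q : ℝ) : UnitAddCircle)}

/-- `D_∘`: the dyadic rational points of the circle `ℝ / ℤ`. -/
def dyadicCircle : Set UnitAddCircle :=
  {x | ∃ (m : ℤ) (n : ℕ), x = (((m : ℝ) / 2 ^ n : ℝ) : UnitAddCircle)}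

/-- `Aut(ℚ_∘)`: the permutations of `ℚ_∘` that preserve the circular order of the circle. -/
def autQo : Subgroup (Equiv.Perm rationalCircle) where
  carrier := {σ | ∀ a b c : rationalCircle,
    sbtw (σ a : UnitAddCircle) (σ b) (σ c) ↔ sbtw (a : UnitAddCircle) b c}
  one_mem' := fun _ _ _ => Iff.rfl
  mul_mem' := fun {σ τ} hσ hτ a b c => (hσ (τ a) (τ b) (τ c)).trans (hτ a b c)
  inv_mem' := fun {σ} hσ a b c => by
    have h := hσ (σ.symm a) (σ.symm b) (σ.symm c)
    simp only [Equiv.apply_symm_apply] at h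
    exact h.symm

/-- `Aut(ℚ_∘)` carries the topology of pointwise convergence on the discrete set `ℚ_∘`. -/
instance : TopologicalSpace autQo :=
  pointwiseTopology fun (σ : autQo) (x : rationalCircle) => (σ : Equiv.Perm rationalCircle) x

/-- `H_+(𝕋)`: the homeomorphisms of the circle that preserve its circular order. -/
def hPlus : Subgroup (UnitAddCircle ≃ₜ UnitAddCircle) where
  carrier := {h | ∀ a b c : UnitAddCircle, sbtw (h a) (h b) (h c) ↔ sbtw a b c}
  one_mem' := fun _ _ _ => Iff.rfl
  mul_mem' := fun {σ τ} hσ hτ a b c => (hσ (τ a) (τ b) (τ c)).trans (hτ a b c)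
  inv_mem' := fun {σ} hσ a b c => by
    have h := hσ (σ.symm a) (σ.symm b) (σ.symm c)
    simp only [Homeomorph.apply_symm_apply] at h
    exact h.symm

/-- `H_+(𝕋)` carries the compact-open topology. -/
instance : TopologicalSpace hPlus :=
  TopologicalSpace.induced
    (fun h : hPlus =>
      (⟨(h : UnitAddCircle ≃ₜ UnitAddCircle), h.1.continuous⟩ : C(UnitAddCircle, UnitAddCircle)))
    ContinuousMap.compactOpen

/-- The group `H_+(𝕋)` again, to be equipped with another topology. -/
def HPlusPointwise : Type := hPlus

instance : Group HPlusPointwise := inferInstanceAs (Group hPlus)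

/-- The topology of pointwise convergence for the action on the *discrete* circle. -/
instance : TopologicalSpace HPlusPointwise :=
  pointwiseTopology fun (h : hPlus) (x : UnitAddCircle) =>
    (h : UnitAddCircle ≃ₜ UnitAddCircle) x

/-- The conditions on a homeomorphism `h` of the circle that define Thompson's group: it preserves
the set of dyadic points, and off a finite set of dyadic points it is locally affine with slope a
power of `2` (with integer exponent). So `h` is piecewise linear; as the slopes are positive, it
preserves the orientation. -/
def IsThompson (h : UnitAddCircle ≃ₜ UnitAddCircle) : Prop :=
  (∀ x, h x ∈ dyadicCircle ↔ x ∈ dyadicCircle) ∧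
    ∃ B : Set UnitAddCircle, B.Finite ∧ B ⊆ dyadicCircle ∧ ∀ x ∉ B, ∃ k : ℤ,
      ∀ᶠ s : ℝ in 𝓝 0,
        h (x + (s : UnitAddCircle)) = h x + (((2 : ℝ) ^ k * s : ℝ) : UnitAddCircle)

theorem IsThompson.one : IsThompson 1 :=
  ⟨fun _ => Iff.rfl, ∅, Set.finite_empty, Set.empty_subset _, fun x _ =>
    ⟨0, Filter.Eventually.of_forall fun s => by simp⟩⟩

theorem tendsto_zpow_mul_zero (k : ℤ) :
    Filter.Tendsto (fun s : ℝ => (2 : ℝ) ^ k * s) (𝓝 0) (𝓝 0) := by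
  have : Continuous fun s : ℝ => (2 : ℝ) ^ k * s := by fun_prop
  simpa using this.tendsto 0

theorem IsThompson.mul {g h : UnitAddCircle ≃ₜ UnitAddCircle} (hg : IsThompson g)
    (hh : IsThompson h) : IsThompson (g * h) := by
  obtain ⟨hg1, B, hB, hBD, hgB⟩ := hg
  obtain ⟨hh1, C, hC, hCD, hhC⟩ := hh
  refine ⟨fun x => (hg1 (h x)).trans (hh1 x), C ∪ h ⁻¹' B,
    hC.union (hB.preimage h.injective.injOn),
    Set.union_subset hCD fun x hx => (hh1 x).1 (hBD hx), fun x hx => ?_⟩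
  simp only [Set.mem_union, Set.mem_preimage, not_or] at hx
  obtain ⟨k, hk⟩ := hhC x hx.1
  obtain ⟨l, hl⟩ := hgB (h x) hx.2
  refine ⟨l + k, ?_⟩
  filter_upwards [hk, (tendsto_zpow_mul_zero k).eventually hl] with s h1 h2
  change g (h (x + s)) = g (h x) + _
  rw [h1, h2, zpow_add₀ (by norm_num), mul_assoc]

theorem IsThompson.inv {h : UnitAddCircle ≃ₜ UnitAddCircle} (hh : IsThompson h) :
    IsThompson h⁻¹ := by
  obtain ⟨hh1, C, hC, hCD, hhC⟩ := hh
  have e1 : ∀ y, h (h⁻¹ y) = y := h.apply_symm_apply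
  have e2 : ∀ y, h⁻¹ (h y) = y := h.symm_apply_apply
  refine ⟨fun x => by rw [← hh1, e1], h '' C, hC.image _, ?_, fun y hy => ?_⟩
  · rintro _ ⟨x, hx, rfl⟩
    exact (hh1 x).2 (hCD hx)
  · obtain ⟨k, hk⟩ := hhC (h⁻¹ y) fun hx => hy ⟨_, hx, e1 y⟩
    refine ⟨-k, ?_⟩
    filter_upwards [(tendsto_zpow_mul_zero (-k)).eventually hk] with s h1
    rw [e1, ← mul_assoc, ← zpow_add₀ (by norm_num), add_neg_cancel, zpow_zero, one_mul] at h1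
    rw [← h1, e2]

/-- Thompson's circular group `T`. -/
def thompsonT : Subgroup (UnitAddCircle ≃ₜ UnitAddCircle) where
  carrier := {h | IsThompson h}
  one_mem' := IsThompson.one
  mul_mem' := IsThompson.mul
  inv_mem' := IsThompson.inv

/-- Thompson's group `T` carries the topology of pointwise convergence for its action on the
discrete set `D_∘`. -/
instance : TopologicalSpace thompsonT :=
  pointwiseTopology fun (h : thompsonT) (x : dyadicCircle) =>
    (⟨(h : UnitAddCircle ≃ₜ UnitAddCircle) x, (h.2.1 x).2 x.2⟩ : dyadicCircle)

/-! Each group `G` is given an explicit compact system `M` with three properties. It maps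
equivariantly to every compact system (`GSystem.MapsToAll`); it contains infinitely many disjoint
closed sets whose complements the group can push into any nonempty open set
(`HasShrinkableComplements`); its topology comes from an invariant circular order. This suffices
(`GSystem.MapsToAll.intrinsic`). Shrinking gives minimality, so `M` is `M(G)`. A probability measure
has little mass on all but finitely many of the disjoint sets, so its orbit closure contains every
point mass. Hence the space of probability measures on `M` is irreducible, and as maps from `M` to
compact convex sets extend by barycenters, it is `IA(G)`.

Tameness is a Helly-type selection principle. Group elements carry arcs to arcs, and every sequence
of arcs has a subsequence for which each point is eventually inside or eventually outside
(`exists_subseq_closedArc`). So the translates of a continuous function are, along a subsequence,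
pointwise Cauchy up to `ε`, which rules out independence. Dominated convergence carries this over to
probability measures.

The first three groups act on `A`, the set of rational, dyadic or all points of the circle, and `M`
is the space `Cut A` of linear orders compatible with the circular order, a closed subset of `A → A
→ Bool`. Rotations and piecewise linear bumps with slopes 2 and 1/2 make these actions
ultrahomogeneous. Equivariant maps to a compact system `Y` then come from Ramsey's theorem: up to
`ε`, `f (g • y)` depends only on which points `g` sends to a suitable finite set, so it becomes
nearly constant on an infinite part of a monotone sequence. Compactness of `Cut A → Y` turns such
finite approximations into an exact map (`exists_equivariant`).

With the compact-open topology `M` is the circle itself. A system `Y` of this group is also one for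
the finer pointwise topology, hence receives a map from `Cut UnitAddCircle`. The stabilizer of `0`
fixes the cut just before `0`, so it fixes the image `y₀` of that cut, and rotating `y₀` gives the
map from the circle to `Y`. -/

open Filter

/-! ### Circular orders and linear orders cut at a point -/

section CutOrder

variable {X : Type*} [CircularOrder X]

theorem sbtw_total {a b c : X} (hab : a ≠ b) (hbc : b ≠ c) (hca : c ≠ a) :
    sbtw a b c ∨ sbtw c b a := by
  by_contra! h
  have h1 := btw_iff_not_sbtw.2 h.1
  have h2 := btw_iff_not_sbtw.2 h.2
  rcases btw_antisymm h1 h2 with h | h | h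
  · exact hbc h.symm
  · exact hab h.symm
  · exact hca h.symm

theorem SBtw.sbtw.ne_left {a b c : X} (h : sbtw a b c) : a ≠ b := by
  rintro rfl; exact sbtw_irrefl_left h

theorem SBtw.sbtw.ne_right {a b c : X} (h : sbtw a b c) : b ≠ c :=
  h.cyclic_left.ne_left

theorem SBtw.sbtw.ne_outer {a b c : X} (h : sbtw a b c) : c ≠ a :=
  h.cyclic_right.ne_left

/-- The strict linear order obtained by cutting a circular order just before the point `o`. -/
def cutLT (o x y : X) : Prop := (x = o ∧ y ≠ o) ∨ sbtw o x y

theorem cutLT_trans {o x y z : X} (h : cutLT o x y) (h' : cutLT o y z) : cutLT o x z := by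
  rcases h with ⟨rfl, h⟩ | h <;> rcases h' with ⟨rfl, h'⟩ | h'
  · exact (h rfl).elim
  · exact Or.inl ⟨rfl, h'.ne_outer⟩
  · exact (h.ne_outer rfl).elim
  · exact Or.inr (h.trans_right h')

theorem cutLT_trichotomy (o x y : X) : cutLT o x y ∨ x = y ∨ cutLT o y x := by
  by_cases hxy : x = y
  · exact Or.inr (Or.inl hxy)
  by_cases hx : x = o
  · exact Or.inl (Or.inl ⟨hx, fun h => hxy (hx.trans h.symm)⟩)
  by_cases hy : y = o
  · exact Or.inr (Or.inr (Or.inl ⟨hy, hx⟩))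
  rcases sbtw_total (Ne.symm hx) hxy hy with h | h
  · exact Or.inl (Or.inr h)
  · exact Or.inr (Or.inr (Or.inr h.cyclic_right))

theorem cutLT_irrefl (o x : X) : ¬ cutLT o x x := by
  rintro (⟨h, h'⟩ | h)
  · exact h' h
  · exact sbtw_irrefl_right h

theorem cutLT_asymm {o x y : X} (h : cutLT o x y) : ¬ cutLT o y x := fun h' =>
  cutLT_irrefl o x (cutLT_trans h h')

/-- The linear order obtained by cutting a circular order just before the point `o`. -/
noncomputable abbrev cutLinearOrder (o : X) : LinearOrder X where
  le x y := ¬ cutLT o y x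
  lt := cutLT o
  le_refl x := cutLT_irrefl o x
  le_trans x y z h h' h'' := by
    rcases cutLT_trichotomy o x y with h1 | rfl | h1
    · exact h' (cutLT_trans h'' h1)
    · exact h' h''
    · exact h h1
  lt_iff_le_not_ge x y := ⟨fun h => ⟨cutLT_asymm h, not_not.2 h⟩, fun h => not_not.1 h.2⟩
  le_antisymm x y h h' := by
    rcases cutLT_trichotomy o x y with h1 | h1 | h1
    · exact (h' h1).elim
    · exact h1
    · exact (h h1).elim
  le_total x y := by
    by_contra! h
    exact cutLT_asymm h.1 h.2
  toDecidableLE := Classical.decRel _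

theorem sbtw_of_cutLT {o a b c : X} (h : cutLT o a b) (h' : cutLT o b c) : sbtw a b c := by
  rcases h with ⟨rfl, h⟩ | h <;> rcases h' with ⟨rfl, h'⟩ | h'
  · exact (h rfl).elim
  · exact h'
  · exact (h.ne_outer rfl).elim
  · exact (h'.cyclic_right.trans_left h).cyclic_left

/-- Cutting loses nothing: a triple is positively oriented exactly when one of its rotations
increases in the cut order. If none does, the reversed triple has an increasing rotation. -/
theorem sbtw_iff_cutLT (o : X) {a b c : X} : sbtw a b c ↔
    (cutLT o a b ∧ cutLT o b c) ∨ (cutLT o b c ∧ cutLT o c a) ∨ (cutLT o c a ∧ cutLT o a b) := by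
  constructor
  · intro h
    rcases cutLT_trichotomy o a b with h1 | h1 | h1
    · rcases cutLT_trichotomy o b c with h2 | h2 | h2
      · exact Or.inl ⟨h1, h2⟩
      · exact (h.ne_right h2).elim
      · rcases cutLT_trichotomy o c a with h3 | h3 | h3
        · exact Or.inr (Or.inr ⟨h3, h1⟩)
        · exact (h.ne_outer h3).elim
        · exact (h.not_sbtw (sbtw_of_cutLT h3 h2).cyclic_left).elim
    · exact (h.ne_left h1).elim
    · rcases cutLT_trichotomy o b c with h2 | h2 | h2
      · rcases cutLT_trichotomy o c a with h3 | h3 | h3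
        · exact Or.inr (Or.inl ⟨h2, h3⟩)
        · exact (h.ne_outer h3).elim
        · exact (h.not_sbtw (sbtw_of_cutLT h1 h3).cyclic_right).elim
      · exact (h.ne_right h2).elim
      · exact (h.not_sbtw (sbtw_of_cutLT h2 h1)).elim
  · rintro (⟨h, h'⟩ | ⟨h, h'⟩ | ⟨h, h'⟩)
    · exact sbtw_of_cutLT h h'
    · exact (sbtw_of_cutLT h h').cyclic_right
    · exact (sbtw_of_cutLT h h').cyclic_left

end CutOrder

/-! ### Eventually decided sequences of propositions -/

/-- The sequence of propositions is eventually constant. -/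
def EventuallyDecided (p : ℕ → Prop) : Prop := (∀ᶠ n in atTop, p n) ∨ ∀ᶠ n in atTop, ¬ p n

namespace EventuallyDecided

variable {p q : ℕ → Prop}

theorem not (hp : EventuallyDecided p) : EventuallyDecided fun n => ¬ p n := by
  rcases hp with h | h
  · exact Or.inr (h.mono fun _ h => not_not.2 h)
  · exact Or.inl h

theorem and (hp : EventuallyDecided p) (hq : EventuallyDecided q) :
    EventuallyDecided fun n => p n ∧ q n := by
  rcases hp with h | h
  · rcases hq with h' | h'
    · exact Or.inl (h.and h')
    · exact Or.inr (h'.mono fun _ h1 h2 => h1 h2.2)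
  · exact Or.inr (h.mono fun _ h1 h2 => h1 h2.1)

theorem or (hp : EventuallyDecided p) (hq : EventuallyDecided q) :
    EventuallyDecided fun n => p n ∨ q n := by
  have := (hp.not.and hq.not).not
  simpa only [not_and_or, not_not] using this

theorem comp (hp : EventuallyDecided p) {φ : ℕ → ℕ} (hφ : StrictMono φ) :
    EventuallyDecided fun n => p (φ n) :=
  hp.imp hφ.tendsto_atTop.eventually hφ.tendsto_atTop.eventually

theorem of_monotone (h : ∀ m n, m < n → p m → p n) : EventuallyDecided p := by
  by_cases h' : ∃ m, p m
  · obtain ⟨m, hm⟩ := h'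
    refine Or.inl ((eventually_ge_atTop m).mono fun n hn => ?_)
    rcases hn.eq_or_lt with rfl | hn
    · exact hm
    · exact h m n hn hm
  · exact Or.inr (Eventually.of_forall fun n hn => h' ⟨n, hn⟩)

theorem of_antitone (h : ∀ m n, m < n → p n → p m) : EventuallyDecided p := by
  have : EventuallyDecided fun n => ¬ p n := of_monotone fun m n hmn hm hn => hm (h m n hmn hn)
  simpa only [not_not] using this.not

end EventuallyDecided

/-- Every sequence in a linear order has a subsequence whose comparison with each point is
eventually constant. -/
theorem exists_subseq_compare {X : Type*} [LinearOrder X] (a : ℕ → X) :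
    ∃ φ : ℕ → ℕ, StrictMono φ ∧ ∀ x, EventuallyDecided (fun n => a (φ n) < x) ∧
      EventuallyDecided fun n => x < a (φ n) := by
  obtain ⟨φ, h | h⟩ := exists_increasing_or_nonincreasing_subseq (· < ·) a
  · exact ⟨φ, φ.strictMono, fun x => ⟨.of_antitone fun m n hmn hn => (h m n hmn).trans hn,
      .of_monotone fun m n hmn hm => hm.trans (h m n hmn)⟩⟩
  · exact ⟨φ, φ.strictMono, fun x =>
      ⟨.of_monotone fun m n hmn hm => (not_lt.1 (h m n hmn)).trans_lt hm,
      .of_antitone fun m n hmn hn => hn.trans_le (not_lt.1 (h m n hmn))⟩⟩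

/-- Every sequence of closed arcs of a circular order has a subsequence such that membership of
each point is eventually constant. -/
theorem exists_subseq_closedArc {X : Type*} [CircularOrder X] (a b : ℕ → X) :
    ∃ φ : ℕ → ℕ, StrictMono φ ∧
      ∀ x, EventuallyDecided fun n => x ∈ closedArc (a (φ n)) (b (φ n)) := by
  -- Any base point would do; `a 0` merely shows that there is one.
  let o := a 0
  let _ : LinearOrder X := cutLinearOrder o
  obtain ⟨φ, hφ, ha⟩ := exists_subseq_compare a
  obtain ⟨ψ, hψ, hab⟩ := exists_subseq_compare fun n => b (φ n)
  -- Whether an arc runs across the base point is recorded by `b < a`. This does not involve `x`, so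
  -- one more extraction decides it; membership in the arc is then a Boolean combination of decided
  -- comparisons.
  obtain ⟨χ, hχ, hc⟩ : ∃ χ : ℕ → ℕ, StrictMono χ ∧
      EventuallyDecided fun n => b (φ (ψ (χ n))) < a (φ (ψ (χ n))) := by
    by_cases h : ∃ᶠ n in atTop, b (φ (ψ n)) < a (φ (ψ n))
    · obtain ⟨χ, hχ, h⟩ := extraction_of_frequently_atTop h
      exact ⟨χ, hχ, Or.inl (Eventually.of_forall h)⟩
    · exact ⟨id, strictMono_id, Or.inr (not_frequently.1 h)⟩
  refine ⟨φ ∘ ψ ∘ χ, hφ.comp (hψ.comp hχ), fun x => ?_⟩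
  have e1 := ((ha x).1.comp hψ).comp hχ
  have e2 := ((ha x).2.comp hψ).comp hχ
  have e3 := (hab x).1.comp hχ
  have e4 := (hab x).2.comp hχ
  have key : ∀ p q : X, x ∈ closedArc p q ↔ (¬ p < x ∧ ¬ x < p) ∨ (¬ q < x ∧ ¬ x < q) ∨
      ((p < x ∧ x < q) ∨ (x < q ∧ q < p) ∨ (q < p ∧ p < x)) := fun p q => by
    have h1 : ∀ p : X, x = p ↔ (¬ p < x ∧ ¬ x < p) := fun p => by
      rw [not_lt, not_lt]
      exact ⟨fun h => ⟨h.le, h.ge⟩, fun h => le_antisymm h.1 h.2⟩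
    have h2 := sbtw_iff_cutLT o (a := p) (b := x) (c := q)
    rw [← h1, ← h1]
    exact or_congr_right (or_congr_right h2)
  simp only [key, Function.comp]
  exact (e1.not.and e2.not).or ((e3.not.and e4.not).or ((e1.and e4).or ((e4.and hc).or
    (hc.and e1))))

/-- A continuous function on a compact space is nearly constant on the cells of a finite
subfamily of a given subbase. -/
theorem exists_finite_subbasis_osc {X : Type*} [t : TopologicalSpace X] [CompactSpace X]
    {S : Set (Set X)} (hS : t = TopologicalSpace.generateFrom S) {f : X → ℝ} (hf : Continuous f)
    {ε : ℝ} (hε : 0 < ε) : ∃ T : Set (Set X), T.Finite ∧ T ⊆ S ∧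
      ∀ x y, (∀ U ∈ T, x ∈ U ↔ y ∈ U) → |f x - f y| < ε := by
  have hb := TopologicalSpace.isTopologicalBasis_of_subbasis hS
  have h1 : ∀ x : X, ∃ F : Set (Set X), F.Finite ∧ F ⊆ S ∧ x ∈ ⋂₀ F ∧
      ∀ y ∈ ⋂₀ F, |f y - f x| < ε / 2 := fun x => by
    have : {y | |f y - f x| < ε / 2} ∈ 𝓝 x :=
      (isOpen_lt (by fun_prop) continuous_const).mem_nhds (by simpa using half_pos hε)
    obtain ⟨_, ⟨F, hF, rfl⟩, hx, h⟩ := hb.mem_nhds_iff.1 this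
    exact ⟨F, hF.1, hF.2, hx, h⟩
  choose F hF hFS hxF hfF using h1
  -- Two points in the same cell lie in a common set of this finite cover, so both values are within
  -- `ε / 2` of the value at its centre.
  obtain ⟨s, hs⟩ := isCompact_univ.elim_finite_subcover (fun x => ⋂₀ F x)
    (fun x => (hF x).isOpen_sInter fun U hU => by
      rw [hS]; exact TopologicalSpace.isOpen_generateFrom_of_mem (hFS x hU))
    (fun x _ => Set.mem_iUnion.2 ⟨x, hxF x⟩)
  refine ⟨⋃ x ∈ s, F x, s.finite_toSet.biUnion fun x _ => hF x, Set.iUnion₂_subset fun x _ => hFS x,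
    fun x y h => ?_⟩
  obtain ⟨z, hz, hxz⟩ := Set.mem_iUnion₂.1 (hs (Set.mem_univ x))
  have hyz : y ∈ ⋂₀ F z := fun U hU => (h U (Set.mem_biUnion hz hU)).1 (hxz U hU)
  have h1 := hfF z x hxz
  have h2 := hfF z y hyz
  rw [abs_lt] at *
  constructor <;> linarith

/-! ### Tameness -/

/-- The system has the approximate selection property: along a subsequence of every sequence of
translates, every continuous function is pointwise Cauchy up to `ε`. -/
def HasCauchySubseq (G X : Type*) [Group G] [TopologicalSpace X] [MulAction G X] : Prop :=
  ∀ f : X → ℝ, Continuous f → ∀ g : ℕ → G, ∀ ε > 0, ∃ φ : ℕ → ℕ, StrictMono φ ∧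
    ∀ x, ∀ᶠ p : ℕ × ℕ in atTop, |f (g (φ p.1) • x) - f (g (φ p.2) • x)| ≤ ε

theorem exists_subseq_finset {ι : Type*} (s : Finset ι) {P : ι → (ℕ → ℕ) → Prop}
    (hsub : ∀ i φ (ψ : ℕ → ℕ), StrictMono ψ → P i φ → P i (φ ∘ ψ))
    (hex : ∀ i ∈ s, ∀ φ : ℕ → ℕ, StrictMono φ → ∃ ψ : ℕ → ℕ, StrictMono ψ ∧ P i (φ ∘ ψ)) :
    ∃ φ : ℕ → ℕ, StrictMono φ ∧ ∀ i ∈ s, P i φ := by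
  classical
  induction s using Finset.induction_on with
  | empty => exact ⟨id, strictMono_id, by simp⟩
  | insert i s _ ih =>
    obtain ⟨φ, hφ, h⟩ := ih fun j hj => hex j (Finset.mem_insert_of_mem hj)
    obtain ⟨ψ, hψ, h'⟩ := hex i (Finset.mem_insert_self i s) φ hφ
    refine ⟨φ ∘ ψ, hφ.comp hψ, fun j hj => ?_⟩
    rcases Finset.mem_insert.1 hj with rfl | hj
    · exact h'
    · exact hsub j φ ψ hψ (h j hj)

/-- Up to `ε`, `f` depends only on membership in finitely many arcs. As `g • x` lies in an arc iff
`x` lies in its translate by `g⁻¹`, the selection principle for arcs, applied once for each of them,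
makes these memberships eventually constant. -/
theorem IsCOrderedSystem.hasCauchySubseq {G X : Type*} [Group G] [t : TopologicalSpace X]
    [CompactSpace X] [MulAction G X] (h : IsCOrderedSystem G X) : HasCauchySubseq G X := by
  classical
  obtain ⟨hX, ht, hG⟩ := h
  intro f hf g ε hε
  obtain ⟨T, hT, hTS, hosc⟩ := exists_finite_subbasis_osc ht hf hε
  have hG' : ∀ (g : G) (a b x : X), g • x ∈ closedArc a b ↔
      x ∈ closedArc (g⁻¹ • a) (g⁻¹ • b) := fun g a b x => by
    refine or_congr (by rw [eq_inv_smul_iff]) (or_congr (by rw [eq_inv_smul_iff]) ⟨fun h => ?_,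
      fun h => ?_⟩)
    · simpa using hG g⁻¹ _ _ _ h
    · simpa using hG g _ _ _ h
  obtain ⟨φ, hφ, hd⟩ := exists_subseq_finset (P := fun U φ =>
      ∀ x, EventuallyDecided fun n => g (φ n) • x ∈ U) hT.toFinset
    (fun U φ ψ hψ h x => (h x).comp hψ) (fun U hU φ hφ => by
      obtain ⟨a, b, rfl⟩ := hTS (hT.mem_toFinset.1 hU)
      obtain ⟨ψ, hψ, h⟩ := exists_subseq_closedArc (fun n => (g (φ n))⁻¹ • a)
        (fun n => (g (φ n))⁻¹ • b)
      refine ⟨ψ, hψ, fun x => ?_⟩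
      simp only [Set.mem_compl_iff, hG']
      exact (h x).not)
  refine ⟨φ, hφ, fun x => ?_⟩
  have : ∀ᶠ p : ℕ × ℕ in atTop, ∀ U ∈ hT.toFinset, (g (φ p.1) • x ∈ U ↔ g (φ p.2) • x ∈ U) := by
    rw [eventually_all_finset]
    intro U hU
    rw [← prod_atTop_atTop_eq]
    rcases hd U hU x with h | h
    · filter_upwards [h.prod_mk h] with p hp
      exact iff_of_true hp.1 hp.2
    · filter_upwards [h.prod_mk h] with p hp
      exact iff_of_false hp.1 hp.2
  filter_upwards [this] with p hp
  exact (hosc _ _ fun U hU => hp U (hT.mem_toFinset.2 hU)).le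

/-- Independence, applied with the even terms of the subsequence low and the odd terms high, gives
by compactness one point at which consecutive values jump by at least `b - a` forever. This
contradicts the Cauchy property at scale `(b - a) / 2`. -/
theorem HasCauchySubseq.isTameSystem {G X : Type*} [Group G] [TopologicalSpace X]
    [CompactSpace X] [MulAction G X] (hc : ∀ g : G, Continuous fun x : X => g • x)
    (h : HasCauchySubseq G X) : IsTameSystem G X := by
  rintro f hf g ⟨a, b, hab, hind⟩
  obtain ⟨φ, hφ, hφc⟩ := h f hf g ((b - a) / 2) (by linarith)
  let C : ℕ → Set X := fun n =>
    {x | f (g (φ (2 * n)) • x) ≤ a ∧ b ≤ f (g (φ (2 * n + 1)) • x)}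
  have hC : ∀ n, IsClosed (C n) := fun n =>
    (isClosed_le (hf.comp (hc _)) continuous_const).inter
      (isClosed_le continuous_const (hf.comp (hc _)))
  obtain ⟨x, hx⟩ : (⋂ n, C n).Nonempty := by
    refine CompactSpace.iInter_nonempty hC fun s => ?_
    obtain ⟨x, hx, hx'⟩ := hind (s.image fun n => φ (2 * n)) (s.image fun n => φ (2 * n + 1)) (by
      rw [Finset.disjoint_left]
      intro k hk hk'
      obtain ⟨m, _, rfl⟩ := Finset.mem_image.1 hk
      obtain ⟨n, _, h⟩ := Finset.mem_image.1 hk'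
      have := hφ.injective h
      omega)
    exact ⟨x, Set.mem_iInter₂.2 fun n hn =>
      ⟨(hx _ (Finset.mem_image_of_mem _ hn)).le, (hx' _ (Finset.mem_image_of_mem _ hn)).le⟩⟩
  obtain ⟨⟨m, n⟩, hmn⟩ := eventually_atTop.1 (hφc x)
  have h1 := hmn (2 * (m + n), 2 * (m + n) + 1) ⟨by simp; omega, by simp; omega⟩
  have h2 := Set.mem_iInter.1 hx (m + n)
  have h3 := (abs_le.1 h1).1
  have h4 := h2.1
  have h5 := h2.2
  simp only at h3
  linarith

/-! ### The state space of a compact space -/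

section StateSpace

variable {X : Type*} [TopologicalSpace X] [CompactSpace X]

/-- The states on `C(X, ℝ)`, i.e. the regular Borel probability measures on `X`, with the weak-*
topology. -/
def stateSpace (X : Type*) [TopologicalSpace X] [CompactSpace X] : Set (WeakDual ℝ C(X, ℝ)) :=
  {μ | (∀ f : C(X, ℝ), 0 ≤ f → 0 ≤ μ f) ∧ μ 1 = 1}

theorem stateSpace_mono {μ : WeakDual ℝ C(X, ℝ)} (hμ : μ ∈ stateSpace X) {f g : C(X, ℝ)}
    (h : f ≤ g) : μ f ≤ μ g := by
  have := hμ.1 (g - f) (sub_nonneg.2 h)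
  rw [map_sub] at this
  linarith

theorem stateSpace_le_of_forall_le {μ : WeakDual ℝ C(X, ℝ)} (hμ : μ ∈ stateSpace X) {f : C(X, ℝ)}
    {c : ℝ} (h : ∀ x, f x ≤ c) : μ f ≤ c := by
  have := stateSpace_mono hμ (g := c • (1 : C(X, ℝ))) fun x => by simpa using h x
  rwa [map_smul, hμ.2, smul_eq_mul, mul_one] at this

theorem stateSpace_abs_le {μ : WeakDual ℝ C(X, ℝ)} (hμ : μ ∈ stateSpace X) {f : C(X, ℝ)}
    {c : ℝ} (h : ∀ x, |f x| ≤ c) : |μ f| ≤ c := by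
  rw [abs_le']
  refine ⟨stateSpace_le_of_forall_le hμ fun x => (abs_le'.1 (h x)).1, ?_⟩
  rw [← map_neg]
  exact stateSpace_le_of_forall_le hμ fun x => (abs_le'.1 (h x)).2

theorem isClosed_stateSpace : IsClosed (stateSpace X) := by
  have h : IsClosed {μ : WeakDual ℝ C(X, ℝ) | ∀ f : C(X, ℝ), 0 ≤ f → 0 ≤ μ f} := by
    simp only [Set.ofPred_forall]
    exact isClosed_iInter fun f => isClosed_iInter fun _ =>
      isClosed_le continuous_const (WeakDual.eval_continuous _)
  exact h.inter (isClosed_eq (WeakDual.eval_continuous _) continuous_const)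

/-- Banach–Alaoglu: positivity and `μ 1 = 1` force norm at most one. -/
theorem isCompact_stateSpace : IsCompact (stateSpace X) := by
  refine (WeakDual.isCompact_closedBall (𝕜 := ℝ) (0 : StrongDual ℝ C(X, ℝ)) 1).of_isClosed_subset
    isClosed_stateSpace fun μ hμ => ?_
  rw [Set.mem_preimage, mem_closedBall_zero_iff]
  refine ContinuousLinearMap.opNorm_le_bound _ zero_le_one fun f => ?_
  rw [one_mul, Real.norm_eq_abs]
  exact stateSpace_abs_le hμ fun x => f.norm_coe_le_norm x

theorem convex_stateSpace : Convex ℝ (stateSpace X) := by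
  intro μ hμ ν hν a b ha hb hab
  refine ⟨fun f hf => ?_, ?_⟩
  · change 0 ≤ a * μ f + b * ν f
    exact add_nonneg (mul_nonneg ha (hμ.1 f hf)) (mul_nonneg hb (hν.1 f hf))
  · change a * μ 1 + b * ν 1 = 1
    rw [hμ.2, hν.2, mul_one, mul_one, hab]

instance : CompactSpace (stateSpace X) := isCompact_iff_compactSpace.1 isCompact_stateSpace

/-- Evaluation at a point, as a state. -/
noncomputable def dirac (x : X) : stateSpace X :=
  ⟨StrongDual.toWeakDual (ContinuousMap.evalCLM ℝ x), fun _ hf => hf x, rfl⟩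

theorem dirac_apply (x : X) (f : C(X, ℝ)) : (dirac x : WeakDual ℝ C(X, ℝ)) f = f x := rfl

theorem continuous_dirac : Continuous (dirac : X → stateSpace X) :=
  Continuous.subtype_mk (WeakDual.continuous_of_continuous_eval fun f => f.continuous) _

theorem locallyConvexSpace_weakDual : LocallyConvexSpace ℝ (WeakDual ℝ C(X, ℝ)) :=
  (WeakDual.withSeminorms ℝ C(X, ℝ)).toLocallyConvexSpace

/-- The barycenter of a state with respect to a continuous map to a compact convex set. -/
theorem exists_barycenter {E : Type*} [AddCommGroup E] [Module ℝ E] [TopologicalSpace E]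
    [T2Space E] {K : Set E}
    (hK : IsCompact K) (hKc : Convex ℝ K) {μ : WeakDual ℝ C(X, ℝ)} (hμ : μ ∈ stateSpace X)
    (φ : C(X, E)) (hφ : ∀ x, φ x ∈ K) :
    ∃ k ∈ K, ∀ ℓ : E →L[ℝ] ℝ, ℓ k = μ ((ℓ : C(E, ℝ)).comp φ) := by
  obtain ⟨k, hk, h⟩ := hK.inter_iInter_nonempty
    (fun ℓ : E →L[ℝ] ℝ => {k | ℓ k = μ ((ℓ : C(E, ℝ)).comp φ)})
    (fun ℓ => isClosed_eq ℓ.continuous continuous_const) (fun u => by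
      let Λ : E →L[ℝ] (u → ℝ) := ContinuousLinearMap.pi fun i : u => i.1
      let v : u → ℝ := fun i => μ ((i.1 : C(E, ℝ)).comp φ)
      by_cases hv : v ∈ Λ '' K
      · obtain ⟨k, hk, hkv⟩ := hv
        exact ⟨k, hk, Set.mem_iInter₂.2 fun ℓ hℓ => congrFun hkv ⟨ℓ, hℓ⟩⟩
      -- By compactness only finitely many functionals matter. If no point of `K` had the prescribed
      -- values, a functional on the finite-dimensional space would separate the value vector from
      -- the image of `K`; its pullback to `E` would then have a mean exceeding its upper bound on
      -- `K`.
      · exfalso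
        obtain ⟨c, s, hs, hsv⟩ := geometric_hahn_banach_closed_point
          (hKc.linear_image Λ.toLinearMap) (hK.image Λ.continuous).isClosed hv
        obtain ⟨w, hw⟩ : ∃ w : u → ℝ, ∀ v, c v = ∑ i, w i * v i := by
          classical
          refine ⟨fun i => c fun j => if i = j then 1 else 0, fun v => ?_⟩
          have := c.toLinearMap.pi_apply_eq_sum_univ v
          simp only [ContinuousLinearMap.coe_coe, smul_eq_mul] at this
          simp only [this, mul_comm]
        have key : c v = μ (((c.comp Λ : E →L[ℝ] ℝ) : C(E, ℝ)).comp φ) := by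
          have h1 : ((c.comp Λ : E →L[ℝ] ℝ) : C(E, ℝ)).comp φ =
              ∑ i : u, w i • ((i.1 : C(E, ℝ)).comp φ) := by
            ext x
            rw [ContinuousMap.sum_apply]
            exact hw (Λ (φ x))
          rw [h1, map_sum, hw]
          exact Finset.sum_congr rfl fun i _ => (map_smul μ _ _).symm
        rw [key] at hsv
        refine hsv.not_ge (stateSpace_le_of_forall_le hμ fun x => ?_)
        exact (hs _ ⟨φ x, hφ x, rfl⟩).le)
  exact ⟨k, hk, fun ℓ => Set.mem_iInter.1 h ℓ⟩

/-- A closed convex set that contains all point masses contains all states. -/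
theorem stateSpace_subset_of_dirac_mem {C : Set (WeakDual ℝ C(X, ℝ))}
    (hC : IsClosed C) (hCc : Convex ℝ C) (h : ∀ x : X, (dirac x : WeakDual ℝ C(X, ℝ)) ∈ C) :
    stateSpace X ⊆ C := by
  intro μ hμ
  -- The barycenter of `μ` along the Dirac map lies in `C`; tested on evaluation functionals it
  -- turns out to be `μ`.
  obtain ⟨k, ⟨hkC, -⟩, hk⟩ := exists_barycenter (K := C ∩ stateSpace X)
    (isCompact_stateSpace.inter_left hC) (hCc.inter convex_stateSpace) hμ
    ⟨fun x => (dirac x : WeakDual ℝ C(X, ℝ)), continuous_subtype_val.comp continuous_dirac⟩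
    fun x => ⟨h x, (dirac x).2⟩
  have : k = μ := by
    refine DFunLike.ext _ _ fun f => ?_
    have := hk ⟨⟨⟨fun ν => ν f, fun _ _ => rfl⟩, fun _ _ => rfl⟩, WeakDual.eval_continuous f⟩
    exact this
  exact this ▸ hkC

/-- States are represented by probability measures. -/
theorem exists_measure_of_mem_stateSpace [T2Space X] [MeasurableSpace X] [BorelSpace X]
    {μ : WeakDual ℝ C(X, ℝ)} (hμ : μ ∈ stateSpace X) :
    ∃ m : MeasureTheory.Measure X, MeasureTheory.IsProbabilityMeasure m ∧
      ∀ f : C(X, ℝ), μ f = ∫ x, f x ∂m := by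
  let Λ : CompactlySupportedContinuousMap X ℝ →ₚ[ℝ] ℝ :=
    { toFun := fun f => μ f.toContinuousMap
      map_add' := fun f g => map_add μ f.toContinuousMap g.toContinuousMap
      map_smul' := fun c f => map_smul μ c f.toContinuousMap
      monotone' := fun f g h => stateSpace_mono hμ h }
  have h1 : ∀ f : C(X, ℝ), μ f = ∫ x, f x ∂(RealRMK.rieszMeasure Λ) := fun f =>
    (RealRMK.integral_rieszMeasure Λ ⟨f, HasCompactSupport.of_compactSpace _⟩).symm
  refine ⟨RealRMK.rieszMeasure Λ, ⟨?_⟩, h1⟩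
  have h2 := h1 1
  rw [hμ.2] at h2
  simp only [ContinuousMap.one_apply, MeasureTheory.integral_const, smul_eq_mul, mul_one] at h2
  rw [MeasureTheory.Measure.real, eq_comm, ENNReal.toReal_eq_one_iff] at h2
  exact h2

end StateSpace

/-! ### The induced affine system -/

section Action

variable {G : Type*} [Group G] {X : Type*} [TopologicalSpace X] [MulAction G X]
  [TopologicalSpace G] [ContinuousSMul G X]

/-- The translate `x ↦ f (g • x)`. -/
def actTranslate (g : G) (f : C(X, ℝ)) : C(X, ℝ) := f.comp ⟨fun x => g • x, continuous_const_smul g⟩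

theorem actTranslate_apply (g : G) (f : C(X, ℝ)) (x : X) : actTranslate g f x = f (g • x) := rfl

theorem continuous_actTranslate (f : C(X, ℝ)) : Continuous fun g : G => actTranslate g f := by
  refine ContinuousMap.continuous_of_continuous_uncurry _ ?_
  change Continuous fun p : G × X => f (p.1 • p.2)
  fun_prop

variable [CompactSpace X]

/-- Translation as a continuous linear map. -/
noncomputable def actTranslateCLM (g : G) : C(X, ℝ) →L[ℝ] C(X, ℝ) where
  toFun := actTranslate g
  map_add' _ _ := rfl
  map_smul' _ _ := rfl
  cont := by
    unfold actTranslate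
    fun_prop

noncomputable instance : MulAction G (stateSpace X) where
  smul g μ := ⟨StrongDual.toWeakDual ((WeakDual.toStrongDual μ.1).comp (actTranslateCLM g)),
    fun f hf => μ.2.1 _ fun x => hf (g • x), μ.2.2⟩
  one_smul μ := Subtype.ext <| DFunLike.ext _ _ fun f => by
    change μ.1 (actTranslate 1 f) = μ.1 f
    congr 1
    ext x
    simp [actTranslate_apply]
  mul_smul g h μ := Subtype.ext <| DFunLike.ext _ _ fun f => by
    change μ.1 (actTranslate (g * h) f) = μ.1 (actTranslate h (actTranslate g f))
    congr 1
    ext x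
    simp [actTranslate_apply, mul_smul]

theorem stateSpace_smul_apply (g : G) (μ : stateSpace X) (f : C(X, ℝ)) :
    (g • μ : stateSpace X).1 f = μ.1 (actTranslate g f) := rfl

theorem smul_dirac (g : G) (x : X) : g • dirac x = dirac (g • x) := rfl

/-- States are contractions for the sup norm, so changing `g` alters the value at `f` by at most the
norm of the difference of two translates of `f`, uniformly in the state. -/
instance : ContinuousSMul G (stateSpace X) where
  continuous_smul := by
    refine Continuous.subtype_mk (WeakDual.continuous_of_continuous_eval fun f => ?_) _
    change Continuous fun p : G × stateSpace X => p.2.1 (actTranslate p.1 f)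
    rw [continuous_iff_continuousAt]
    rintro ⟨g, μ⟩
    have h1 : Tendsto (fun p : G × stateSpace X => p.2.1 (actTranslate g f)) (𝓝 (g, μ))
        (𝓝 (μ.1 (actTranslate g f))) :=
      ((WeakDual.eval_continuous _).comp (continuous_subtype_val.comp continuous_snd)).tendsto _
    have h2 : Tendsto (fun p : G × stateSpace X => p.2.1 (actTranslate p.1 f - actTranslate g f))
        (𝓝 (g, μ)) (𝓝 0) := by
      refine squeeze_zero_norm (a := fun p => ‖actTranslate p.1 f - actTranslate g f‖)
        (fun p => ?_) ?_
      · exact stateSpace_abs_le p.2.2 (actTranslate p.1 f - actTranslate g f).norm_coe_le_norm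
      · have : Continuous fun p : G × stateSpace X => ‖actTranslate p.1 f - actTranslate g f‖ :=
          (((continuous_actTranslate f).comp continuous_fst).sub continuous_const).norm
        simpa using this.tendsto (g, μ)
    have h3 := h2.add h1
    simpa [ContinuousAt] using h3

theorem isAffineOnConvex_smul_stateSpace (g : G) :
    IsAffineOnConvex fun μ : stateSpace X => g • μ := by
  intro μ ν ρ a b _ _ _ h
  refine DFunLike.ext _ _ fun f => ?_
  have := DFunLike.congr_fun h (actTranslate g f)
  exact this

open MeasureTheory in
/-- The approximate selection property passes to the state space, evaluated at a function. -/
theorem HasCauchySubseq.exists_subseq_state [T2Space X] (h : HasCauchySubseq G X) (f : C(X, ℝ))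
    (g : ℕ → G) {ε : ℝ} (hε : 0 < ε) : ∃ φ : ℕ → ℕ, StrictMono φ ∧
    ∀ μ : stateSpace X, ∀ᶠ p : ℕ × ℕ in atTop,
      |(g (φ p.1) • μ).1 f - (g (φ p.2) • μ).1 f| ≤ ε := by
  obtain ⟨φ, hφ, hc⟩ := h f f.continuous g (ε / 2) (half_pos hε)
  refine ⟨φ, hφ, fun μ => ?_⟩
  borelize X
  obtain ⟨m, hm, hμ⟩ := exists_measure_of_mem_stateSpace μ.2
  -- The excess over `ε / 2` vanishes eventually at each point and is bounded by `2 * ‖f‖`, so its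
  -- integral tends to zero by dominated convergence.
  let F : ℕ × ℕ → X → ℝ := fun p x =>
    max (|f (g (φ p.1) • x) - f (g (φ p.2) • x)| - ε / 2) 0
  have hFc : ∀ p, Continuous (F p) := fun p => by
    have h1 := (actTranslate (g (φ p.1)) f).continuous
    have h2 := (actTranslate (g (φ p.2)) f).continuous
    exact ((h1.sub h2).abs.sub continuous_const).max continuous_const
  have hlim : Tendsto (fun p => ∫ x, F p x ∂m) atTop (𝓝 (∫ _, (0 : ℝ) ∂m)) := by
    refine tendsto_integral_filter_of_dominated_convergence (fun _ => 2 * ‖f‖)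
      (Eventually.of_forall fun p => (hFc p).aestronglyMeasurable) (Eventually.of_forall fun p =>
        Eventually.of_forall fun x => ?_) (integrable_const _) (Eventually.of_forall fun x => ?_)
    · have h1 := f.norm_coe_le_norm (g (φ p.1) • x)
      have h2 := f.norm_coe_le_norm (g (φ p.2) • x)
      rw [Real.norm_eq_abs, abs_of_nonneg (le_max_right _ _)]
      refine max_le ?_ (by positivity)
      have := abs_sub (f (g (φ p.1) • x)) (f (g (φ p.2) • x))
      rw [Real.norm_eq_abs] at h1 h2
      linarith
    · refine tendsto_const_nhds.congr' ?_
      filter_upwards [hc x] with p hp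
      exact (max_eq_right (by linarith)).symm
  rw [integral_zero] at hlim
  filter_upwards [hlim.eventually (gt_mem_nhds (half_pos hε))] with p hp
  rw [stateSpace_smul_apply, stateSpace_smul_apply, hμ, hμ, ← integral_sub
    ((actTranslate _ f).continuous.integrable_of_hasCompactSupport (.of_compactSpace _))
    ((actTranslate _ f).continuous.integrable_of_hasCompactSupport (.of_compactSpace _))]
  have hi : Integrable (F p) m :=
    (hFc p).integrable_of_hasCompactSupport (.of_compactSpace _)
  calc |∫ x, (actTranslate (g (φ p.1)) f x - actTranslate (g (φ p.2)) f x) ∂m|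
      ≤ ∫ x, (F p x + ε / 2) ∂m := by
        rw [← Real.norm_eq_abs]
        refine norm_integral_le_of_norm_le (hi.add (integrable_const _))
          (Eventually.of_forall fun x => ?_)
        have := le_max_left (|f (g (φ p.1) • x) - f (g (φ p.2) • x)| - ε / 2) 0
        rw [Real.norm_eq_abs]
        exact sub_le_iff_le_add.1 this
    _ = ∫ x, F p x ∂m + ε / 2 := by
        rw [integral_add hi (integrable_const _)]
        simp
    _ ≤ ε := by linarith

/-- A continuous function on the state space is nearly determined by finitely many evaluations. -/
theorem exists_finset_stateSpace (F : stateSpace X → ℝ) (hF : Continuous F) {ε : ℝ} (hε : 0 < ε) :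
    ∃ s : Finset C(X, ℝ), ∀ μ ν : stateSpace X, (∀ f ∈ s, |μ.1 f - ν.1 f| ≤ 1) →
      |F μ - F ν| < ε := by
  have hK : IsCompact {p : stateSpace X × stateSpace X | ε ≤ |F p.1 - F p.2|} :=
    (isClosed_le continuous_const (by fun_prop)).isCompact
  obtain ⟨s, hs⟩ := hK.elim_finite_subcover
    (fun f : C(X, ℝ) => {p : stateSpace X × stateSpace X | 1 < |p.1.1 f - p.2.1 f|})
    (fun f => isOpen_lt continuous_const
      (((WeakDual.eval_continuous f).comp (continuous_subtype_val.comp continuous_fst)).sub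
      ((WeakDual.eval_continuous f).comp (continuous_subtype_val.comp continuous_snd))).abs)
    (fun p hp => by
      have hne : p.1 ≠ p.2 := by
        intro h
        have : ε ≤ |F p.1 - F p.2| := hp
        rw [h, sub_self, abs_zero] at this
        linarith
      obtain ⟨f, hf⟩ : ∃ f, p.1.1 f ≠ p.2.1 f := by
        by_contra! h
        exact hne (Subtype.ext (DFunLike.ext _ _ h))
      -- The rescaling makes the two values differ by exactly 2. This is why the fixed tolerance 1
      -- suffices for every `ε`.
      refine Set.mem_iUnion.2 ⟨(2 / |p.1.1 f - p.2.1 f|) • f, ?_⟩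
      have h0 : 0 < |p.1.1 f - p.2.1 f| := abs_pos.2 (sub_ne_zero.2 hf)
      change 1 < |p.1.1 (_ • f) - p.2.1 (_ • f)|
      rw [map_smul, map_smul, ← smul_sub, smul_eq_mul, abs_mul, abs_div, abs_abs,
        div_mul_cancel₀ _ h0.ne']
      norm_num)
  refine ⟨s, fun μ ν h => ?_⟩
  by_contra! h'
  obtain ⟨f, hf, hlt⟩ := Set.mem_iUnion₂.1 (hs (show (μ, ν) ∈ _ from h'))
  exact (h f hf).not_gt hlt

/-- A continuous function of a state is controlled by finitely many evaluations, and a subsequence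
can be extracted for each of these in turn. -/
theorem HasCauchySubseq.stateSpace [T2Space X] (h : HasCauchySubseq G X) :
    HasCauchySubseq G (stateSpace X) := by
  intro F hF g ε hε
  obtain ⟨s, hs⟩ := exists_finset_stateSpace F hF hε
  obtain ⟨φ, hφ, hd⟩ := exists_subseq_finset (P := fun f φ =>
      ∀ μ : _root_.stateSpace X, ∀ᶠ p : ℕ × ℕ in atTop,
        |(g (φ p.1) • μ).1 f - (g (φ p.2) • μ).1 f| ≤ 1) s
    (fun f φ ψ hψ h μ => by
      have := hψ.tendsto_atTop.prodMap hψ.tendsto_atTop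
      rw [prod_atTop_atTop_eq] at this
      exact this.eventually (h μ))
    (fun f _ φ hφ => h.exists_subseq_state f (fun n => g (φ n)) one_pos)
  refine ⟨φ, hφ, fun μ => ?_⟩
  filter_upwards [(eventually_all_finset s).2 fun f hf => hd f hf μ] with p hp
  exact (hs _ _ hp).le

end Action

/-- There is an infinite sequence `J` of disjoint closed sets such that the group can move each
complement `(J n)ᶜ` into any nonempty open set. -/
def HasShrinkableComplements (G X : Type*) [Group G] [TopologicalSpace X] [MulAction G X] : Prop :=
  ∃ J : ℕ → Set X, (∀ n, IsClosed (J n)) ∧ Pairwise (Function.onFun Disjoint J) ∧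
    ∀ n (U : Set X), IsOpen U → U.Nonempty → ∃ g : G, ∀ x ∉ J n, g • x ∈ U

/-! ### Minimality and approximation of point masses by shrinking -/

section Shrink

variable {G : Type*} [Group G] {X : Type*} [TopologicalSpace X] [MulAction G X]

/-- A point lies outside `J 0` or outside `J 1`, so some group element moves it into any given open
set. -/
theorem HasShrinkableComplements.isMinimal (h : HasShrinkableComplements G X) :
    MulAction.IsMinimal G X := by
  obtain ⟨J, -, hd, h⟩ := h
  refine ⟨fun x => dense_iff_inter_open.2 fun U hU hne => ?_⟩
  have : ∃ n, x ∉ J n := by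
    by_contra! h'
    exact Set.disjoint_left.1 (hd zero_ne_one) (h' 0) (h' 1)
  obtain ⟨n, hn⟩ := this
  obtain ⟨g, hg⟩ := h n U hU hne
  exact ⟨g • x, hg x hn, ⟨g, rfl⟩⟩

variable [CompactSpace X] [T2Space X] [TopologicalSpace G] [ContinuousSMul G X]

-- The measures of the disjoint sets `J n` tend to zero. For large `n`, pushing the complement of `J
-- n` close to `x` leaves an error of at most `1 / 2` from the complement and `2 * ‖f‖ * m.real (J
-- n)` from `J n`.
open MeasureTheory in
theorem HasShrinkableComplements.exists_smul_state_near (h : HasShrinkableComplements G X)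
    (μ : stateSpace X) (x : X) (s : Finset C(X, ℝ)) :
    ∃ g : G, ∀ f ∈ s, |(g • μ).1 f - f x| ≤ 1 := by
  classical
  obtain ⟨J, hJ, hd, h⟩ := h
  borelize X
  obtain ⟨m, hm, hμ⟩ := exists_measure_of_mem_stateSpace μ.2
  have hlim : Tendsto (fun n => m (J n)) atTop (𝓝 0) := by
    refine ENNReal.tendsto_atTop_zero_of_tsum_ne_top (ne_top_of_le_ne_top (measure_ne_top m _)
      (tsum_meas_le_meas_iUnion_of_disjoint m (fun n => (hJ n).measurableSet) hd))
  have hlim' : Tendsto (fun n => m.real (J n)) atTop (𝓝 0) :=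
    (ENNReal.tendsto_toReal_zero_iff fun n => measure_ne_top m _).2 hlim
  obtain ⟨n, hn⟩ : ∃ n, ∀ f ∈ s, 2 * ‖f‖ * m.real (J n) < 1 / 2 := by
    have : ∀ᶠ n in atTop, ∀ f ∈ s, 2 * ‖f‖ * m.real (J n) < 1 / 2 := by
      rw [eventually_all_finset]
      intro f _
      have := hlim'.const_mul (2 * ‖f‖)
      rw [mul_zero] at this
      exact this.eventually (gt_mem_nhds (by norm_num))
    exact this.exists
  obtain ⟨g, hg⟩ := h n (⋂ f ∈ s, {y | |f y - f x| < 1 / 2})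
    (isOpen_biInter_finset fun f _ => isOpen_lt (by fun_prop) continuous_const)
    ⟨x, by simp⟩
  refine ⟨g, fun f hf => ?_⟩
  have hi : ∀ f : C(X, ℝ), Integrable f m := fun f =>
    f.continuous.integrable_of_hasCompactSupport (.of_compactSpace _)
  have hi' : Integrable (fun y => 1 / 2 + (J n).indicator (fun _ => 2 * ‖f‖) y) m :=
    (integrable_const _).add ((integrable_const _).indicator (hJ n).measurableSet)
  have h0 : f x = ∫ _, f x ∂m := by simp
  rw [stateSpace_smul_apply, hμ, h0, ← integral_sub (hi _) (integrable_const _)]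
  calc |∫ y, (actTranslate g f y - f x) ∂m|
      ≤ ∫ y, (1 / 2 + (J n).indicator (fun _ => 2 * ‖f‖) y) ∂m := by
        rw [← Real.norm_eq_abs]
        refine norm_integral_le_of_norm_le hi' (Eventually.of_forall fun y => ?_)
        by_cases hy : y ∈ J n
        · rw [Set.indicator_of_mem hy]
          have h1 := f.norm_coe_le_norm (g • y)
          have h2 := f.norm_coe_le_norm x
          have h3 := norm_sub_le (f (g • y)) (f x)
          rw [actTranslate_apply]
          linarith
        · rw [Set.indicator_of_notMem hy, add_zero, Real.norm_eq_abs]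
          exact (Set.mem_iInter₂.1 (hg y hy) f hf).le
    _ = 1 / 2 + 2 * ‖f‖ * m.real (J n) := by
        rw [integral_add (integrable_const _)
          ((integrable_const _).indicator (hJ n).measurableSet),
          integral_indicator_const _ (hJ n).measurableSet]
        simp [mul_comm]
    _ ≤ 1 := by linarith [hn f hf]

/-- By compactness some `ν` in `C` is within 1 of `f x` for every `f` at once; since `f` may be
rescaled, `ν` must be the point mass. -/
theorem HasShrinkableComplements.dirac_mem (h : HasShrinkableComplements G X)
    {C : Set (stateSpace X)} (hne : C.Nonempty) (hC : IsClosed C)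
    (hG : ∀ g : G, ∀ μ ∈ C, g • μ ∈ C) (x : X) : dirac x ∈ C := by
  obtain ⟨μ, hμ⟩ := hne
  obtain ⟨ν, hν, h'⟩ := hC.isCompact.inter_iInter_nonempty
    (fun f : C(X, ℝ) => {ν : stateSpace X | |ν.1 f - f x| ≤ 1})
    (fun f => isClosed_le (((WeakDual.eval_continuous f).comp continuous_subtype_val).sub
      continuous_const).abs continuous_const) (fun s => by
      obtain ⟨g, hg⟩ := h.exists_smul_state_near μ x s
      exact ⟨g • μ, hG g μ hμ, Set.mem_iInter₂.2 hg⟩)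
  have : ν = dirac x := by
    refine Subtype.ext (DFunLike.ext _ _ fun f => ?_)
    rw [dirac_apply]
    by_contra hf
    have h0 : 0 < |ν.1 f - f x| := abs_pos.2 (sub_ne_zero.2 hf)
    have h1 : |ν.1 ((2 / |ν.1 f - f x|) • f) - (2 / |ν.1 f - f x|) * f x| ≤ 1 :=
      Set.mem_iInter.1 h' ((2 / |ν.1 f - f x|) • f)
    rw [map_smul, smul_eq_mul, ← mul_sub, abs_mul, abs_div, abs_abs,
      div_mul_cancel₀ _ h0.ne'] at h1
    norm_num at h1
  exact this ▸ hν

end Shrink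

/-! ### Criterion for a system to determine the universal systems -/

section Universal

variable {G : Type u} [Group G] [TopologicalSpace G]

/-- The affine system of states of a compact system. -/
noncomputable def GSystem.states (M : GSystem G) : AffineGSystem G :=
  haveI := locallyConvexSpace_weakDual (X := M.carrier)
  { space := WeakDual ℝ C(M.carrier, ℝ)
    carrier := stateSpace M.carrier
    nonempty := ⟨_, (dirac (Classical.arbitrary M.carrier)).2⟩
    isCompact := isCompact_stateSpace
    convex := convex_stateSpace
    affine := isAffineOnConvex_smul_stateSpace }

theorem GSystem.states_isIrreducible (M : GSystem G)
    (h : HasShrinkableComplements G M.carrier) : M.states.IsIrreducible := by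
  intro C hne hC hCc hG
  have h1 := stateSpace_subset_of_dirac_mem (X := M.carrier)
    (isCompact_stateSpace.isClosed.isClosedEmbedding_subtypeVal.isClosedMap C hC) hCc
    fun x => ⟨dirac x, h.dirac_mem (C := C) hne hC hG x, rfl⟩
  refine Set.eq_univ_of_forall fun μ => ?_
  obtain ⟨ν, hν, h2⟩ := h1 μ.2
  exact Subtype.ext h2 ▸ hν

/-- `β` sends a state to its barycenter along `φ`. It is affine and continuous because functionals
separate points, and it extends `φ` on point masses. The states at which it commutes with `g` form a
closed convex set containing the point masses, hence are all states. -/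
theorem GSystem.exists_map_of_states (M : GSystem G) (R : AffineGSystem G)
    (φ : M.carrier → R.carrier) (hφ : Continuous φ) (hφG : ∀ (g : G) x, φ (g • x) = g • φ x) :
    ∃ β : M.states.carrier → R.carrier, Continuous β ∧ IsAffineOnConvex β ∧
      ∀ (g : G) (x : M.states.carrier), β (g • x) = g • β x := by
  let φ' : C(M.carrier, R.space) := ⟨fun x => φ x, continuous_subtype_val.comp hφ⟩
  have hex : ∀ μ : stateSpace M.carrier, ∃ k : R.carrier, ∀ ℓ : R.space →L[ℝ] ℝ,
      ℓ k = μ.1 ((ℓ : C(R.space, ℝ)).comp φ') := fun μ => by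
    obtain ⟨k, hk, h⟩ := exists_barycenter R.isCompact R.convex μ.2 φ' fun x => (φ x).2
    exact ⟨⟨k, hk⟩, h⟩
  choose β hβ using hex
  have hsep : ∀ x y : R.space, (∀ ℓ : R.space →L[ℝ] ℝ, ℓ x = ℓ y) → x = y := fun x y h => by
    by_contra hne
    obtain ⟨f, hf⟩ := geometric_hahn_banach_point_point hne
    exact hf.ne (h f)
  have : CompactSpace R.carrier := isCompact_iff_compactSpace.1 R.isCompact
  have hβc : Continuous β := by
    have hemb : IsClosedEmbedding fun (k : R.carrier) (ℓ : R.space →L[ℝ] ℝ) => ℓ k :=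
      Continuous.isClosedEmbedding
        (continuous_pi fun ℓ => ℓ.continuous.comp continuous_subtype_val)
        fun x y h => Subtype.ext (hsep _ _ fun ℓ => congrFun h ℓ)
    rw [hemb.isInducing.continuous_iff]
    refine continuous_pi fun ℓ => ?_
    simp only [Function.comp_def, hβ]
    exact (WeakDual.eval_continuous _).comp continuous_subtype_val
  have hβa : IsAffineOnConvex β := by
    intro x y z a b _ _ _ h
    refine hsep _ _ fun ℓ => ?_
    rw [map_add, map_smul, map_smul, hβ, hβ, hβ, h]
    rfl
  have hβd : ∀ x, β (dirac x) = φ x := fun x => Subtype.ext (hsep _ _ fun ℓ => hβ _ ℓ)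
  refine ⟨β, hβc, hβa, fun g => ?_⟩
  have h1 := stateSpace_subset_of_dirac_mem (X := M.carrier)
    (C := Subtype.val '' {μ : stateSpace M.carrier | β (g • μ) = g • β μ})
    (isCompact_stateSpace.isClosed.isClosedEmbedding_subtypeVal.isClosedMap _
      (isClosed_eq (hβc.comp (continuous_const_smul g)) (hβc.const_smul g))) (by
      rintro _ ⟨x, hx, rfl⟩ _ ⟨y, hy, rfl⟩ a b ha hb hab
      refine ⟨⟨_, convex_stateSpace x.2 y.2 ha hb hab⟩, ?_, rfl⟩
      have e1 := hβa x y ⟨_, convex_stateSpace x.2 y.2 ha hb hab⟩ a b ha hb hab rfl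
      have e2 := R.affine g _ _ _ a b ha hb hab e1
      have e3 := hβa (g • x) (g • y) (g • ⟨_, convex_stateSpace x.2 y.2 ha hb hab⟩) a b ha hb hab
        (isAffineOnConvex_smul_stateSpace g x y _ a b ha hb hab rfl)
      refine Subtype.ext (e3.trans ?_)
      rw [show β (g • x) = g • β x from hx, show β (g • y) = g • β y from hy]
      exact e2.symm)
    (fun x => ⟨dirac x, by
      change β (g • dirac x) = g • β (dirac x)
      rw [smul_dirac, hβd, hβd, hφG], rfl⟩)
  intro μ
  obtain ⟨ν, hν, h2⟩ := h1 μ.2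
  exact Subtype.ext h2 ▸ hν

/-- A system that maps to every compact system. -/
def GSystem.MapsToAll (M : GSystem G) : Prop := ∀ Y : GSystem G,
  ∃ φ : M.carrier → Y.carrier, Continuous φ ∧ ∀ (g : G) (x : M.carrier), φ (g • x) = g • φ x

theorem GSystem.MapsToAll.isUniversalMinimal {M : GSystem G} (hM : M.MapsToAll)
    (h : HasShrinkableComplements G M.carrier) : M.IsUniversalMinimal :=
  ⟨h.isMinimal, fun Y _ => hM Y⟩

/-- An affine system is in particular a compact system, so `M` maps to it and the map extends to
states. For this `M` must map to all compact systems and not just to the minimal ones. -/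
theorem GSystem.MapsToAll.isUniversalIrreducible {M : GSystem G} (hM : M.MapsToAll)
    (h : HasShrinkableComplements G M.carrier) : M.states.IsUniversalIrreducible := by
  refine ⟨M.states_isIrreducible h, fun R _ => ?_⟩
  have : CompactSpace R.carrier := isCompact_iff_compactSpace.1 R.isCompact
  have : Nonempty R.carrier := R.nonempty.to_subtype
  obtain ⟨φ, hφ, hφG⟩ := hM { carrier := R.carrier }
  exact M.exists_map_of_states R φ hφ hφG

theorem GSystem.MapsToAll.intrinsic {M : GSystem G} (hM : M.MapsToAll)
    (h : HasShrinkableComplements G M.carrier) (hco : IsCOrderedSystem G M.carrier) :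
    IntrinsicallyCOrdered G ∧ IntrinsicallyTame G ∧ ConvexlyIntrinsicallyTame G :=
  ⟨⟨M, hM.isUniversalMinimal h, hco⟩,
    ⟨M, hM.isUniversalMinimal h, hco.hasCauchySubseq.isTameSystem fun g =>
      continuous_const_smul g⟩,
    ⟨M.states, hM.isUniversalIrreducible h, HasCauchySubseq.isTameSystem (G := G)
      (X := stateSpace M.carrier) (fun g => continuous_const_smul g)
      hco.hasCauchySubseq.stateSpace⟩⟩

end Universal

/-! ### The space of cuts of a circular order -/

/-- A strict linear order compatible with the circular order, as a Boolean-valued relation. -/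
def IsCut {A : Type*} [CircularOrder A] (r : A → A → Bool) : Prop :=
  (∀ a b, a ≠ b → r a b ∨ r b a) ∧ (∀ a b c, r a b → r b c → r a c) ∧
    ∀ a b c, r a b → r b c → sbtw a b c

/-- The space of cuts of a circular order, i.e. of the compatible linear orders. -/
def Cut (A : Type*) [CircularOrder A] : Type _ := {r : A → A → Bool // IsCut r}

instance (A : Type*) [CircularOrder A] : TopologicalSpace (Cut A) :=
  inferInstanceAs (TopologicalSpace {r : A → A → Bool // IsCut r})

instance (A : Type*) [CircularOrder A] : T2Space (Cut A) :=
  inferInstanceAs (T2Space {r : A → A → Bool // IsCut r})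

namespace Cut

variable {A : Type*} [CircularOrder A]

/-- The linear order of a cut. -/
def lt (p : Cut A) (a b : A) : Prop := p.1 a b = true

theorem ext {p q : Cut A} (h : ∀ a b, p.lt a b → q.lt a b) (h' : ∀ a b, q.lt a b → p.lt a b) :
    p = q :=
  Subtype.ext <| funext fun a => funext fun b => Bool.eq_iff_iff.2 ⟨h a b, h' a b⟩

theorem isClopen_lt (a b : A) : IsClopen {p : Cut A | p.lt a b} := by
  have : Continuous fun p : Cut A => p.1 a b :=
    (continuous_apply_apply a b).comp continuous_subtype_val
  exact (isClopen_discrete {true}).preimage this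

theorem total (p : Cut A) {a b : A} (h : a ≠ b) : p.lt a b ∨ p.lt b a := p.2.1 a b h

theorem trans (p : Cut A) {a b c : A} (h : p.lt a b) (h' : p.lt b c) : p.lt a c :=
  p.2.2.1 a b c h h'

theorem sbtw (p : Cut A) {a b c : A} (h : p.lt a b) (h' : p.lt b c) : sbtw a b c :=
  p.2.2.2 a b c h h'

theorem asymm (p : Cut A) {a b : A} (h : p.lt a b) : ¬ p.lt b a := fun h' =>
  sbtw_irrefl_left_right (p.sbtw h h')

theorem irrefl (p : Cut A) (a : A) : ¬ p.lt a a := fun h => p.asymm h h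

theorem ne (p : Cut A) {a b : A} (h : p.lt a b) : a ≠ b := by
  rintro rfl
  exact p.irrefl _ h

theorem not_lt (p : Cut A) {a b : A} (h : a ≠ b) : ¬ p.lt a b ↔ p.lt b a :=
  ⟨fun h' => (p.total h).resolve_left h', fun h' h'' => p.asymm h' h''⟩

theorem sbtw_iff (p : Cut A) {a b c : A} : SBtw.sbtw a b c ↔
    (p.lt a b ∧ p.lt b c) ∨ (p.lt b c ∧ p.lt c a) ∨ (p.lt c a ∧ p.lt a b) := by
  constructor
  · intro h
    have hn : ∀ {x y z : A}, SBtw.sbtw x y z → ¬ (p.lt z y ∧ p.lt y x) := fun h h' =>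
      h.not_sbtw (p.sbtw h'.1 h'.2)
    have h1 := hn h
    have h2 := hn h.cyclic_left
    have h3 := hn h.cyclic_right
    have h4 := p.total h.ne_left
    have h5 := p.total h.ne_right
    have h6 := p.total h.ne_outer
    tauto
  · rintro (⟨h, h'⟩ | ⟨h, h'⟩ | ⟨h, h'⟩)
    · exact p.sbtw h h'
    · exact (p.sbtw h h').cyclic_right
    · exact (p.sbtw h h').cyclic_left

theorem lt_of_sbtw_left (p : Cut A) {a b c : A} (h : SBtw.sbtw a b c) (h' : p.lt a c) :
    p.lt a b ∧ p.lt b c := by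
  have h1 := p.asymm h'
  have h2 := p.sbtw_iff.1 h
  tauto

/-- The linear order underlying a cut. -/
noncomputable abbrev toLinearOrder (p : Cut A) : LinearOrder A where
  le a b := ¬ p.lt b a
  lt := p.lt
  le_refl := p.irrefl
  le_trans a b c h h' h'' := by
    rcases eq_or_ne a b with rfl | hab
    · exact h' h''
    · exact h' (p.trans h'' ((p.not_lt hab.symm).1 h))
  lt_iff_le_not_ge a b := ⟨fun h => ⟨p.asymm h, not_not.2 h⟩, fun h => not_not.1 h.2⟩
  le_antisymm a b h h' := by
    by_contra hab
    exact (p.total hab).elim h' h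
  le_total a b := by
    by_contra! h
    exact p.asymm h.1 h.2
  toDecidableLE := Classical.decRel _

/-- The cut just before the point `o`. -/
noncomputable def before (o : A) : Cut A := by
  classical
  exact ⟨fun a b => decide (cutLT o a b), fun a b h => by
    rcases cutLT_trichotomy o a b with h1 | h1 | h1
    · simp [h1]
    · exact (h h1).elim
    · simp [h1], fun a b c h h' => by
      simp only [decide_eq_true_eq] at *
      exact cutLT_trans h h', fun a b c h h' => by
      simp only [decide_eq_true_eq] at *
      exact sbtw_of_cutLT h h'⟩

theorem before_lt (o a b : A) : (before o).lt a b ↔ cutLT o a b := by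
  simp [before, lt]

instance [Nonempty A] : Nonempty (Cut A) := ⟨before (Classical.arbitrary A)⟩

theorem isClosed_isCut : IsClosed {r : A → A → Bool | IsCut r} := by
  have h0 : ∀ a b, IsClopen {r : A → A → Bool | r a b = true} := fun a b =>
    (isClopen_discrete {true}).preimage (continuous_apply_apply a b)
  have h1 : IsClosed {r : A → A → Bool | ∀ a b, a ≠ b → r a b ∨ r b a} := by
    simp only [Set.ofPred_forall]
    exact isClosed_iInter fun a => isClosed_iInter fun b => isClosed_iInter fun _ =>
      (h0 a b).1.union (h0 b a).1
  have h2 : IsClosed {r : A → A → Bool | ∀ a b c, r a b → r b c → r a c} := by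
    simp only [Set.ofPred_forall]
    exact isClosed_iInter fun a => isClosed_iInter fun b => isClosed_iInter fun c =>
      isClosed_imp (h0 a b).2 (isClosed_imp (h0 b c).2 (h0 a c).1)
  have h3 : IsClosed {r : A → A → Bool | ∀ a b c, r a b → r b c → SBtw.sbtw a b c} := by
    simp only [Set.ofPred_forall]
    exact isClosed_iInter fun a => isClosed_iInter fun b => isClosed_iInter fun c =>
      isClosed_imp (h0 a b).2 (isClosed_imp (h0 b c).2 isClosed_const)
  exact h1.inter (h2.inter h3)

instance : CompactSpace (Cut A) := isCompact_iff_compactSpace.1 isClosed_isCut.isCompact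

/-! #### The circular order on cuts -/

/-- If `a` lies before `o` only for `p` and `b` only for `q`, then `a, o, b` and `b, o, a` are both
positively oriented. -/
theorem subset_total (o : A) (p q : Cut A) :
    {a | p.lt a o} ⊆ {a | q.lt a o} ∨ {a | q.lt a o} ⊆ {a | p.lt a o} := by
  by_contra! h
  obtain ⟨⟨a, ha, ha'⟩, ⟨b, hb, hb'⟩⟩ := Set.not_subset.1 h.1, Set.not_subset.1 h.2
  have h1 := p.sbtw ha ((p.not_lt (q.ne hb)).1 hb')
  have h2 := q.sbtw hb ((q.not_lt (p.ne ha)).1 ha')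
  exact h1.not_sbtw h2

/-- A cut is recovered from the set of points before `o`: on each side of `o` the circular order
dictates how points compare. -/
theorem eq_of_lt_base_iff (o : A) {p q : Cut A} (h : ∀ a, p.lt a o ↔ q.lt a o) : p = q := by
  have key : ∀ p q : Cut A, (∀ a, p.lt a o ↔ q.lt a o) → ∀ a b, p.lt a b → q.lt a b := by
    intro p q h a b hab
    by_contra hba
    rw [q.not_lt (p.ne hab)] at hba
    by_cases ha : p.lt a o
    · have hb := q.trans hba ((h a).1 ha)
      exact (p.sbtw hab ((h b).2 hb)).not_sbtw (q.sbtw hba ((h a).1 ha)).cyclic_right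
    · rcases eq_or_ne a o with rfl | hao
      · exact p.asymm hab ((h b).2 hba)
      · have h1 := (p.not_lt hao).1 ha
        have h2 : ¬ q.lt b o := fun h' => p.asymm (p.trans h1 hab) ((h b).2 h')
        rcases eq_or_ne b o with rfl | hbo
        · exact p.asymm h1 hab
        · exact (p.sbtw h1 hab).not_sbtw (q.sbtw ((q.not_lt hbo).1 h2) hba).cyclic_left
  exact ext (key p q h) (key q p fun a => (h a).symm)

/-- The linear order on cuts, by distance from a base point. -/
noncomputable abbrev linearOrder (o : A) : LinearOrder (Cut A) where
  le p q := {a | q.lt a o} ⊆ {a | p.lt a o}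
  le_refl p := Set.Subset.rfl
  le_trans p q r h h' := h'.trans h
  le_antisymm p q h h' := eq_of_lt_base_iff o fun a => ⟨fun x => h' x, fun x => h x⟩
  le_total p q := subset_total o q p
  toDecidableLE := Classical.decRel _

theorem linearOrder_lt_iff (o : A) {p q : Cut A} :
    (linearOrder o).lt p q ↔ ∃ a, p.lt a o ∧ q.lt o a := by
  let _ := linearOrder o
  change p < q ↔ _
  rw [← not_le]
  change ¬ ({a | p.lt a o} ⊆ {a | q.lt a o}) ↔ _
  rw [Set.not_subset]
  exact exists_congr fun a => and_congr_right fun h => q.not_lt (p.ne h)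

/-- The circular order on cuts. -/
noncomputable abbrev circularOrder (o : A) : CircularOrder (Cut A) :=
  @LinearOrder.toCircularOrder _ (linearOrder o)

/-- Points that witness the circular order of three cuts. -/
def Separated (p q r : Cut A) : Prop := ∃ a b c, p.lt a b ∧ p.lt b c ∧ q.lt b c ∧ q.lt c a ∧
  r.lt c a ∧ r.lt a b

theorem Separated.cyclic {p q r : Cut A} (h : Separated p q r) : Separated q r p := by
  obtain ⟨a, b, c, h1, h2, h3, h4, h5, h6⟩ := h
  exact ⟨b, c, a, h3, h4, h5, h6, h1, h2⟩

/-- The witnesses are a point between `p` and `q`, a point between `q` and `r`, and `o` itself. -/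
theorem separated_of_lt (o : A) {p q r : Cut A} (h : (linearOrder o).lt p q)
    (h' : (linearOrder o).lt q r) : Separated p q r := by
  let _ := linearOrder o
  obtain ⟨a, hpa, hqa⟩ := (linearOrder_lt_iff o).1 h
  obtain ⟨b, hqb, hrb⟩ := (linearOrder_lt_iff o).1 h'
  have h1 := q.sbtw hqb hqa
  have hpb : p.lt b o := le_of_lt (show p < q from h) hqb
  have hra : r.lt o a := by
    rw [← r.not_lt (p.ne hpa)]
    exact fun h => q.asymm hqa (le_of_lt (show q < r from h') h)
  refine ⟨a, b, o, ?_, hpb, hqb, hqa, hra, ?_⟩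
  · have := p.sbtw_iff.1 h1
    have := p.asymm hpb
    have := p.asymm hpa
    tauto
  · have := r.sbtw_iff.1 h1
    have := r.asymm hrb
    have := r.asymm hra
    tauto

theorem Separated.sbtw_of_base (o : A) {p q r : Cut A} {a b c : A} (h1 : p.lt a b) (h2 : p.lt b c)
    (h3 : q.lt b c) (h4 : q.lt c a) (h5 : r.lt c a) (h6 : r.lt a b)
    (ho : o = c ∨ SBtw.sbtw c o a) : (circularOrder o).sbtw p q r := by
  change ((linearOrder o).lt p q ∧ (linearOrder o).lt q r) ∨
    ((linearOrder o).lt q r ∧ (linearOrder o).lt r p) ∨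
    ((linearOrder o).lt r p ∧ (linearOrder o).lt p q)
  simp only [linearOrder_lt_iff]
  rcases ho with rfl | ho
  · exact Or.inl ⟨⟨a, p.trans h1 h2, h4⟩, ⟨b, h3, r.trans h5 h6⟩⟩
  · have hq := q.lt_of_sbtw_left ho h4
    have hr := r.lt_of_sbtw_left ho h5
    have hqr : ∃ a, q.lt a o ∧ r.lt o a := ⟨b, q.trans h3 hq.1, r.trans hr.2 h6⟩
    by_cases hp : p.lt a o
    · exact Or.inl ⟨⟨a, hp, hq.2⟩, hqr⟩
    · have hp' := (p.not_lt ho.ne_right.symm).1 hp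
      exact Or.inr (Or.inl ⟨hqr, ⟨c, hr.1, p.trans hp' (p.trans h1 h2)⟩⟩)

/-- `Separated` does not mention `o`, so the circular order on cuts is independent of the base point
and invariant under automorphisms of `A`. -/
theorem separated_iff (o : A) {p q r : Cut A} :
    (circularOrder o).sbtw p q r ↔ Separated p q r := by
  constructor
  · rintro (⟨h, h'⟩ | ⟨h, h'⟩ | ⟨h, h'⟩)
    · exact separated_of_lt o h h'
    · exact (separated_of_lt o h h').cyclic.cyclic
    · exact (separated_of_lt o h h').cyclic
  · rintro ⟨a, b, c, h1, h2, h3, h4, h5, h6⟩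
    -- The three witnesses divide the circular order into three half-open arcs; by cyclic symmetry
    -- `o` may be taken to lie in the arc from `c` to `a`.
    have ho : (o = c ∨ SBtw.sbtw c o a) ∨ (o = a ∨ SBtw.sbtw a o b) ∨
        (o = b ∨ SBtw.sbtw b o c) := by
      rcases eq_or_ne o a with h | ha
      · exact Or.inr (Or.inl (Or.inl h))
      rcases eq_or_ne o b with h | hb
      · exact Or.inr (Or.inr (Or.inl h))
      rcases eq_or_ne o c with h | hc
      · exact Or.inl (Or.inl h)
      by_cases h : p.lt a o
      · by_cases h' : p.lt o b
        · exact Or.inr (Or.inl (Or.inr (p.sbtw h h')))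
        · rw [p.not_lt hb] at h'
          by_cases h'' : p.lt o c
          · exact Or.inr (Or.inr (Or.inr (p.sbtw h' h'')))
          · rw [p.not_lt hc] at h''
            exact Or.inl (Or.inr (p.sbtw (p.trans h1 h2) h'').cyclic_left)
      · rw [p.not_lt ha.symm] at h
        exact Or.inl (Or.inr (p.sbtw h (p.trans h1 h2)).cyclic_right)
    have hcyc : ∀ {p q r : Cut A}, (circularOrder o).sbtw p q r → (circularOrder o).sbtw q r p :=
      fun h => @sbtw_cyclic_left _ (circularOrder o).toCircularPreorder _ _ _ h
    rcases ho with ho | ho | ho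
    · exact Separated.sbtw_of_base o h1 h2 h3 h4 h5 h6 ho
    · exact hcyc (hcyc (Separated.sbtw_of_base o h3 h4 h5 h6 h1 h2 ho))
    · exact hcyc (Separated.sbtw_of_base o h5 h6 h1 h2 h3 h4 ho)

end Cut

/-- The order topology of a compact linear order is the interval topology of the associated
circular order. -/
theorem eq_circularIntervalTopology_of_orderTopology (X : Type*) [t : TopologicalSpace X]
    [LinearOrder X] [OrderTopology X] [CompactSpace X] [Nonempty X] :
    t = @circularIntervalTopology X (LinearOrder.toCircularOrder X) := by
  let _ := LinearOrder.toCircularOrder X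
  have hs : ∀ a x b : X, sbtw a x b ↔ (a < x ∧ x < b) ∨ (x < b ∧ b < a) ∨ (b < a ∧ a < x) :=
    fun a x b => Iff.rfl
  have hle : ∀ a b : X, a ≤ b → closedArc a b = Set.Icc a b := fun a b hab => by
    ext x
    simp only [closedArc, hs, Set.mem_Icc, Set.mem_ofPred_eq]
    grind
  have hgt : ∀ a b : X, b < a → closedArc a b = Set.Iic b ∪ Set.Ici a := fun a b hab => by
    ext x
    simp only [closedArc, hs, Set.mem_union, Set.mem_Iic, Set.mem_Ici, Set.mem_ofPred_eq]
    grind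
  refine le_antisymm (le_generateFrom ?_) ?_
  · rintro _ ⟨a, b, rfl⟩
    rw [isOpen_compl_iff]
    rcases le_or_gt a b with hab | hab
    · rw [hle a b hab]
      exact isClosed_Icc
    · rw [hgt a b hab]
      exact isClosed_Iic.union isClosed_Ici
  · obtain ⟨l, -, hl⟩ := (isCompact_univ (X := X)).exists_isLeast Set.univ_nonempty
    obtain ⟨m, -, hm⟩ := (isCompact_univ (X := X)).exists_isGreatest Set.univ_nonempty
    rw [OrderTopology.topology_eq_generate_intervals (α := X)]
    refine le_generateFrom ?_
    rintro _ ⟨a, rfl | rfl⟩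
    · refine TopologicalSpace.isOpen_generateFrom_of_mem ⟨l, a, ?_⟩
      rw [hle l a (hl (Set.mem_univ a))]
      ext x
      have := hl (Set.mem_univ x)
      simp only [Set.mem_Ioi, Set.mem_compl_iff, Set.mem_Icc]
      grind
    · refine TopologicalSpace.isOpen_generateFrom_of_mem ⟨a, m, ?_⟩
      rw [hle a m (hm (Set.mem_univ a))]
      ext x
      have := hm (Set.mem_univ x)
      simp only [Set.mem_Iio, Set.mem_compl_iff, Set.mem_Icc]
      grind

/-- Rays are unions of the clopen sets `{q | q.lt a b}`, so the compact topology of cuts refines the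
order topology; as the latter is Hausdorff, they coincide. -/
theorem Cut.orderTopology {A : Type*} [CircularOrder A] (o : A) :
    @OrderTopology (Cut A) _ (Cut.linearOrder o).toPreorder := by
  let _ := Cut.linearOrder o
  have h1 : ∀ p q : Cut A, p < q ↔ ∃ a, p.lt a o ∧ q.lt o a := fun p q =>
    Cut.linearOrder_lt_iff o
  have hle : (inferInstance : TopologicalSpace (Cut A)) ≤ Preorder.topology (Cut A) := by
    refine le_generateFrom ?_
    rintro _ ⟨p, rfl | rfl⟩
    · have : Set.Ioi p = ⋃ a ∈ {a | p.lt a o}, {q | q.lt o a} := by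
        ext q
        simp [h1]
      rw [this]
      exact isOpen_biUnion fun a _ => (Cut.isClopen_lt o a).2
    · have : Set.Iio p = ⋃ a ∈ {a | p.lt o a}, {q | q.lt a o} := by
        ext q
        simp [h1, and_comm]
      rw [this]
      exact isOpen_biUnion fun a _ => (Cut.isClopen_lt a o).2
  have ht2 : @T2Space (Cut A) (Preorder.topology (Cut A)) := by
    let _ := Preorder.topology (Cut A)
    have : OrderTopology (Cut A) := ⟨rfl⟩
    infer_instance
  refine ⟨le_antisymm hle fun U hU => ?_⟩
  have hK : IsCompact Uᶜ := (isClosed_compl_iff.2 hU).isCompact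
  have hK' := @IsCompact.image _ _ _ (Preorder.topology (Cut A)) _ id hK
    (continuous_id_iff_le.2 hle)
  rw [Set.image_id] at hK'
  exact (@isClosed_compl_iff _ (Preorder.topology (Cut A)) _).1
    (@IsCompact.isClosed _ (Preorder.topology (Cut A)) ht2 _ hK')

/-! ### Groups of automorphisms of a circular order -/

/-- The action preserves the circular order. -/
class IsCircularAction (G A : Type*) [Group G] [CircularOrder A] [MulAction G A] : Prop where
  smul_sbtw : ∀ (g : G) {a b c : A}, sbtw a b c → sbtw (g • a) (g • b) (g • c)

/-- The topology of the group is that of pointwise convergence on the discrete set `A`. -/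
class IsPointwiseAction (G A : Type*) [Group G] [TopologicalSpace G] [MulAction G A] : Prop where
  isOpen_smul_eq : ∀ a b : A, IsOpen {g : G | g • a = b}
  exists_finset_of_mem_nhds : ∀ U ∈ 𝓝 (1 : G), ∃ F : Finset A, ∀ g : G,
    (∀ a ∈ F, g • a = a) → g ∈ U

/-- The circular order has no gaps. -/
class DenseCircularOrder (A : Type*) [CircularOrder A] : Prop where
  exists_sbtw : ∀ {a b : A}, a ≠ b → ∃ c, sbtw a c b

/-- The group is transitive, and its elements supported in an arc are transitive on the arc. -/
class IsArcTransitive (G A : Type*) [Group G] [CircularOrder A] [MulAction G A] : Prop where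
  exists_smul_eq : ∀ a b : A, ∃ g : G, g • a = b
  exists_smul_eq_of_arc : ∀ {p q x y : A}, sbtw p x q → sbtw p y q →
    ∃ g : G, g • x = y ∧ ∀ c, ¬ sbtw p c q → g • c = c

/-! ### Points in arcs of a dense circular order -/

section DenseOrder

variable {A : Type*} [CircularOrder A] [DenseCircularOrder A]

theorem exists_seq_arc {a b : A} (hab : a ≠ b) :
    ∃ c : ℕ → A, (∀ i, sbtw a (c i) b) ∧ ∀ i j, i < j → sbtw a (c i) (c j) := by
  obtain ⟨c₀, h₀⟩ := DenseCircularOrder.exists_sbtw hab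
  have hnext : ∀ x : {x : A // sbtw a x b}, ∃ y : {x : A // sbtw a x b}, sbtw a x.1 y.1 :=
    fun x => by
      obtain ⟨y, hy⟩ := DenseCircularOrder.exists_sbtw x.2.ne_right
      exact ⟨⟨y, x.2.trans_left hy⟩,
        sbtw_of_cutLT (Or.inr x.2.cyclic_right) (Or.inr hy.cyclic_right)⟩
  choose f hf using hnext
  let c : ℕ → {x : A // sbtw a x b} := fun n => f^[n] ⟨c₀, h₀⟩
  have : IsTrans {x : A // sbtw a x b} fun x y => sbtw a x.1 y.1 :=
    ⟨fun _ _ _ h h' => h.trans_right h'⟩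
  refine ⟨fun n => (c n).1, fun n => (c n).2, fun i j hij => ?_⟩
  refine Nat.rel_of_forall_rel_succ_of_lt (fun x y : {x : A // sbtw a x b} => sbtw a x.1 y.1)
    (f := c) (fun n => ?_) hij
  simp only [c, Function.iterate_succ_apply']
  exact hf _

theorem exists_sbtw_sbtw {a b c : A} (hb : a ≠ b) (hc : a ≠ c) : ∃ d, sbtw a d b ∧ sbtw a d c := by
  rcases eq_or_ne b c with rfl | hbc
  · obtain ⟨d, hd⟩ := DenseCircularOrder.exists_sbtw hb
    exact ⟨d, hd, hd⟩
  · rcases sbtw_total hb hbc hc.symm with h | h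
    · obtain ⟨d, hd⟩ := DenseCircularOrder.exists_sbtw hb
      exact ⟨d, hd, hd.trans_right h⟩
    · obtain ⟨d, hd⟩ := DenseCircularOrder.exists_sbtw hc
      exact ⟨d, hd.trans_right h.cyclic_right, hd⟩

end DenseOrder

/-! ### From arc-transitivity to ultrahomogeneity -/

section Homogeneity

variable {G A : Type*} [Group G] [CircularOrder A] [MulAction G A] [IsCircularAction G A]

theorem smul_sbtw_iff (g : G) {a b c : A} : sbtw (g • a) (g • b) (g • c) ↔ sbtw a b c :=
  ⟨fun h => by simpa using IsCircularAction.smul_sbtw g⁻¹ h, IsCircularAction.smul_sbtw g⟩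

variable [IsArcTransitive G A]

/-- The points are moved one at a time. After `g₁` takes the head `x` to `y`, the remaining targets
are pulled back by `g₁⁻¹` and the induction works in the smaller arc from `x` to `z`, whose endpoint
`x` stays fixed. -/
theorem exists_smul_list_eq_of_arc (z : A) (l l' : List A) (q : A) (hlen : l.length = l'.length)
    (hl : l.Pairwise (sbtw z)) (hl' : l'.Pairwise (sbtw z)) (hq : ∀ x ∈ l, sbtw q x z)
    (hq' : ∀ x ∈ l', sbtw q x z) :
    ∃ g : G, l.map (g • ·) = l' ∧ ∀ c, ¬ sbtw q c z → g • c = c := by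
  induction l generalizing l' q with
  | nil =>
    obtain rfl : l' = [] := List.length_eq_zero_iff.1 hlen.symm
    exact ⟨1, rfl, fun c _ => one_smul _ c⟩
  | cons x t ih =>
    obtain _ | ⟨y, t'⟩ := l'
    · simp at hlen
    obtain ⟨g₁, hg₁, hfix₁⟩ := IsArcTransitive.exists_smul_eq_of_arc (G := G)
      (hq x List.mem_cons_self) (hq' y List.mem_cons_self)
    have hy : g₁⁻¹ • y = x := by rw [← hg₁, inv_smul_smul]
    have hz : g₁⁻¹ • z = z := by
      rw [inv_smul_eq_iff]
      exact (hfix₁ z sbtw_irrefl_right).symm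
    rw [List.pairwise_cons] at hl hl'
    have hmove : ∀ {u v : A}, sbtw z u v → sbtw z (g₁⁻¹ • u) (g₁⁻¹ • v) := fun h => by
      have := IsCircularAction.smul_sbtw g₁⁻¹ h
      rwa [hz] at this
    obtain ⟨g₂, hg₂, hfix₂⟩ := ih (t'.map (g₁⁻¹ • ·)) x (by simpa using hlen) hl.2
      (List.pairwise_map.2 (hl'.2.imp hmove)) (fun w hw => (hl.1 w hw).cyclic_left) (fun w hw => by
        obtain ⟨v, hv, rfl⟩ := List.mem_map.1 hw
        have := hmove (hl'.1 v hv)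
        rw [hy] at this
        exact this.cyclic_left)
    refine ⟨g₁ * g₂, ?_, fun c hc => ?_⟩
    · rw [List.map_cons, mul_smul, hfix₂ x sbtw_irrefl_left, hg₁]
      congr 1
      have : t.map (fun w => (g₁ * g₂) • w) = (t.map (g₂ • ·)).map (g₁ • ·) := by
        simp [mul_smul]
      rw [this, hg₂]
      simp [Function.comp_def]
    · rw [mul_smul, hfix₂ c fun h => hc ((hq x List.mem_cons_self).trans_left h), hfix₁ c hc]

variable [DenseCircularOrder A]

theorem exists_smul_list_eq (p q : Cut A) (l l' : List A) (hlen : l.length = l'.length)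
    (hl : l.Pairwise p.lt) (hl' : l'.Pairwise q.lt) : ∃ g : G, l.map (g • ·) = l' := by
  obtain _ | ⟨z, t⟩ := l
  · exact ⟨1, (List.length_eq_zero_iff.1 hlen.symm).symm⟩
  obtain _ | ⟨z', t'⟩ := l'
  · simp at hlen
  obtain ⟨g₁, rfl⟩ := IsArcTransitive.exists_smul_eq (G := G) z z'
  rw [List.pairwise_cons] at hl hl'
  have h1 : t.Pairwise (sbtw z) := hl.2.imp_of_mem fun ha _ h => p.sbtw (hl.1 _ ha) h
  have h2 : t'.Pairwise (sbtw (g₁ • z)) := hl'.2.imp_of_mem fun ha _ h => q.sbtw (hl'.1 _ ha) h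
  -- The point `r` is taken just after `g₁ • z`, before the first remaining point of either list, so
  -- that the arc from `r` to `g₁ • z` contains both. If the lists are exhausted, any `r` will do.
  have h3 : ∃ r, (∀ x ∈ t.map (g₁ • ·), sbtw r x (g₁ • z)) ∧ ∀ x ∈ t', sbtw r x (g₁ • z) := by
    obtain _ | ⟨x, s⟩ := t
    · exact ⟨z, by simp, by
        obtain rfl : t' = [] := List.length_eq_zero_iff.1 (by simpa using hlen.symm)
        simp⟩
    obtain _ | ⟨y, s'⟩ := t'
    · simp at hlen
    have hx : g₁ • z ≠ g₁ • x := fun h => p.ne (hl.1 x List.mem_cons_self) (smul_left_cancel _ h)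
    obtain ⟨r, hr, hr'⟩ := exists_sbtw_sbtw hx (q.ne (hl'.1 y List.mem_cons_self))
    rw [List.pairwise_cons] at h1 h2
    refine ⟨r, fun w hw => ?_, fun w hw => ?_⟩
    · rw [List.map_cons] at hw
      rcases List.mem_cons.1 hw with rfl | hw
      · exact hr.cyclic_left
      · obtain ⟨v, hv, rfl⟩ := List.mem_map.1 hw
        exact (hr.trans_right (IsCircularAction.smul_sbtw g₁ (h1.1 v hv))).cyclic_left
    · rcases List.mem_cons.1 hw with rfl | hw
      · exact hr'.cyclic_left
      · exact (hr'.trans_right (h2.1 w hw)).cyclic_left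
  obtain ⟨r, hr, hr'⟩ := h3
  obtain ⟨g₂, hg₂, hfix⟩ := exists_smul_list_eq_of_arc (G := G) (g₁ • z) (t.map (g₁ • ·)) t' r
    (by simpa using hlen) (List.pairwise_map.2 (h1.imp fun h => IsCircularAction.smul_sbtw g₁ h))
    h2 hr hr'
  refine ⟨g₂ * g₁, ?_⟩
  rw [List.map_cons, mul_smul, hfix _ sbtw_irrefl_right, ← hg₂]
  simp [mul_smul]

/-- The action is ultrahomogeneous. -/
theorem exists_smul_eq_on (G : Type*) [Group G] [MulAction G A] [IsCircularAction G A]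
    [IsArcTransitive G A] (p q : Cut A) (F : Finset A) (t : A → A)
    (ht : ∀ a ∈ F, ∀ b ∈ F, p.lt a b → q.lt (t a) (t b)) : ∃ g : G, ∀ a ∈ F, g • a = t a := by
  let _ := p.toLinearOrder
  let l := F.sort (· ≤ ·)
  have hl : l.Pairwise p.lt := (Finset.sortedLT_sort F).pairwise
  have hmem : ∀ a, a ∈ l ↔ a ∈ F := fun a => Finset.mem_sort (· ≤ ·)
  obtain ⟨g, hg⟩ := exists_smul_list_eq (G := G) p q l (l.map t) (by simp) hl
    (List.pairwise_map.2 (hl.imp_of_mem fun ha hb h => ht _ ((hmem _).1 ha) _ ((hmem _).1 hb) h))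
  exact ⟨g, fun a ha => List.map_inj_left.1 hg a ((hmem a).2 ha)⟩

end Homogeneity

/-! ### The action on cuts -/

namespace Cut

section Action

variable {G A : Type*} [Group G] [CircularOrder A] [MulAction G A] [IsCircularAction G A]

instance : MulAction G (Cut A) where
  smul g p := ⟨fun a b => p.1 (g⁻¹ • a) (g⁻¹ • b), fun a b h => p.2.1 _ _ (by simpa using h),
    fun a b c => p.2.2.1 _ _ _, fun a b c h h' => (smul_sbtw_iff g⁻¹).1 (p.2.2.2 _ _ _ h h')⟩
  one_smul p := by
    refine Subtype.ext (funext fun a => funext fun b => ?_)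
    change p.1 ((1 : G)⁻¹ • a) ((1 : G)⁻¹ • b) = p.1 a b
    simp
  mul_smul g h p := by
    refine Subtype.ext (funext fun a => funext fun b => ?_)
    change p.1 ((g * h)⁻¹ • a) ((g * h)⁻¹ • b) = p.1 (h⁻¹ • g⁻¹ • a) (h⁻¹ • g⁻¹ • b)
    simp [mul_smul]

theorem smul_lt_iff (g : G) (p : Cut A) (a b : A) : (g • p).lt a b ↔ p.lt (g⁻¹ • a) (g⁻¹ • b) :=
  Iff.rfl

theorem smul_lt_smul_iff (g : G) (p : Cut A) (a b : A) : (g • p).lt (g • a) (g • b) ↔ p.lt a b := by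
  rw [smul_lt_iff, inv_smul_smul, inv_smul_smul]

/-- The comparison of `a` and `b` by `g • p` depends on `g` only through `g⁻¹ • a` and `g⁻¹ • b`,
which are locally constant in `g`. -/
instance [TopologicalSpace G] [IsPointwiseAction G A] : ContinuousSMul G (Cut A) where
  continuous_smul := by
    refine Continuous.subtype_mk (continuous_pi fun a => continuous_pi fun b => ?_) _
    change Continuous fun x : G × Cut A => x.2.1 (x.1⁻¹ • a) (x.1⁻¹ • b)
    rw [continuous_iff_continuousAt]
    rintro ⟨g, p⟩
    have hg : ∀ c : A, ∀ᶠ x : G × Cut A in 𝓝 (g, p), x.1⁻¹ • c = g⁻¹ • c := fun c => by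
      have : IsOpen {h : G | h • (g⁻¹ • c) = c} :=
        IsPointwiseAction.isOpen_smul_eq (g⁻¹ • c) c
      filter_upwards [(this.preimage continuous_fst).mem_nhds (by simp)] with x hx
      rw [inv_smul_eq_iff]
      exact hx.symm
    have hc : Continuous fun x : G × Cut A => x.2.1 (g⁻¹ • a) (g⁻¹ • b) :=
      (continuous_apply_apply _ _).comp (continuous_subtype_val.comp continuous_snd)
    refine (hc.tendsto (g, p)).congr' ?_
    filter_upwards [hg a, hg b] with x ha hb
    rw [ha, hb]

theorem isCOrderedSystem (G : Type*) [Group G] [MulAction G A] [IsCircularAction G A] [Nonempty A] :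
    IsCOrderedSystem G (Cut A) := by
  let o := Classical.arbitrary A
  refine ⟨circularOrder o, ?_, fun g p q r h => ?_⟩
  · let _ := linearOrder o
    have := orderTopology o
    exact eq_circularIntervalTopology_of_orderTopology (Cut A)
  · rw [separated_iff] at h ⊢
    obtain ⟨a, b, c, h⟩ := h
    refine ⟨g • a, g • b, g • c, ?_⟩
    simpa only [smul_lt_smul_iff] using h

end Action

/-! ### Basic neighbourhoods and shrinking in the space of cuts -/

variable {A : Type*} [CircularOrder A]

/-- The basic neighbourhood of a cut given by a finite set of points. -/
def nhd (p : Cut A) (F : Finset A) : Set (Cut A) := {q | ∀ a ∈ F, ∀ b ∈ F, p.lt a b → q.lt a b}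

theorem isClopen_nhd (p : Cut A) (F : Finset A) : IsClopen (p.nhd F) := by
  have : p.nhd F = ⋂ a ∈ F, ⋂ b ∈ F, {q | p.lt a b → q.lt a b} := by
    ext q
    simp [nhd]
  rw [this]
  refine isClopen_biInter_finset fun a _ => isClopen_biInter_finset fun b _ => ?_
  by_cases h : p.lt a b
  · simpa [h] using isClopen_lt a b
  · simp [h, isClopen_univ]

theorem mem_nhd_self (p : Cut A) (F : Finset A) : p ∈ p.nhd F := fun _ _ _ _ h => h

theorem lt_iff_of_mem_nhd {p q : Cut A} {F : Finset A} (h : q ∈ p.nhd F) {a b : A} (ha : a ∈ F)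
    (hb : b ∈ F) : q.lt a b ↔ p.lt a b := by
  refine ⟨fun h' => ?_, h a ha b hb⟩
  by_contra h''
  exact q.asymm h' (h b hb a ha ((p.not_lt (q.ne h')).1 h''))

/-- The sets `p.nhd F` are closed, directed downwards and intersect in `p` alone, so compactness
applies. -/
theorem exists_nhd_subset {p : Cut A} {U : Set (Cut A)} (hU : U ∈ 𝓝 p) : ∃ F, p.nhd F ⊆ U := by
  classical
  refine exists_subset_nhds_of_compactSpace (fun F F' => ⟨F ∪ F', ?_, ?_⟩)
    (fun F => (p.isClopen_nhd F).1) fun q hq => ?_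
  · exact fun q h a ha b hb => h a (Finset.mem_union_left _ ha) b (Finset.mem_union_left _ hb)
  · exact fun q h a ha b hb => h a (Finset.mem_union_right _ ha) b (Finset.mem_union_right _ hb)
  · have : q = p := by
      have h1 : ∀ a b, q.lt a b ↔ p.lt a b := fun a b =>
        lt_iff_of_mem_nhd (Set.mem_iInter.1 hq {a, b}) (by simp) (by simp)
      exact ext (fun a b => (h1 a b).1) fun a b => (h1 a b).2
    rwa [this]

/-- The number of points of a finite set before a given point. -/
noncomputable def rank (p : Cut A) (F : Finset A) (a : A) : ℕ := by
  classical exact (F.filter fun b => p.lt b a).card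

theorem rank_lt_rank (p : Cut A) {F : Finset A} {a b : A} (ha : a ∈ F) (h : p.lt a b) :
    p.rank F a < p.rank F b := by
  classical
  refine Finset.card_lt_card ⟨fun c hc => ?_, fun hs => ?_⟩
  · rw [Finset.mem_filter] at hc ⊢
    exact ⟨hc.1, p.trans hc.2 h⟩
  · exact p.irrefl a (Finset.mem_filter.1 (hs (Finset.mem_filter.2 ⟨ha, h⟩))).2

/-- The set `J n` consists of the cuts made between consecutive terms `x n` and `x (n + 1)` of a
monotone sequence. All other cuts order the arc between these terms alike, so it suffices to move a
given finite set `F`, in its `q`-order, into that arc. -/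
theorem hasShrinkableComplements (G : Type*) [Group G] [MulAction G A] [IsCircularAction G A]
    [IsArcTransitive G A] [DenseCircularOrder A] [Nontrivial A] :
    HasShrinkableComplements G (Cut A) := by
  obtain ⟨o, o', ho⟩ := exists_pair_ne A
  obtain ⟨x, -, hx⟩ := exists_seq_arc ho
  have hsucc : ∀ n, SBtw.sbtw o (x n) (x (n + 1)) := fun n => hx n _ n.lt_succ_self
  have hlt : ∀ i j, i < j → (before o).lt (x i) (x j) := fun i j h =>
    (before_lt _ _ _).2 (Or.inr (hx i j h))
  refine ⟨fun n => {p | p.lt (x (n + 1)) (x n)}, fun n => (isClopen_lt _ _).1,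
    (pairwise_disjoint_on _).2 fun m n hmn => Set.disjoint_left.2 fun p hm hn => ?_, ?_⟩
  · have h1 : SBtw.sbtw (x m) (x n) (x (n + 1)) :=
        (before o).sbtw (hlt _ _ hmn) (hlt _ _ n.lt_succ_self)
    have h2 : p.lt (x n) (x m) := by
      rcases (show m + 1 ≤ n from hmn).eq_or_lt with rfl | h
      · exact hm
      · have h3 := p.sbtw_iff.1 ((before o).sbtw (hlt _ _ m.lt_succ_self) (hlt _ _ h))
        have := p.asymm hm
        tauto
    have h3 := p.sbtw_iff.1 h1
    have := p.asymm h2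
    have := p.asymm hn
    tauto
  · rintro n U hU ⟨q, hq⟩
    obtain ⟨F, hF⟩ := exists_nhd_subset (hU.mem_nhds hq)
    obtain ⟨c, hc, hcc⟩ := exists_seq_arc (hsucc n).ne_right
    have hmono : ∀ a ∈ F, ∀ b ∈ F, q.lt a b →
        (before (x n)).lt (c (q.rank F a)) (c (q.rank F b)) := fun a ha b hb hab =>
      (before_lt _ _ _).2 (Or.inr (hcc _ _ (q.rank_lt_rank ha hab)))
    obtain ⟨g, hg⟩ := exists_smul_eq_on G q (before (x n)) F _ hmono
    refine ⟨g⁻¹, fun p hp => hF fun a ha b hb hab => ?_⟩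
    rw [smul_lt_iff, inv_inv, hg a ha, hg b hb]
    have h1 : p.lt (x n) (x (n + 1)) := (p.not_lt (hsucc n).ne_right.symm).1 hp
    exact (p.lt_of_sbtw_left (hcc _ _ (q.rank_lt_rank ha hab))
      (p.lt_of_sbtw_left (hc _) h1).1).2

end Cut

/-! ### Ramsey's theorem -/

/-- The infinite Ramsey theorem. -/
theorem exists_infinite_homogeneous {κ : Type*} [Finite κ] (n : ℕ) (c : Finset ℕ → κ) {X : Set ℕ}
    (hX : X.Infinite) : ∃ Y ⊆ X, Y.Infinite ∧ ∃ k, ∀ S : Finset ℕ, ↑S ⊆ Y → S.card = n →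
      c S = k := by
  induction n generalizing c X with
  | zero =>
    refine ⟨X, Set.Subset.rfl, hX, c ∅, fun S _ hS => ?_⟩
    rw [Finset.card_eq_zero.1 hS]
  | succ n ih =>
    have step : ∀ X : {X : Set ℕ // X.Infinite}, ∃ (x : ℕ) (k : κ) (Y : {X : Set ℕ // X.Infinite}),
        x ∈ X.1 ∧ Y.1 ⊆ X.1 ∧ (∀ y ∈ Y.1, x < y) ∧
          ∀ S : Finset ℕ, ↑S ⊆ Y.1 → S.card = n → c (insert x S) = k := by
      rintro ⟨X, hX⟩
      obtain ⟨x, hx⟩ := hX.nonempty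
      have hX' : (X \ Set.Iic x).Infinite := hX.sdiff (Set.finite_Iic x)
      obtain ⟨Y, hYX, hY, k, hk⟩ := ih (fun S => c (insert x S)) hX'
      exact ⟨x, k, ⟨Y, hY⟩, hx, fun y hy => (hYX hy).1, fun y hy => not_le.1 (hYX hy).2, hk⟩
    choose x k Y hxX hYX hxY hk using step
    let Z : ℕ → {X : Set ℕ // X.Infinite} := fun i => Y^[i] ⟨X, hX⟩
    have hZ : ∀ i, Z (i + 1) = Y (Z i) := fun i => Function.iterate_succ_apply' _ _ _
    have hanti : Antitone fun i => (Z i).1 := antitone_nat_of_succ_le fun i => by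
      simp only [hZ]
      exact hYX _
    have hmem : ∀ i j, i < j → x (Z j) ∈ (Y (Z i)).1 := fun i j hij => by
      rw [← hZ]
      exact hanti hij (hxX (Z j))
    have hmono : StrictMono fun i => x (Z i) := fun i j hij => hxY _ _ (hmem i j hij)
    -- The colour of a set of chosen points now depends only on its least element; the pigeonhole
    -- principle makes it constant.
    obtain ⟨k₀, hk₀⟩ := Finite.exists_infinite_fiber fun i => k (Z i)
    have hI : ((fun i => k (Z i)) ⁻¹' {k₀}).Infinite := Set.infinite_coe_iff.1 hk₀
    refine ⟨(fun i => x (Z i)) '' ((fun i => k (Z i)) ⁻¹' {k₀}), ?_,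
      hI.image hmono.injective.injOn, k₀, fun S hS hcard => ?_⟩
    · rintro _ ⟨i, -, rfl⟩
      exact hanti (Nat.zero_le i) (hxX (Z i))
    · have hne : S.Nonempty := Finset.card_pos.1 (by omega)
      obtain ⟨i, hi, hmin⟩ := hS (S.min'_mem hne)
      have h1 : x (Z i) ∈ S := by
        rw [show x (Z i) = _ from hmin]
        exact S.min'_mem hne
      rw [← Finset.insert_erase h1, hk (Z i) _ _ (by rw [Finset.card_erase_of_mem h1]; omega)]
      · exact hi
      · intro y hy
        rw [Finset.mem_coe, Finset.mem_erase] at hy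
        obtain ⟨j, -, rfl⟩ := hS hy.2
        refine hmem i j (hmono.lt_iff_lt.1 (lt_of_le_of_ne ?_ hy.1.symm))
        have := S.min'_le _ hy.2
        rwa [← hmin] at this

/-! ### Equivariant maps from the space of cuts to compact systems -/

section MapsToAll

theorem exists_finite_colouring {Y : Type*} [TopologicalSpace Y] [CompactSpace Y] (f : C(Y, ℝ))
    {ε : ℝ} (hε : 0 < ε) : ∃ (s : Finset ℤ) (col : Y → s),
      ∀ y y', col y = col y' → |f y - f y'| ≤ ε := by
  have h : ∀ y, ⌊f y / ε⌋ ∈ Finset.Icc ⌊-‖f‖ / ε⌋ ⌊‖f‖ / ε⌋ := fun y => by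
    have h1 := abs_le.1 (f.norm_coe_le_norm y)
    rw [Finset.mem_Icc]
    exact ⟨Int.floor_le_floor (by gcongr; exact h1.1), Int.floor_le_floor (by gcongr; exact h1.2)⟩
  refine ⟨_, fun y => ⟨_, h y⟩, fun y y' hyy => ?_⟩
  have h1 := Int.abs_sub_lt_one_of_floor_eq_floor (Subtype.ext_iff.1 hyy)
  rw [← sub_div, abs_div, abs_of_pos hε, div_lt_one hε] at h1
  exact h1.le

variable {G A : Type*} [Group G] [CircularOrder A] [MulAction G A]

/-- The group element `g` moves the points of the sequence `l` with indices in `S`, in increasing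
order, to the points of `F`, ordered by the cut `p`. -/
def Places (l : ℕ → A) (p : Cut A) (F : Finset A) (g : G) (S : Finset ℕ) : Prop :=
  ∃ i : A → ℕ, (∀ a ∈ F, ∀ b ∈ F, p.lt a b → i a < i b) ∧ i '' F = S ∧ ∀ a ∈ F, g • l (i a) = a

theorem Places.card_eq {l : ℕ → A} {p : Cut A} {F : Finset A} {g : G} {S : Finset ℕ}
    (h : Places l p F g S) : S.card = F.card := by
  classical
  obtain ⟨i, hi, hS, hg⟩ := h
  have hS' : S = F.image i := by
    rw [← Finset.coe_inj, ← hS, Finset.coe_image]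
  rw [hS']
  refine Finset.card_image_of_injOn fun a ha b hb hab => ?_
  rw [← hg a ha, ← hg b hb]
  exact congrArg (fun n => g • l n) hab

/-- Both index maps enumerate the same finite set increasingly along `F`, so they agree on `F`, and
hence so do `g⁻¹` and `g'⁻¹`. -/
theorem Places.mul_inv_smul {l : ℕ → A} {p : Cut A} {F : Finset A} {g g' : G} {S : Finset ℕ}
    (h : Places l p F g S) (h' : Places l p F g' S) {a : A} (ha : a ∈ F) :
    (g' * g⁻¹) • a = a := by
  obtain ⟨i, hi, hS, hg⟩ := h
  obtain ⟨i', hi', hS', hg'⟩ := h'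
  let _ := p.toLinearOrder
  have h1 : StrictMono fun a : F => i a.1 := fun a b hab => hi _ a.2 _ b.2 hab
  have h2 : StrictMono fun a : F => i' a.1 := fun a b hab => hi' _ a.2 _ b.2 hab
  have h3 : (fun a : F => i a.1) = fun a : F => i' a.1 := by
    rw [← StrictMono.range_inj h1 h2]
    have : ∀ j : A → ℕ, Set.range (fun a : F => j a.1) = j '' F := fun j => by
      ext n
      simp
    rw [this, this, hS, hS']
  have h4 : i a = i' a := congrFun h3 ⟨a, ha⟩
  have h5 : g⁻¹ • a = l (i a) := by rw [inv_smul_eq_iff, hg a ha]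
  rw [mul_smul, h5, h4, hg' a ha]

variable {Y : Type*} [TopologicalSpace Y] [CompactSpace Y] [MulAction G Y]

/-- The finite set `F` controls `f` up to `ε`. -/
def Controls (G : Type*) {A Y : Type*} [Group G] [MulAction G A] [TopologicalSpace Y]
    [MulAction G Y] (F : Finset A) (f : C(Y, ℝ)) (ε : ℝ) : Prop :=
  ∀ g : G, (∀ a ∈ F, g • a = a) → ∀ y : Y, |f (g • y) - f y| ≤ ε

/-- Translates of `f` vary continuously in the sup norm, and each neighbourhood of `1` contains the
pointwise stabilizer of a finite set. -/
theorem exists_controls {G A : Type*} [Group G] [MulAction G A] [MulAction G Y]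
    [TopologicalSpace G] [ContinuousSMul G Y] [IsPointwiseAction G A]
    (f : C(Y, ℝ)) {ε : ℝ} (hε : 0 < ε) : ∃ F : Finset A, Controls G F f ε := by
  have h1 : Continuous fun g : G => ‖actTranslate g f - f‖ :=
    ((continuous_actTranslate f).sub continuous_const).norm
  have h2 : ∀ᶠ g : G in 𝓝 1, ‖actTranslate g f - f‖ < ε := by
    refine h1.tendsto 1 |>.eventually (gt_mem_nhds ?_)
    have : actTranslate (1 : G) f = f := by
      ext y
      simp [actTranslate_apply]
    rwa [this, sub_self, norm_zero]
  obtain ⟨F, hF⟩ := IsPointwiseAction.exists_finset_of_mem_nhds (A := A) _ h2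
  exact ⟨F, fun g hg y =>
    ((actTranslate g f - f).norm_coe_le_norm y).trans (le_of_lt (hF g hg))⟩

/-- Because `F` controls `f`, the value `f (g • y)` depends up to `ε` only on the set `S` that `g`
places on `F`. Ramsey's theorem is applied to the rounded value. The bound `3 * ε` collects one `ε`
for each choice of representative and one for rounding. -/
theorem exists_infinite_places (l : ℕ → A) (p : Cut A) {F : Finset A} {f : C(Y, ℝ)} {ε : ℝ}
    (hε : 0 < ε) (hF : Controls G F f ε) (y : Y) {X : Set ℕ} (hX : X.Infinite) :
    ∃ X' ⊆ X, X'.Infinite ∧ ∀ (g g' : G) (S S' : Finset ℕ), ↑S ⊆ X' → ↑S' ⊆ X' →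
      Places l p F g S → Places l p F g' S' → |f (g • y) - f (g' • y)| ≤ 3 * ε := by
  classical
  obtain ⟨s, col, hcol⟩ := exists_finite_colouring f hε
  -- Sets placed by no group element receive the irrelevant colour `col y`.
  let c : Finset ℕ → s := fun S =>
    if h : ∃ g : G, Places l p F g S then col (h.choose • y) else col y
  obtain ⟨X', hX'X, hX', k, hk⟩ := exists_infinite_homogeneous F.card c hX
  have key : ∀ (g : G) (S : Finset ℕ), ↑S ⊆ X' → Places l p F g S →
      ∃ y', col y' = k ∧ |f (g • y) - f y'| ≤ ε := by
    intro g S hS h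
    have hex : ∃ g : G, Places l p F g S := ⟨g, h⟩
    refine ⟨hex.choose • y, ?_, ?_⟩
    · rw [← hk S hS h.card_eq]
      simp only [c, dif_pos hex]
    · have := hF (g * hex.choose⁻¹) (fun a ha => hex.choose_spec.mul_inv_smul h ha)
        (hex.choose • y)
      rwa [mul_smul, inv_smul_smul] at this
  refine ⟨X', hX'X, hX', fun g g' S S' hS hS' h h' => ?_⟩
  obtain ⟨y₁, h1, h1'⟩ := key g S hS h
  obtain ⟨y₂, h2, h2'⟩ := key g' S' hS' h'
  have h3 := hcol y₁ y₂ (h1.trans h2.symm)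
  rw [abs_le] at *
  constructor <;> linarith

theorem exists_infinite_places_finset {ι : Type*} (s : Finset ι) (l : ℕ → A) (p : ι → Cut A)
    (F : ι → Finset A) (f : ι → C(Y, ℝ)) (ε : ι → ℝ) (hε : ∀ i, 0 < ε i)
    (hF : ∀ i, Controls G (F i) (f i) (ε i)) (y : Y) :
    ∃ X : Set ℕ, X.Infinite ∧ ∀ i ∈ s, ∀ (g g' : G) (S S' : Finset ℕ), ↑S ⊆ X → ↑S' ⊆ X →
      Places l (p i) (F i) g S → Places l (p i) (F i) g' S' →
        |f i (g • y) - f i (g' • y)| ≤ 3 * ε i := by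
  classical
  induction s using Finset.induction_on with
  | empty => exact ⟨Set.univ, Set.infinite_univ, by simp⟩
  | insert i s _ ih =>
    obtain ⟨X, hX, h⟩ := ih
    obtain ⟨X', hX'X, hX', h'⟩ := exists_infinite_places l (p i) (hε i) (hF i) y hX
    refine ⟨X', hX', fun j hj => ?_⟩
    rcases Finset.mem_insert.1 hj with rfl | hj
    · exact h'
    · exact fun g g' S S' hS hS' => h j hj g g' S S' (hS.trans hX'X) (hS'.trans hX'X)

theorem eq_of_forall_continuousMap_eq {Y : Type*} [TopologicalSpace Y] [CompactSpace Y] [T2Space Y]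
    {x y : Y} (h : ∀ f : C(Y, ℝ), f x = f y) : x = y := by
  by_contra hne
  obtain ⟨f, hf, hf', -⟩ := exists_continuous_zero_one_of_isClosed (isClosed_singleton (x := x))
    (isClosed_singleton (x := y)) (Set.disjoint_singleton.2 hne)
  have h0 := hf (Set.mem_singleton x)
  have h1 := hf' (Set.mem_singleton y)
  rw [h f, h1] at h0
  exact one_ne_zero h0

/-- Each requirement is a closed condition on `Φ` in the compact product `Cut A → Y`, so only
finitely many need to be met at once. For these, ultrahomogeneity lets `h p` spread the relevant
points, in their `p`-order, along a homogeneous subsequence of `l`, and `Φ p` is `(h p)⁻¹ • y`. -/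
theorem exists_approx_equivariant [T2Space Y] [Nonempty Y] [TopologicalSpace G]
    [ContinuousSMul G Y] [IsCircularAction G A] [IsArcTransitive G A]
    [DenseCircularOrder A] [Nontrivial A] (F : C(Y, ℝ) → {ε : ℝ // 0 < ε} → Finset A)
    (hF : ∀ f ε, Controls G (F f ε) f ε.1) :
    ∃ Φ : Cut A → Y, ∀ (g : G) (p q : Cut A) (f : C(Y, ℝ)) (ε : {ε : ℝ // 0 < ε}),
      g • p ∈ q.nhd (F f ε) → |f (g • Φ p) - f (Φ q)| ≤ 3 * ε.1 := by
  classical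
  have hcl : ∀ i : G × Cut A × Cut A × C(Y, ℝ) × {ε : ℝ // 0 < ε}, IsClosed {Φ : Cut A → Y |
      i.1 • i.2.1 ∈ i.2.2.1.nhd (F i.2.2.2.1 i.2.2.2.2) →
        |i.2.2.2.1 (i.1 • Φ i.2.1) - i.2.2.2.1 (Φ i.2.2.1)| ≤ 3 * i.2.2.2.2.1} := fun i => by
    refine isClosed_imp isOpen_const (isClosed_le ?_ continuous_const)
    exact ((i.2.2.2.1.continuous.comp ((continuous_apply _).const_smul _)).sub
      (i.2.2.2.1.continuous.comp (continuous_apply _))).abs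
  obtain ⟨Φ, hΦ⟩ := CompactSpace.iInter_nonempty hcl fun s => by
    obtain ⟨o, o', ho⟩ := exists_pair_ne A
    obtain ⟨l, -, hl⟩ := exists_seq_arc ho
    let y : Y := Classical.arbitrary Y
    obtain ⟨X, hX, hXs⟩ := exists_infinite_places_finset (G := G) s l (fun i => i.2.2.1)
      (fun i => F i.2.2.2.1 i.2.2.2.2) (fun i => i.2.2.2.1) (fun i => i.2.2.2.2.1)
      (fun i => i.2.2.2.2.2) (fun i => hF _ _) y
    have := hX.to_subtype
    let x : ℕ ↪o ℕ := Nat.orderEmbeddingOfSet X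
    have hx : ∀ n, x n ∈ X := fun n => by
      rw [← Nat.orderEmbeddingOfSet_range X]
      exact ⟨n, rfl⟩
    let B : Finset A := s.biUnion fun i =>
      F i.2.2.2.1 i.2.2.2.2 ∪ (F i.2.2.2.1 i.2.2.2.2).image fun a => i.1⁻¹ • a
    have hB : ∀ i ∈ s, ∀ a ∈ F i.2.2.2.1 i.2.2.2.2, a ∈ B ∧ i.1⁻¹ • a ∈ B := fun i hi a ha =>
      ⟨Finset.mem_biUnion.2 ⟨i, hi, Finset.mem_union_left _ ha⟩,
        Finset.mem_biUnion.2 ⟨i, hi, Finset.mem_union_right _ (Finset.mem_image_of_mem _ ha)⟩⟩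
    have hex : ∀ p : Cut A, ∃ h : G, ∀ a ∈ B, h • a = l (x (p.rank B a)) := fun p =>
      exists_smul_eq_on G p (Cut.before o) B _ fun a ha b hb hab =>
        (Cut.before_lt _ _ _).2 (Or.inr (hl _ _ (x.strictMono (p.rank_lt_rank ha hab))))
    choose h hh using hex
    refine ⟨fun p => (h p)⁻¹ • y, Set.mem_iInter₂.2 fun i hi hmem => ?_⟩
    obtain ⟨g, p, q, f, ε⟩ := i
    have hsub : ∀ (i : A → ℕ) (C : Finset A), ↑(C.image fun a => x (i a)) ⊆ X := fun i C n hn => by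
      obtain ⟨a, -, rfl⟩ := Finset.mem_image.1 (Finset.mem_coe.1 hn)
      exact hx _
    -- Both elements place homogeneous index sets on `F f ε` in its `q`-order; for the first one
    -- this is what `g • p ∈ q.nhd (F f ε)` says.
    have := hXs _ hi (g * (h p)⁻¹) (h q)⁻¹ ((F f ε).image fun a => x (p.rank B (g⁻¹ • a)))
      ((F f ε).image fun a => x (q.rank B a)) (hsub _ _) (hsub _ _)
      ⟨_, fun a ha b hb hab => ?_, (Finset.coe_image ..).symm, fun a ha => ?_⟩
      ⟨_, fun a ha b hb hab => ?_, (Finset.coe_image ..).symm, fun a ha => ?_⟩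
    · rwa [mul_smul] at this
    · exact x.strictMono (p.rank_lt_rank (hB _ hi a ha).2 (hmem a ha b hb hab))
    · rw [← hh p _ (hB _ hi a ha).2, mul_smul, inv_smul_smul, smul_inv_smul]
    · exact x.strictMono (q.rank_lt_rank (hB _ hi a ha).1 hab)
    · rw [← hh q _ (hB _ hi a ha).1, inv_smul_smul]
  exact ⟨Φ, fun g p q f ε h => Set.mem_iInter.1 hΦ (g, p, q, f, ε) h⟩

/-- The approximate estimate for `q = g • p` and all `ε` is exact equivariance; for `g = 1` it is
continuity. -/
theorem exists_equivariant [T2Space Y] [Nonempty Y] [TopologicalSpace G]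
    [ContinuousSMul G Y] [IsCircularAction G A] [IsPointwiseAction G A] [IsArcTransitive G A]
    [DenseCircularOrder A] [Nontrivial A] :
    ∃ Φ : Cut A → Y, Continuous Φ ∧ ∀ (g : G) p, Φ (g • p) = g • Φ p := by
  choose F hF using fun (f : C(Y, ℝ)) (ε : {ε : ℝ // 0 < ε}) =>
    exists_controls (G := G) (A := A) f ε.2
  obtain ⟨Φ, hΦ⟩ := exists_approx_equivariant F hF
  refine ⟨Φ, ?_, fun g p => eq_of_forall_continuousMap_eq fun f => ?_⟩
  · have hemb : IsClosedEmbedding fun (y : Y) (f : C(Y, ℝ)) => f y :=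
      Continuous.isClosedEmbedding (continuous_pi fun f => f.continuous)
        fun x y h => eq_of_forall_continuousMap_eq (congrFun h)
    rw [hemb.isInducing.continuous_iff]
    refine continuous_pi fun f => continuous_iff_continuousAt.2 fun p => ?_
    refine Metric.continuousAt_iff'.2 fun ε hε => ?_
    filter_upwards [(p.isClopen_nhd (F f ⟨ε / 4, by linarith⟩)).2.mem_nhds (p.mem_nhd_self _)]
      with q hq
    have := hΦ 1 q p f ⟨ε / 4, by linarith⟩ (by rwa [one_smul])
    rw [one_smul] at this
    rw [Function.comp_apply, Function.comp_apply, Real.dist_eq]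
    linarith
  · have : ∀ ε > 0, |f (g • Φ p) - f (Φ (g • p))| ≤ ε := fun ε hε => by
      have := hΦ g p (g • p) f ⟨ε / 3, by linarith⟩ (Cut.mem_nhd_self _ _)
      linarith
    have h0 := le_of_forall_gt_imp_ge_of_dense this
    exact (sub_eq_zero.1 (abs_nonpos_iff.1 h0)).symm

end MapsToAll

/-! ### The universal systems of an arc-transitive group -/

section Cuts

/-- The system of cuts. -/
noncomputable def cutSystem (G A : Type u) [Group G] [TopologicalSpace G] [CircularOrder A]
    [MulAction G A] [IsCircularAction G A] [IsPointwiseAction G A] [Nontrivial A] : GSystem G where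
  carrier := Cut A

variable (G A : Type u) [Group G] [TopologicalSpace G] [CircularOrder A] [MulAction G A]
  [IsCircularAction G A] [IsPointwiseAction G A] [IsArcTransitive G A] [DenseCircularOrder A]
  [Nontrivial A]

theorem cutSystem_mapsToAll : (cutSystem G A).MapsToAll := fun _ => exists_equivariant

theorem cutSystem_intrinsic : (cutSystem G A).MapsToAll ∧
    IntrinsicallyCOrdered G ∧ IntrinsicallyTame G ∧ ConvexlyIntrinsicallyTame G :=
  ⟨cutSystem_mapsToAll G A, (cutSystem_mapsToAll G A).intrinsic (Cut.hasShrinkableComplements G)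
    (Cut.isCOrderedSystem G)⟩

theorem cutSystem_metrizable [Countable A] : (cutSystem G A).IsUniversalMinimal ∧
    TopologicalSpace.MetrizableSpace (cutSystem G A).carrier := by
  refine ⟨(cutSystem_mapsToAll G A).isUniversalMinimal (Cut.hasShrinkableComplements G), ?_⟩
  have : SecondCountableTopology (Cut A) :=
    TopologicalSpace.Subtype.secondCountableTopology {r : A → A → Bool | IsCut r}
  exact TopologicalSpace.metrizableSpace_of_t3_secondCountable (Cut A)

end Cuts

/-! ### The circular order of the circle -/

namespace UnitCircle

theorem sbtw_coe_iff {a s t : ℝ} (hs : s ∈ Set.Ioo a (a + 1)) (ht : t ∈ Set.Ioo a (a + 1)) :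
    sbtw (a : UnitAddCircle) s t ↔ s < t := by
  rw [sbtw_iff_not_btw, btw_cyclic, ← not_le, not_iff_not]
  have h := QuotientAddGroup.btw_coe_iff (p := (1 : ℝ)) (x₁ := a) (x₂ := t) (x₃ := s)
  refine h.trans ?_
  rw [(toIcoMod_eq_self _).2 (Set.Ioo_subset_Ico_self ht),
    (toIocMod_eq_self _).2 (Set.Ioo_subset_Ioc_self hs)]

theorem exists_lift (a : ℝ) (x : UnitAddCircle) :
    ∃ t ∈ Set.Ico a (a + 1), (t : UnitAddCircle) = x := by
  have : x ∈ ((↑) : ℝ → UnitAddCircle) '' Set.Ico a (a + 1) := by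
    rw [AddCircle.coe_image_Ico_eq]
    trivial
  exact this

theorem exists_lift_of_ne {a : ℝ} {x : UnitAddCircle} (h : (a : UnitAddCircle) ≠ x) :
    ∃ t ∈ Set.Ioo a (a + 1), (t : UnitAddCircle) = x := by
  obtain ⟨t, ht, rfl⟩ := exists_lift a x
  exact ⟨t, ⟨lt_of_le_of_ne ht.1 fun h' => h (by rw [h']), ht.2⟩, rfl⟩

theorem sbtw_coe_left_iff {a : ℝ} {y z : UnitAddCircle} : sbtw (a : UnitAddCircle) y z ↔
    ∃ s t : ℝ, a < s ∧ s < t ∧ t < a + 1 ∧ (s : UnitAddCircle) = y ∧ (t : UnitAddCircle) = z := by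
  constructor
  · intro h
    obtain ⟨s, hs, rfl⟩ := exists_lift_of_ne h.ne_left
    obtain ⟨t, ht, rfl⟩ := exists_lift_of_ne h.ne_outer.symm
    exact ⟨s, t, hs.1, (sbtw_coe_iff hs ht).1 h, ht.2, rfl, rfl⟩
  · rintro ⟨s, t, h1, h2, h3, rfl, rfl⟩
    exact (sbtw_coe_iff ⟨h1, h2.trans h3⟩ ⟨h1.trans h2, h3⟩).2 h2

theorem sbtw_of_lt {a s t : ℝ} (h1 : a < s) (h2 : s < t) (h3 : t < a + 1) :
    sbtw (a : UnitAddCircle) s t :=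
  sbtw_coe_left_iff.2 ⟨s, t, h1, h2, h3, rfl, rfl⟩

theorem sbtw_add_right {x y z : UnitAddCircle} (w : UnitAddCircle) (h : sbtw x y z) :
    sbtw (x + w) (y + w) (z + w) := by
  obtain ⟨a, -, rfl⟩ := exists_lift 0 x
  obtain ⟨b, -, rfl⟩ := exists_lift 0 w
  obtain ⟨s, t, h1, h2, h3, rfl, rfl⟩ := sbtw_coe_left_iff.1 h
  simp only [← AddCircle.coe_add]
  exact sbtw_of_lt (by linarith) (by linarith) (by linarith)

/-- The lifts form an open convex set; its image therefore inherits both openness and connectedness.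
-/
theorem sbtw_set_eq : {p : UnitAddCircle × UnitAddCircle × UnitAddCircle | sbtw p.1 p.2.1 p.2.2} =
    Prod.map (↑) (Prod.map (↑) (↑)) ''
      {p : ℝ × ℝ × ℝ | p.1 < p.2.1 ∧ p.2.1 < p.2.2 ∧ p.2.2 < p.1 + 1} := by
  ext ⟨x, y, z⟩
  constructor
  · intro h
    obtain ⟨a, -, rfl⟩ := exists_lift 0 x
    obtain ⟨s, t, h1, h2, h3, rfl, rfl⟩ := sbtw_coe_left_iff.1 h
    exact ⟨(a, s, t), ⟨h1, h2, h3⟩, rfl⟩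
  · rintro ⟨⟨a, s, t⟩, ⟨h1, h2, h3⟩, h⟩
    cases h
    exact sbtw_of_lt h1 h2 h3

theorem isOpen_sbtw : IsOpen {p : UnitAddCircle × UnitAddCircle × UnitAddCircle |
    sbtw p.1 p.2.1 p.2.2} := by
  rw [sbtw_set_eq]
  have h : IsOpenMap ((↑) : ℝ → UnitAddCircle) := QuotientAddGroup.isOpenMap_coe
  have h1 : IsOpen {p : ℝ × ℝ × ℝ | p.1 < p.2.1} := isOpen_lt (by fun_prop) (by fun_prop)
  have h2 : IsOpen {p : ℝ × ℝ × ℝ | p.2.1 < p.2.2} := isOpen_lt (by fun_prop) (by fun_prop)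
  have h3 : IsOpen {p : ℝ × ℝ × ℝ | p.2.2 < p.1 + 1} := isOpen_lt (by fun_prop) (by fun_prop)
  exact (h.prodMap (h.prodMap h)) _ (h1.inter (h2.inter h3))

theorem isPreconnected_sbtw : IsPreconnected
    {p : UnitAddCircle × UnitAddCircle × UnitAddCircle | sbtw p.1 p.2.1 p.2.2} := by
  rw [sbtw_set_eq]
  refine IsPreconnected.image (Convex.isPreconnected ?_) _ ?_
  · intro x hx y hy a b ha hb hab
    obtain ⟨h1, h2, h3⟩ := hx
    obtain ⟨h1', h2', h3'⟩ := hy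
    obtain rfl : b = 1 - a := by linarith
    simp only [Set.mem_ofPred_eq, Prod.fst_add, Prod.snd_add, Prod.smul_fst, Prod.smul_snd,
      smul_eq_mul]
    rcases ha.eq_or_lt with rfl | ha
    · exact ⟨by linarith, by linarith, by linarith⟩
    · exact ⟨by nlinarith, by nlinarith, by nlinarith⟩
  · have h : Continuous ((↑) : ℝ → UnitAddCircle) := AddCircle.continuous_mk' 1
    exact (h.prodMap (h.prodMap h)).continuousOn

theorem isOpen_arc (a b : UnitAddCircle) : IsOpen {x | sbtw a x b} :=
  isOpen_sbtw.preimage (f := fun x => (a, x, b)) (by fun_prop)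

theorem exists_arc_subset {x : UnitAddCircle} {U : Set UnitAddCircle} (hU : U ∈ 𝓝 x) :
    ∃ c d, sbtw c x d ∧ closedArc c d ⊆ U := by
  obtain ⟨x, -, rfl⟩ := exists_lift 0 x
  have h := (AddCircle.continuous_mk' (1 : ℝ)).tendsto x hU
  obtain ⟨ε, hε, h⟩ := Metric.nhds_basis_closedBall.mem_iff.1 h
  let δ := min ε (1 / 4)
  have hδ : 0 < δ := lt_min hε (by norm_num)
  have hδ' : δ ≤ 1 / 4 := min_le_right _ _
  have hsub : ∀ t, x - δ ≤ t → t ≤ x + δ → (t : UnitAddCircle) ∈ U := fun t h1 h2 => by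
    have : δ ≤ ε := min_le_left _ _
    refine h ?_
    rw [Metric.mem_closedBall, Real.dist_eq, abs_le]
    constructor <;> linarith
  refine ⟨((x - δ : ℝ) : UnitAddCircle), ((x + δ : ℝ) : UnitAddCircle),
    sbtw_of_lt (by linarith) (by linarith) (by linarith), ?_⟩
  rintro y (rfl | rfl | hy)
  · exact hsub _ le_rfl (by linarith)
  · exact hsub _ (by linarith) le_rfl
  · obtain ⟨s, hs, rfl⟩ := exists_lift_of_ne hy.ne_left
    rw [sbtw_coe_iff hs ⟨by linarith, by linarith⟩] at hy
    exact hsub s hs.1.le hy.le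

theorem compl_closedArc {a b : UnitAddCircle} (hab : a ≠ b) :
    (closedArc a b)ᶜ = {x | sbtw b x a} := by
  ext x
  simp only [closedArc, Set.mem_compl_iff, Set.mem_ofPred_eq, not_or]
  constructor
  · rintro ⟨h1, h2, h3⟩
    rcases sbtw_total (Ne.symm h1) h2 hab.symm with h | h
    · exact (h3 h).elim
    · exact h
  · exact fun h => ⟨h.ne_right, h.ne_left.symm, h.not_sbtw⟩

theorem topology_eq : (inferInstance : TopologicalSpace UnitAddCircle) =
    circularIntervalTopology UnitAddCircle := by
  refine le_antisymm (le_generateFrom ?_) fun U hU => ?_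
  · rintro _ ⟨a, b, rfl⟩
    rcases eq_or_ne a b with rfl | hab
    · have : closedArc a a = {a} := by
        ext x
        simp [closedArc, sbtw_irrefl_left_right]
      rw [this]
      exact isOpen_compl_singleton
    · rw [compl_closedArc hab]
      exact isOpen_arc b a
  · refine (@isOpen_iff_forall_mem_open _ (circularIntervalTopology UnitAddCircle) _).2
      fun x hx => ?_
    obtain ⟨c, d, hcd, hsub⟩ := exists_arc_subset (hU.mem_nhds hx)
    refine ⟨(closedArc d c)ᶜ, ?_, TopologicalSpace.isOpen_generateFrom_of_mem ⟨d, c, rfl⟩, ?_⟩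
    · rw [compl_closedArc hcd.ne_outer]
      exact fun y hy => hsub (Or.inr (Or.inr hy))
    · rw [compl_closedArc hcd.ne_outer]
      exact hcd

theorem sbtw_iff_of_forall {X : Type*} [CircularOrder X] {h : X → X} (hinj : Function.Injective h)
    (hh : ∀ a b c, sbtw a b c → sbtw (h a) (h b) (h c)) (a b c : X) :
    sbtw (h a) (h b) (h c) ↔ sbtw a b c := by
  refine ⟨fun h' => ?_, hh a b c⟩
  rcases sbtw_total (hinj.ne_iff.1 h'.ne_left) (hinj.ne_iff.1 h'.ne_right)
    (hinj.ne_iff.1 h'.ne_outer) with h1 | h1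
  · exact h1
  · exact (h'.not_sbtw (hh _ _ _ h1)).elim

/-- A homeomorphism of the circle that preserves the orientation of one triple preserves the
circular order. -/
theorem mem_hPlus_of_sbtw (h : UnitAddCircle ≃ₜ UnitAddCircle) {a b c : UnitAddCircle}
    (habc : sbtw a b c) (h' : sbtw (h a) (h b) (h c)) : h ∈ hPlus := by
  let f : UnitAddCircle × UnitAddCircle × UnitAddCircle →
      UnitAddCircle × UnitAddCircle × UnitAddCircle := Prod.map h (Prod.map h h)
  have hf : Continuous f := h.continuous.prodMap (h.continuous.prodMap h.continuous)
  -- Positively oriented triples form a connected set, which splits into two disjoint relatively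
  -- open parts according to whether `h` keeps or reverses orientation. One triple decides for all.
  have hs := isPreconnected_sbtw.subset_left_of_subset_union
    (u := f ⁻¹' {p | sbtw p.1 p.2.1 p.2.2}) (v := f ⁻¹' {p | sbtw p.2.2 p.2.1 p.1})
    (isOpen_sbtw.preimage hf)
    ((isOpen_sbtw.preimage (f := fun p : UnitAddCircle × UnitAddCircle × UnitAddCircle =>
      (p.2.2, p.2.1, p.1)) (by fun_prop)).preimage hf)
    (Set.disjoint_left.2 fun p (h1 : sbtw (f p).1 (f p).2.1 (f p).2.2)
      (h2 : sbtw (f p).2.2 (f p).2.1 (f p).1) => h1.not_sbtw h2)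
    (fun p hp => sbtw_total (h.injective.ne (SBtw.sbtw.ne_left hp))
      (h.injective.ne (SBtw.sbtw.ne_right hp)) (h.injective.ne (SBtw.sbtw.ne_outer hp)))
    ⟨(a, b, c), habc, h'⟩
  exact sbtw_iff_of_forall h.injective fun a b c habc => hs (show (a, b, c) ∈ _ from habc)

/-! ### Homeomorphisms supported in an arc -/

/-- As `f` and `g` fix both ends of the fundamental interval, they close up to continuous maps of
the circle. -/
theorem exists_homeomorph_of_interval (a : ℝ) (f g : ℝ → ℝ) (hf : Continuous f) (hg : Continuous g)
    (hfm : StrictMono f) (hgf : ∀ t, g (f t) = t) (hfg : ∀ t, f (g t) = t) (ha : f a = a)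
    (ha' : f (a + 1) = a + 1) :
    ∃ h : UnitAddCircle ≃ₜ UnitAddCircle, ∀ t ∈ Set.Ico a (a + 1), h t = f t := by
  have hga : g a = a := by rw [← ha, hgf, ha]
  have hga' : g (a + 1) = a + 1 := by rw [← ha', hgf, ha']
  have hfI : ∀ t ∈ Set.Ico a (a + 1), f t ∈ Set.Ico a (a + 1) := fun t ht => by
    constructor
    · rw [← ha]
      exact hfm.monotone ht.1
    · rw [← ha']
      exact hfm ht.2
  have hgI : ∀ t ∈ Set.Ico a (a + 1), g t ∈ Set.Ico a (a + 1) := fun t ht => by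
    constructor
    · rw [← hfm.le_iff_le, ha, hfg]
      exact ht.1
    · rw [← hfm.lt_iff_lt, ha', hfg]
      exact ht.2
  have key : ∀ f : ℝ → ℝ, Continuous f → f a = a → f (a + 1) = a + 1 →
      Continuous (AddCircle.liftIco 1 a fun t => (f t : UnitAddCircle)) := fun f hf h h' => by
    refine AddCircle.liftIco_continuous ?_ ((AddCircle.continuous_mk' 1).comp hf).continuousOn
    rw [h, h', AddCircle.coe_add_period]
  have hap : ∀ (f : ℝ → ℝ), ∀ t ∈ Set.Ico a (a + 1),
      AddCircle.liftIco 1 a (fun t => (f t : UnitAddCircle)) (t : UnitAddCircle) = f t :=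
    fun f t ht => AddCircle.liftIco_coe_apply ht
  refine ⟨{ toFun := AddCircle.liftIco 1 a fun t => (f t : UnitAddCircle)
            invFun := AddCircle.liftIco 1 a fun t => (g t : UnitAddCircle)
            left_inv := fun x => ?_
            right_inv := fun x => ?_
            continuous_toFun := key f hf ha ha'
            continuous_invFun := key g hg hga hga' }, hap f⟩
  · obtain ⟨t, ht, rfl⟩ := exists_lift a x
    rw [hap f t ht, hap g _ (hfI t ht), hgf]
  · obtain ⟨t, ht, rfl⟩ := exists_lift a x
    rw [hap g t ht, hap f _ (hgI t ht), hfg]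

/-- The piecewise linear map that moves `x` to `x + δ` and is the identity off
`[x - δ, x + 2 δ]`. -/
noncomputable def bump (x δ t : ℝ) : ℝ := max t (min (2 * t - x + δ) ((t + x) / 2 + δ))

/-- The inverse of `bump`. -/
noncomputable def bumpInv (x δ t : ℝ) : ℝ := min t (max ((t + x - δ) / 2) (2 * (t - δ) - x))

/-- The successive pieces have slopes 1, 2, 1/2, 1, so that a bump with dyadic parameters belongs to
Thompson's group. -/
theorem bump_eq_left {x δ t : ℝ} (ht : t ≤ x - δ) : bump x δ t = t :=
  max_eq_left (min_le_of_left_le (by linarith))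

theorem bump_eq_right {x δ t : ℝ} (ht : x + 2 * δ ≤ t) : bump x δ t = t :=
  max_eq_left (min_le_of_right_le (by linarith))

theorem bump_eq_mid_left {x δ t : ℝ} (ht : x - δ ≤ t) (ht' : t ≤ x) :
    bump x δ t = 2 * t - x + δ := by
  rw [bump, min_eq_left (by linarith), max_eq_right (by linarith)]

theorem bump_eq_mid_right {x δ t : ℝ} (ht : x ≤ t) (ht' : t ≤ x + 2 * δ) :
    bump x δ t = (t + x) / 2 + δ := by
  rw [bump, min_eq_right (by linarith), max_eq_right (by linarith)]

theorem bumpInv_bump {x δ : ℝ} (t : ℝ) : bumpInv x δ (bump x δ t) = t := by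
  rcases le_total t (x - δ) with h | h
  · rw [bump_eq_left h, bumpInv, min_eq_left (le_max_of_le_left (by linarith))]
  rcases le_total t x with h' | h'
  · rw [bump_eq_mid_left h h', bumpInv, max_eq_left (by linarith), min_eq_right (by linarith)]
    ring
  rcases le_total t (x + 2 * δ) with h'' | h''
  · rw [bump_eq_mid_right h' h'', bumpInv, max_eq_right (by linarith),
      min_eq_right (by linarith)]
    ring
  · rw [bump_eq_right h'', bumpInv, min_eq_left (le_max_of_le_right (by linarith))]

theorem strictMono_bump (x δ : ℝ) : StrictMono (bump x δ) := fun s t h =>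
  max_lt_max h (min_lt_min (by linarith) (by linarith))

theorem bump_bumpInv {x δ : ℝ} (t : ℝ) : bump x δ (bumpInv x δ t) = t := by
  have hc : Continuous (bump x δ) := by
    unfold bump
    fun_prop
  obtain ⟨s, rfl⟩ : t ∈ Set.range (bump x δ) := by
    refine mem_range_of_exists_le_of_exists_ge hc ⟨min t (x - δ), ?_⟩ ⟨max t (x + 2 * δ), ?_⟩
    · rw [bump_eq_left (min_le_right _ _)]
      exact min_le_left _ _
    · rw [bump_eq_right (le_max_right _ _)]
      exact le_max_left _ _
  rw [bumpInv_bump]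

/-- The homeomorphism acts on the arc `[a, a + 1)` as the map `bump x δ`, which is supported
inside. -/
structure IsBump (a x δ : ℝ) (h : UnitAddCircle ≃ₜ UnitAddCircle) : Prop where
  pos : 0 < δ
  lt : a < x - δ
  lt' : x + 2 * δ < a + 1
  apply_coe : ∀ t ∈ Set.Ico a (a + 1), h t = bump x δ t

theorem exists_isBump {a x δ : ℝ} (hδ : 0 < δ) (h : a < x - δ) (h' : x + 2 * δ < a + 1) :
    ∃ f, IsBump a x δ f := by
  obtain ⟨f, hf⟩ := exists_homeomorph_of_interval a (bump x δ) (bumpInv x δ)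
    (by unfold bump; fun_prop) (by unfold bumpInv; fun_prop) (strictMono_bump x δ)
    bumpInv_bump bump_bumpInv (bump_eq_left h.le) (bump_eq_right h'.le)
  exact ⟨f, hδ, h, h', hf⟩

theorem IsBump.mem_hPlus {a x δ : ℝ} {h : UnitAddCircle ≃ₜ UnitAddCircle} (hh : IsBump a x δ h) :
    h ∈ hPlus := by
  have h1 := hh.pos
  have h2 := hh.lt
  have h3 := hh.lt'
  have hs : sbtw (a : UnitAddCircle) (((a + (x - δ)) / 2 : ℝ)) ((x - δ : ℝ)) :=
    sbtw_of_lt (by linarith) (by linarith) (by linarith)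
  refine mem_hPlus_of_sbtw h hs ?_
  rwa [hh.apply_coe _ ⟨le_rfl, by linarith⟩, hh.apply_coe _ ⟨by linarith, by linarith⟩,
    hh.apply_coe _ ⟨by linarith, by linarith⟩, bump_eq_left (by linarith),
    bump_eq_left (by linarith), bump_eq_left le_rfl]

/-- A group that contains the bumps with parameters in `R` acts transitively on the points of an
arc that lift to `R`. -/
theorem exists_mem_apply_eq (R : AddSubgroup ℝ) (hhalf : ∀ x ∈ R, x / 2 ∈ R)
    (H : Subgroup (UnitAddCircle ≃ₜ UnitAddCircle))
    (hH : ∀ a ∈ R, ∀ x ∈ R, ∀ δ ∈ R, ∀ h, IsBump a x δ h → h ∈ H) {a b x y : ℝ} (ha : a ∈ R)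
    (hx : x ∈ R) (hy : y ∈ R) (hb : b < a + 1) (hax : a < x) (hxy : x < y) (hyb : y < b) :
    ∃ h ∈ H, h x = y ∧ ∀ c : UnitAddCircle, ¬ sbtw (a : UnitAddCircle) c b → h c = c := by
  -- The way from `x` to `y` is split into `2 ^ n` equal shifts `δ`, small enough for each bump to
  -- have its support strictly between `a` and `b`. Repeated halving keeps `δ` in `R`, also when `R`
  -- consists of the dyadics.
  obtain ⟨n, hn⟩ := exists_pow_lt_of_lt_one
    (show 0 < min (x - a) (b - y) / (y - x) from
      div_pos (lt_min (by linarith) (by linarith)) (by linarith)) (show (1 / 2 : ℝ) < 1 by norm_num)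
  rw [lt_div_iff₀ (by linarith)] at hn
  set δ := (1 / 2 : ℝ) ^ n * (y - x) with hδ
  have hδ0 : 0 < δ := mul_pos (by positivity) (by linarith)
  have hδ1 : δ < x - a := hn.trans_le (min_le_left _ _)
  have hδ2 : δ < b - y := hn.trans_le (min_le_right _ _)
  have hδR : δ ∈ R := by
    have : ∀ (m : ℕ) (z : ℝ), z ∈ R → (1 / 2 : ℝ) ^ m * z ∈ R := fun m z hz => by
      induction m with
      | zero => simpa using hz
      | succ m ih =>
        have := hhalf _ ih
        rwa [pow_succ, mul_assoc, mul_left_comm, one_div_mul_eq_div]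
    exact this n _ (R.sub_mem hy hx)
  have hN : ((2 ^ n : ℕ) : ℝ) * δ = y - x := by
    rw [hδ, ← mul_assoc]
    simp
  have step : ∀ i : ℕ, i ≤ 2 ^ n → ∃ h ∈ H, h x = ((x + i * δ : ℝ) : UnitAddCircle) ∧
      ∀ c : UnitAddCircle, ¬ sbtw (a : UnitAddCircle) c b → h c = c := by
    intro i
    induction i with
    | zero => exact fun _ => ⟨1, H.one_mem, by simp, fun c _ => rfl⟩
    | succ i ih =>
      intro hi
      obtain ⟨h, hh, hhx, hfix⟩ := ih (by omega)
      have h0 : 0 ≤ (i : ℝ) * δ := by positivity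
      have h1 : ((i : ℝ) + 1) * δ ≤ y - x := by
        rw [← hN]
        exact mul_le_mul_of_nonneg_right (by exact_mod_cast hi) hδ0.le
      obtain ⟨f, hf⟩ := exists_isBump (a := a) (x := x + i * δ) hδ0 (by linarith) (by linarith)
      refine ⟨f * h, H.mul_mem (hH a ha _ (R.add_mem hx ?_) δ hδR f hf) hh, ?_, fun c hc => ?_⟩
      · rw [← nsmul_eq_mul]
        exact R.nsmul_mem hδR i
      · change f (h x) = _
        rw [hhx, hf.apply_coe _ ⟨by linarith, by linarith⟩,
          bump_eq_mid_left (by linarith) le_rfl]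
        congr 1
        push_cast
        ring
      · change f (h c) = _
        rw [hfix c hc]
        obtain ⟨t, ht, rfl⟩ := exists_lift a c
        rw [hf.apply_coe t ht]
        rcases ht.1.eq_or_lt with rfl | hat
        · rw [bump_eq_left (by linarith)]
        · have hbt : b ≤ t := by
            by_contra! h'
            exact hc (sbtw_of_lt hat h' hb)
          rw [bump_eq_right (by linarith)]
  obtain ⟨h, hh, hx, hfix⟩ := step _ le_rfl
  refine ⟨h, hh, ?_, hfix⟩
  rw [hx, hN, add_sub_cancel]

theorem coe_mem_image_iff {R : AddSubgroup ℝ} (hone : 1 ∈ R) {t : ℝ} :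
    (t : UnitAddCircle) ∈ ((↑) : ℝ → UnitAddCircle) '' R ↔ t ∈ R := by
  refine ⟨?_, fun h => ⟨t, h, rfl⟩⟩
  rintro ⟨s, hs, hst⟩
  have h0 : ((t - s : ℝ) : UnitAddCircle) = 0 := by
    rw [AddCircle.coe_sub, hst, sub_self]
  obtain ⟨n, hn⟩ := (AddCircle.coe_eq_zero_iff _).1 h0
  have : t = s + n • (1 : ℝ) := by
    rw [hn]
    ring
  rw [this]
  exact R.add_mem hs (R.zsmul_mem hone n)

theorem exists_mem_sbtw {R : AddSubgroup ℝ} (hone : 1 ∈ R) (hhalf : ∀ x ∈ R, x / 2 ∈ R)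
    {p q : UnitAddCircle} (hp : p ∈ ((↑) : ℝ → UnitAddCircle) '' R)
    (hq : q ∈ ((↑) : ℝ → UnitAddCircle) '' R) (hpq : p ≠ q) :
    ∃ c ∈ ((↑) : ℝ → UnitAddCircle) '' R, sbtw p c q := by
  obtain ⟨a, ha, rfl⟩ := hp
  obtain ⟨b, hb, rfl⟩ := exists_lift_of_ne hpq
  rw [coe_mem_image_iff hone] at hq
  exact ⟨_, ⟨_, hhalf _ (R.add_mem ha hq), rfl⟩,
    sbtw_of_lt (by linarith [hb.1]) (by linarith [hb.1]) hb.2⟩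

theorem exists_mem_apply_eq_of_arc (R : AddSubgroup ℝ) (hone : 1 ∈ R) (hhalf : ∀ x ∈ R, x / 2 ∈ R)
    (H : Subgroup (UnitAddCircle ≃ₜ UnitAddCircle))
    (hH : ∀ a ∈ R, ∀ x ∈ R, ∀ δ ∈ R, ∀ h, IsBump a x δ h → h ∈ H) {p q x y : UnitAddCircle}
    (hp : p ∈ ((↑) : ℝ → UnitAddCircle) '' R) (hx : x ∈ ((↑) : ℝ → UnitAddCircle) '' R)
    (hy : y ∈ ((↑) : ℝ → UnitAddCircle) '' R) (hpx : sbtw p x q) (hpy : sbtw p y q) :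
    ∃ h ∈ H, h x = y ∧ ∀ c : UnitAddCircle, ¬ sbtw p c q → h c = c := by
  obtain ⟨a, ha, rfl⟩ := hp
  obtain ⟨s, hsI, rfl⟩ := exists_lift_of_ne hpx.ne_left
  obtain ⟨t, htI, rfl⟩ := exists_lift_of_ne hpy.ne_left
  rw [coe_mem_image_iff hone] at hx hy
  obtain ⟨b, hb, rfl⟩ := exists_lift_of_ne hpx.ne_outer.symm
  rw [sbtw_coe_iff hsI hb] at hpx
  rw [sbtw_coe_iff htI hb] at hpy
  rcases lt_trichotomy s t with h | rfl | h
  · exact exists_mem_apply_eq R hhalf H hH ha hx hy hb.2 hsI.1 h hpy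
  · exact ⟨1, H.one_mem, rfl, fun _ _ => rfl⟩
  · obtain ⟨f, hf, hts, hfix⟩ := exists_mem_apply_eq R hhalf H hH ha hy hx hb.2 htI.1 h hpx
    refine ⟨f⁻¹, H.inv_mem hf, ?_, fun c hc => ?_⟩
    · rw [← hts]
      exact f.symm_apply_apply _
    · conv_lhs => rw [← hfix c hc]
      exact f.symm_apply_apply _

end UnitCircle

/-! ### Topologies of pointwise convergence -/

section Pointwise

variable {G A : Type*} [Group G] [MulAction G A] [t : TopologicalSpace G]

theorem isOpen_smul_eq_of_pointwise (ht : t = pointwiseTopology fun (g : G) (a : A) => g • a)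
    (a b : A) : IsOpen {g : G | g • a = b} := by
  let _ : TopologicalSpace A := ⊥
  have : DiscreteTopology A := ⟨rfl⟩
  have h : Continuous fun g : G => g • a :=
    (continuous_apply a).comp (continuous_iff_le_induced.2 ht.le)
  exact (isOpen_discrete {b}).preimage h

theorem continuous_of_pointwise (ht : t = pointwiseTopology fun (g : G) (a : A) => g • a)
    {Z : Type*} [TopologicalSpace Z] {f : Z → G} (hf : ∀ a b : A, IsOpen {z | f z • a = b}) :
    Continuous f := by
  let _ : TopologicalSpace A := ⊥
  have : DiscreteTopology A := ⟨rfl⟩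
  rw [ht]
  refine continuous_induced_rng.2 (continuous_pi fun a => ?_)
  exact continuous_discrete_rng.2 fun b => hf a b

theorem isTopologicalGroup_of_pointwise
    (ht : t = pointwiseTopology fun (g : G) (a : A) => g • a) : IsTopologicalGroup G where
  continuous_mul := continuous_of_pointwise ht fun a b => by
    have : {p : G × G | (p.1 * p.2) • a = b} =
        ⋃ c, {p : G × G | p.2 • a = c} ∩ {p : G × G | p.1 • c = b} := by
      ext p
      simp [mul_smul]
    rw [this]
    exact isOpen_iUnion fun c =>
      ((isOpen_smul_eq_of_pointwise ht a c).preimage continuous_snd).inter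
        ((isOpen_smul_eq_of_pointwise ht c b).preimage continuous_fst)
  continuous_inv := continuous_of_pointwise ht fun a b => by
    simp only [inv_smul_eq_iff, eq_comm (a := a)]
    exact isOpen_smul_eq_of_pointwise ht b a

theorem isPointwiseAction_of_pointwise
    (ht : t = pointwiseTopology fun (g : G) (a : A) => g • a) : IsPointwiseAction G A where
  isOpen_smul_eq := isOpen_smul_eq_of_pointwise ht
  exists_finset_of_mem_nhds U hU := by
    let _ : TopologicalSpace A := ⊥
    rw [ht, nhds_induced] at hU
    obtain ⟨V, hV, hVU⟩ := hU
    obtain ⟨W, hWV, hW, h1⟩ := mem_nhds_iff.1 hV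
    obtain ⟨F, u, hu, hF⟩ := isOpen_pi_iff.1 hW _ h1
    refine ⟨F, fun g hg => hVU (hWV (hF fun a ha => ?_))⟩
    have := (hu a ha).2
    rw [one_smul] at this
    change g • a ∈ u a
    rwa [hg a ha]

end Pointwise

instance Subtype.instCircularOrder {X : Type*} [CircularOrder X] (s : Set X) :
    CircularOrder s where
  btw a b c := btw (a : X) b c
  sbtw a b c := sbtw (a : X) b c
  btw_refl a := btw_refl (a : X)
  btw_cyclic_left h := btw_cyclic_left (α := X) h
  sbtw_iff_btw_not_btw := sbtw_iff_btw_not_btw (α := X)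
  sbtw_trans_left h h' := sbtw_trans_left (α := X) h h'
  btw_antisymm h h' := by
    simpa only [Subtype.ext_iff] using btw_antisymm (α := X) h h'
  btw_total a b c := btw_total (a : X) b c

namespace UnitCircle

/-! ### Groups of homeomorphisms preserving a set of points -/

/-- The homeomorphisms that map `s` onto itself. -/
def preserving (s : Set UnitAddCircle) : Subgroup (UnitAddCircle ≃ₜ UnitAddCircle) where
  carrier := {h | ∀ x, h x ∈ s ↔ x ∈ s}
  one_mem' _ := Iff.rfl
  mul_mem' {g h} hg hh x := (hg (h x)).trans (hh x)
  inv_mem' {h} hh x := by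
    rw [← hh]
    exact iff_of_eq (congrArg (· ∈ s) (h.apply_symm_apply x))

theorem IsBump.mem_preserving {R : AddSubgroup ℝ} (hone : 1 ∈ R) (hhalf : ∀ x ∈ R, x / 2 ∈ R)
    {a x δ : ℝ} (hx : x ∈ R) (hδ : δ ∈ R) {h : UnitAddCircle ≃ₜ UnitAddCircle}
    (hh : IsBump a x δ h) : h ∈ preserving (((↑) : ℝ → UnitAddCircle) '' R) := by
  intro c
  obtain ⟨t, ht, rfl⟩ := exists_lift a c
  rw [hh.apply_coe t ht, coe_mem_image_iff hone, coe_mem_image_iff hone]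
  have h2 : ∀ t ∈ R, 2 * t ∈ R := fun t ht => by
    rw [two_mul]
    exact R.add_mem ht ht
  constructor
  · intro hb
    -- The inverse, too, is pieced together from sums, doublings and halvings that preserve `R`.
    rw [← bumpInv_bump (x := x) (δ := δ) t, bumpInv]
    rcases min_choice (bump x δ t)
      (max ((bump x δ t + x - δ) / 2) (2 * (bump x δ t - δ) - x)) with h | h <;> rw [h]
    · exact hb
    · rcases max_choice ((bump x δ t + x - δ) / 2) (2 * (bump x δ t - δ) - x) with h | h <;> rw [h]
      · exact hhalf _ (R.sub_mem (R.add_mem hb hx) hδ)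
      · exact R.sub_mem (h2 _ (R.sub_mem hb hδ)) hx
  · intro ht
    rw [bump]
    rcases max_choice t (min (2 * t - x + δ) ((t + x) / 2 + δ)) with h | h <;> rw [h]
    · exact ht
    · rcases min_choice (2 * t - x + δ) ((t + x) / 2 + δ) with h | h <;> rw [h]
      · exact R.add_mem (R.sub_mem (h2 _ ht) hx) hδ
      · exact R.add_mem (hhalf _ (R.add_mem ht hx)) hδ

/-- The rotation by `r`. -/
def rotation (r : UnitAddCircle) : UnitAddCircle ≃ₜ UnitAddCircle := Homeomorph.addRight r

theorem rotation_apply (r x : UnitAddCircle) : rotation r x = x + r := rfl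

theorem rotation_mem_hPlus (r : UnitAddCircle) : rotation r ∈ hPlus :=
  fun a b c => sbtw_iff_of_forall (rotation r).injective (fun _ _ _ h => sbtw_add_right r h) a b c

theorem rotation_mem_preserving (R : AddSubgroup ℝ) {r : ℝ} (hr : r ∈ R) :
    rotation (r : UnitAddCircle) ∈ preserving (((↑) : ℝ → UnitAddCircle) '' R) := by
  intro x
  rw [rotation_apply]
  constructor
  · rintro ⟨s, hs, h⟩
    exact ⟨s - r, R.sub_mem hs hr, by rw [AddCircle.coe_sub, h, add_sub_cancel_right]⟩
  · rintro ⟨s, hs, rfl⟩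
    exact ⟨s + r, R.add_mem hs hr, AddCircle.coe_add _ _ _⟩

/-- An action on the points with coordinates in `R` by means of a group of homeomorphisms that
contains bumps and rotations is arc-transitive. -/
theorem isArcTransitive {R : AddSubgroup ℝ} (hone : 1 ∈ R) (hhalf : ∀ x ∈ R, x / 2 ∈ R)
    {H : Subgroup (UnitAddCircle ≃ₜ UnitAddCircle)}
    (hH : ∀ a ∈ R, ∀ x ∈ R, ∀ δ ∈ R, ∀ h, IsBump a x δ h → h ∈ H)
    (hrot : ∀ r ∈ R, rotation (r : UnitAddCircle) ∈ H)
    {G A : Type*} [Group G] [CircularOrder A] [MulAction G A] (ι : A → UnitAddCircle)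
    (hinj : Function.Injective ι) (hmem : ∀ a, ι a ∈ ((↑) : ℝ → UnitAddCircle) '' R)
    (hι : ∀ a b c : A, sbtw a b c ↔ sbtw (ι a) (ι b) (ι c))
    (hG : ∀ h ∈ H, ∃ g : G, ∀ a : A, ι (g • a) = h (ι a)) : IsArcTransitive G A where
  exists_smul_eq a b := by
    obtain ⟨s, hs, hsa⟩ := hmem a
    obtain ⟨t, ht, htb⟩ := hmem b
    obtain ⟨g, hg⟩ := hG _ (hrot _ (R.sub_mem ht hs))
    refine ⟨g, hinj ?_⟩
    rw [hg, rotation_apply, ← hsa, ← htb, ← AddCircle.coe_add, add_sub_cancel]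
  exists_smul_eq_of_arc {p q x y} hx hy := by
    obtain ⟨h, hh, hxy, hfix⟩ := exists_mem_apply_eq_of_arc R hone hhalf H hH (hmem p) (hmem x)
      (hmem y) ((hι _ _ _).1 hx) ((hι _ _ _).1 hy)
    obtain ⟨g, hg⟩ := hG h hh
    refine ⟨g, hinj (by rw [hg, hxy]), fun c hc => hinj ?_⟩
    rw [hg, hfix _ fun h' => hc ((hι _ _ _).2 h')]

theorem denseCircularOrder {R : AddSubgroup ℝ} (hone : 1 ∈ R) (hhalf : ∀ x ∈ R, x / 2 ∈ R)
    {s : Set UnitAddCircle} (hs : s = ((↑) : ℝ → UnitAddCircle) '' R) : DenseCircularOrder s where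
  exists_sbtw {a b} hab := by
    obtain ⟨c, hc, h⟩ := exists_mem_sbtw hone hhalf (hs ▸ a.2) (hs ▸ b.2)
      (Subtype.coe_injective.ne hab)
    exact ⟨⟨c, hs ▸ hc⟩, h⟩

theorem half_ne_zero : (((1 / 2 : ℝ) : ℝ) : UnitAddCircle) ≠ ((0 : ℝ) : UnitAddCircle) := by
  have := sbtw_of_lt (a := 0) (s := 1 / 4) (t := 1 / 2) (by norm_num) (by norm_num) (by norm_num)
  exact this.ne_outer

theorem nontrivial_image {R : AddSubgroup ℝ} (hone : 1 ∈ R) (hhalf : ∀ x ∈ R, x / 2 ∈ R)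
    {s : Set UnitAddCircle} (hs : s = ((↑) : ℝ → UnitAddCircle) '' R) : Nontrivial s :=
  ⟨⟨⟨_, hs ▸ ⟨1 / 2, hhalf _ hone, rfl⟩⟩, ⟨_, hs ▸ ⟨0, R.zero_mem, rfl⟩⟩,
    fun h => half_ne_zero (Subtype.ext_iff.1 h)⟩⟩

/-! ### The automorphism group of the rational circle -/

/-- The rational numbers. -/
def rationals : AddSubgroup ℝ where
  carrier := {x | ∃ q : ℚ, x = q}
  zero_mem' := ⟨0, by simp⟩
  add_mem' := by
    rintro _ _ ⟨p, rfl⟩ ⟨q, rfl⟩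
    exact ⟨p + q, by push_cast; rfl⟩
  neg_mem' := by
    rintro _ ⟨p, rfl⟩
    exact ⟨-p, by push_cast; rfl⟩

theorem one_mem_rationals : (1 : ℝ) ∈ rationals := ⟨1, by simp⟩

theorem half_mem_rationals : ∀ x ∈ rationals, x / 2 ∈ rationals := by
  rintro _ ⟨p, rfl⟩
  exact ⟨p / 2, by push_cast; rfl⟩

theorem rationalCircle_eq : rationalCircle = ((↑) : ℝ → UnitAddCircle) '' rationals := by
  ext x
  constructor
  · rintro ⟨q, rfl⟩
    exact ⟨q, ⟨q, rfl⟩, rfl⟩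
  · rintro ⟨_, ⟨q, rfl⟩, rfl⟩
    exact ⟨q, rfl⟩

instance : DenseCircularOrder rationalCircle :=
  denseCircularOrder one_mem_rationals half_mem_rationals rationalCircle_eq

instance : Nontrivial rationalCircle :=
  nontrivial_image one_mem_rationals half_mem_rationals rationalCircle_eq

instance : Countable rationalCircle := by
  have : rationalCircle = Set.range fun q : ℚ => ((q : ℝ) : UnitAddCircle) := by
    ext x
    simp [rationalCircle, eq_comm]
  rw [this]
  exact (Set.countable_range _).to_subtype

instance : IsCircularAction autQo rationalCircle where
  smul_sbtw σ _ _ _ h := (σ.2 _ _ _).2 h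

instance : IsPointwiseAction autQo rationalCircle := isPointwiseAction_of_pointwise rfl

instance : IsArcTransitive autQo rationalCircle :=
  isArcTransitive (R := rationals) one_mem_rationals half_mem_rationals
    (H := hPlus ⊓ preserving rationalCircle)
    (fun _ _ _ hx _ hδ _ hh => ⟨hh.mem_hPlus,
      rationalCircle_eq ▸ hh.mem_preserving one_mem_rationals half_mem_rationals hx hδ⟩)
    (fun _ hr => ⟨rotation_mem_hPlus _, rationalCircle_eq ▸ rotation_mem_preserving _ hr⟩)
    Subtype.val Subtype.val_injective (fun a => rationalCircle_eq ▸ a.2) (fun _ _ _ => Iff.rfl)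
    fun h hh => ⟨⟨h.toEquiv.subtypeEquiv fun x => (hh.2 x).symm, fun _ _ _ => hh.1 _ _ _⟩,
      fun _ => rfl⟩

theorem isTopologicalGroup_autQo : IsTopologicalGroup autQo :=
  isTopologicalGroup_of_pointwise (A := rationalCircle) rfl

/-- Recording `σ⁻¹` along with `σ` makes bijectivity a closed condition, so the group embeds as a
closed subset of a countable product of copies of `ℕ`. -/
theorem polishSpace_autQo : PolishSpace autQo := by
  obtain ⟨e, he⟩ := exists_injective_nat rationalCircle
  have := isTopologicalGroup_autQo
  have hop : ∀ a b : rationalCircle, IsOpen {σ : autQo | σ • a = b} :=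
    IsPointwiseAction.isOpen_smul_eq
  have hcont : ∀ a : rationalCircle, Continuous fun σ : autQo => e (σ • a) := fun a =>
    continuous_discrete_rng.2 fun n => by
      have : (fun σ : autQo => e (σ • a)) ⁻¹' {n} = ⋃ b ∈ e ⁻¹' {n}, {σ : autQo | σ • a = b} := by
        ext σ
        simp only [Set.mem_preimage, Set.mem_singleton_iff, Set.mem_iUnion, exists_prop]
        exact ⟨fun h => ⟨_, h, rfl⟩, fun ⟨b, hb, h⟩ => (congrArg e h).trans hb⟩
      rw [this]
      exact isOpen_biUnion fun b _ => hop a b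
  let F : autQo → (rationalCircle → ℕ) × (rationalCircle → ℕ) :=
    fun σ => (fun a => e (σ • a), fun a => e (σ⁻¹ • a))
  have hF : Continuous F := (continuous_pi hcont).prodMk
    (continuous_pi fun a => (hcont a).comp continuous_inv)
  have hc1 (a : rationalCircle) :
      Continuous fun p : (rationalCircle → ℕ) × (rationalCircle → ℕ) => p.1 a :=
    (continuous_apply a).comp continuous_fst
  have ho (a b : rationalCircle) :
      IsOpen {p : (rationalCircle → ℕ) × (rationalCircle → ℕ) | p.1 a = e b} :=
    (isOpen_discrete {e b}).preimage (hc1 a)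
  have hind : IsInducing F := ⟨le_antisymm (continuous_iff_le_induced.1 hF) <|
    continuous_id_iff_le.1 <| @continuous_of_pointwise autQo rationalCircle _ _ _ rfl autQo
      (.induced F inferInstance) id fun a b => by
        have h : F ⁻¹' {p | p.1 a = e b} = {σ : autQo | σ • a = b} := by
          ext σ
          exact he.eq_iff
        exact isOpen_induced_iff.2 ⟨_, ho a b, h⟩⟩
  have hinj : Function.Injective F := fun σ τ h =>
    Subtype.ext (Equiv.ext fun a => he (congrFun (congrArg Prod.fst h) a))
  have hrange : Set.range F = {p | (∀ a, p.1 a ∈ Set.range e) ∧ (∀ a, p.2 a ∈ Set.range e) ∧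
      (∀ a b, p.1 a = e b ↔ p.2 b = e a) ∧
      ∀ a b c a' b' c' : rationalCircle, p.1 a = e a' → p.1 b = e b' →
        p.1 c = e c' → (sbtw (a' : UnitAddCircle) b' c' ↔ sbtw (a : UnitAddCircle) b c)} := by
    ext p
    constructor
    · rintro ⟨σ, rfl⟩
      refine ⟨fun a => ⟨_, rfl⟩, fun a => ⟨_, rfl⟩, fun a b => ?_,
        fun a b c a' b' c' h h' h'' => ?_⟩
      · change e (σ • a) = e b ↔ e (σ⁻¹ • b) = e a
        rw [he.eq_iff, he.eq_iff, inv_smul_eq_iff, eq_comm]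
      · rw [← he h, ← he h', ← he h'']
        exact σ.2 a b c
    · rintro ⟨h1, h2, h3, h4⟩
      choose f hf using h1
      choose f' hf' using h2
      refine ⟨⟨⟨f, f', fun a => he ?_, fun a => he ?_⟩, fun a b c =>
        h4 a b c _ _ _ (hf a).symm (hf b).symm (hf c).symm⟩, Prod.ext (funext hf) (funext hf')⟩
      · rw [hf', ← h3, hf]
      · rw [hf, h3, hf']
  refine IsClosedEmbedding.polishSpace (f := F) ⟨⟨hind, hinj⟩, ?_⟩
  have hc2 (a : rationalCircle) :
      Continuous fun p : (rationalCircle → ℕ) × (rationalCircle → ℕ) => p.2 a :=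
    (continuous_apply a).comp continuous_snd
  rw [hrange]
  simp only [Set.ofPred_and, Set.ofPred_forall]
  refine .inter (isClosed_iInter fun a => (isClosed_discrete _).preimage (hc1 a)) <|
    .inter (isClosed_iInter fun a => (isClosed_discrete _).preimage (hc2 a)) <|
    .inter (isClosed_iInter fun a => isClosed_iInter fun b => ?_) ?_
  · exact (isClosed_discrete {q : ℕ × ℕ | q.1 = e b ↔ q.2 = e a}).preimage
      ((hc1 a).prodMk (hc2 b))
  · refine isClosed_iInter fun a => isClosed_iInter fun b =>
      isClosed_iInter fun c => isClosed_iInter fun a' => isClosed_iInter fun b' =>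
      isClosed_iInter fun c' => ?_
    exact (isClosed_discrete {q : ℕ × ℕ × ℕ | q.1 = e a' → q.2.1 = e b' → q.2.2 = e c' →
      (sbtw (a' : UnitAddCircle) b' c' ↔ sbtw (a : UnitAddCircle) b c)}).preimage
      ((hc1 a).prodMk ((hc1 b).prodMk (hc1 c)))

/-! ### Thompson's group -/

/-- The dyadic rational numbers. -/
def dyadics : AddSubgroup ℝ where
  carrier := {x | ∃ (m : ℤ) (n : ℕ), x = m / 2 ^ n}
  zero_mem' := ⟨0, 0, by simp⟩
  add_mem' := by
    rintro _ _ ⟨m, n, rfl⟩ ⟨m', n', rfl⟩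
    refine ⟨m * 2 ^ n' + m' * 2 ^ n, n + n', ?_⟩
    push_cast
    field_simp
    ring
  neg_mem' := by
    rintro _ ⟨m, n, rfl⟩
    exact ⟨-m, n, by push_cast; ring⟩

theorem one_mem_dyadics : (1 : ℝ) ∈ dyadics := ⟨1, 0, by simp⟩

theorem half_mem_dyadics : ∀ x ∈ dyadics, x / 2 ∈ dyadics := by
  rintro _ ⟨m, n, rfl⟩
  refine ⟨m, n + 1, ?_⟩
  rw [pow_succ]
  field_simp

theorem dyadicCircle_eq : dyadicCircle = ((↑) : ℝ → UnitAddCircle) '' dyadics := by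
  ext x
  constructor
  · rintro ⟨m, n, rfl⟩
    exact ⟨_, ⟨m, n, rfl⟩, rfl⟩
  · rintro ⟨_, ⟨m, n, rfl⟩, rfl⟩
    exact ⟨m, n, rfl⟩

instance : DenseCircularOrder dyadicCircle :=
  denseCircularOrder one_mem_dyadics half_mem_dyadics dyadicCircle_eq

instance : Nontrivial dyadicCircle :=
  nontrivial_image one_mem_dyadics half_mem_dyadics dyadicCircle_eq

instance : MulAction thompsonT dyadicCircle where
  smul h x := ⟨(h : UnitAddCircle ≃ₜ UnitAddCircle) x, (h.2.1 x).2 x.2⟩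
  one_smul _ := rfl
  mul_smul _ _ _ := rfl

theorem eventually_bump_eq {x δ t : ℝ} (h1 : t ≠ x - δ) (h2 : t ≠ x)
    (h3 : t ≠ x + 2 * δ) :
    ∃ k : ℤ, ∀ᶠ u in 𝓝 t, bump x δ u = bump x δ t + (2 : ℝ) ^ k * (u - t) := by
  rcases h1.lt_or_gt with h | h
  · refine ⟨0, (eventually_lt_nhds h).mono fun u hu => ?_⟩
    rw [bump_eq_left h.le, bump_eq_left hu.le]
    simp
  rcases h2.lt_or_gt with h' | h'
  · refine ⟨1, ((eventually_gt_nhds h).and (eventually_lt_nhds h')).mono fun u hu => ?_⟩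
    rw [bump_eq_mid_left h.le h'.le, bump_eq_mid_left hu.1.le hu.2.le, zpow_one]
    ring
  rcases h3.lt_or_gt with h'' | h''
  · refine ⟨-1, ((eventually_gt_nhds h').and (eventually_lt_nhds h'')).mono fun u hu => ?_⟩
    rw [bump_eq_mid_right h'.le h''.le, bump_eq_mid_right hu.1.le hu.2.le, zpow_neg_one]
    ring
  · refine ⟨0, (eventually_gt_nhds h'').mono fun u hu => ?_⟩
    rw [bump_eq_right h''.le, bump_eq_right hu.le]
    simp

theorem IsBump.isThompson {a x δ : ℝ} (ha : a ∈ dyadics) (hx : x ∈ dyadics) (hδ : δ ∈ dyadics)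
    {h : UnitAddCircle ≃ₜ UnitAddCircle} (hh : IsBump a x δ h) : IsThompson h := by
  -- The seam `a` is listed as a break point so that every other point lifts to the open interval,
  -- where the formula for `h` holds on both sides.
  refine ⟨?_, ((↑) : ℝ → UnitAddCircle) '' {a, x - δ, x, x + 2 * δ}, Set.toFinite _, ?_, ?_⟩
  · rw [dyadicCircle_eq]
    exact hh.mem_preserving one_mem_dyadics half_mem_dyadics hx hδ
  · rw [dyadicCircle_eq]
    refine Set.image_mono ?_
    rintro _ (rfl | rfl | rfl | rfl)
    · exact ha
    · exact dyadics.sub_mem hx hδ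
    · exact hx
    · rw [two_mul]
      exact dyadics.add_mem hx (dyadics.add_mem hδ hδ)
  · intro c hc
    have hne : ∀ b ∈ ({a, x - δ, x, x + 2 * δ} : Set ℝ), (b : UnitAddCircle) ≠ c :=
      fun b hb h => hc ⟨b, hb, h⟩
    obtain ⟨t, ht, rfl⟩ := exists_lift_of_ne (hne a (by simp))
    have hne' : ∀ b ∈ ({a, x - δ, x, x + 2 * δ} : Set ℝ), t ≠ b :=
      fun b hb h => hne b hb (by rw [h])
    obtain ⟨k, hk⟩ := eventually_bump_eq (hne' (x - δ) (by simp)) (hne' x (by simp))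
      (hne' (x + 2 * δ) (by simp))
    refine ⟨k, ?_⟩
    have htend : Tendsto (fun s : ℝ => t + s) (𝓝 0) (𝓝 t) := by
      have : Continuous fun s : ℝ => t + s := by fun_prop
      simpa using this.tendsto 0
    filter_upwards [htend.eventually hk, htend.eventually (Ioo_mem_nhds ht.1 ht.2)] with s h1 h2
    rw [← AddCircle.coe_add, hh.apply_coe _ (Set.Ioo_subset_Ico_self h2),
      hh.apply_coe _ (Set.Ioo_subset_Ico_self ht), ← AddCircle.coe_add, h1, add_sub_cancel_left]

theorem isThompson_rotation {r : ℝ} (hr : r ∈ dyadics) :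
    IsThompson (rotation (r : UnitAddCircle)) := by
  refine ⟨?_, ∅, Set.finite_empty, Set.empty_subset _, fun x _ =>
    ⟨0, Eventually.of_forall fun s => ?_⟩⟩
  · rw [dyadicCircle_eq]
    exact rotation_mem_preserving _ hr
  · rw [rotation_apply, rotation_apply, zpow_zero, one_mul]
    abel

theorem injOn_coe (a : ℝ) : Set.InjOn ((↑) : ℝ → UnitAddCircle) (Set.Ico a (a + 1)) :=
  fun s hs t ht h => by
    have : Fact ((0 : ℝ) < 1) := ⟨one_pos⟩
    have := congrArg (AddCircle.equivIco 1 a) h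
    rw [AddCircle.equivIco_coe_eq hs, AddCircle.equivIco_coe_eq ht] at this
    exact congrArg Subtype.val this

theorem uncountable_circle : Uncountable UnitAddCircle := by
  refine ⟨fun _ => ?_⟩
  have h := Set.countable_of_injective_of_countable_image (injOn_coe 0) (Set.to_countable _)
  rw [Cardinal.Real.Ico_countable_iff] at h
  norm_num at h

/-- Near a point that is not a break point `h` is affine with positive slope, so it keeps the
orientation of a small triple, and one triple suffices. -/
theorem IsThompson.mem_hPlus {h : UnitAddCircle ≃ₜ UnitAddCircle} (hh : IsThompson h) :
    h ∈ hPlus := by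
  obtain ⟨-, B, hB, -, hk⟩ := hh
  have := uncountable_circle
  obtain ⟨x, hx⟩ := hB.infinite_compl.nonempty
  obtain ⟨k, hk⟩ := hk x hx
  have h2 : Tendsto (fun s : ℝ => 2 * s) (𝓝[>] 0) (𝓝 0) := by
    have : Continuous fun s : ℝ => 2 * s := by fun_prop
    simpa using (this.tendsto 0).mono_left nhdsWithin_le_nhds
  have h3 : ∀ᶠ s : ℝ in 𝓝 0, (2 : ℝ) ^ k * s < 1 :=
    (tendsto_zpow_mul_zero k).eventually (gt_mem_nhds one_pos)
  have hk' : ∀ᶠ s : ℝ in 𝓝[>] 0,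
      h (x + (s : UnitAddCircle)) = h x + ((2 ^ k * s : ℝ) : UnitAddCircle) :=
    nhdsWithin_le_nhds hk
  -- The local formula must hold at both `s` and `2 * s`, and the triple and its image must each fit
  -- within one turn.
  obtain ⟨s, hs, hs', hs1, hs2, hs0⟩ := (hk'.and <| (h2.eventually hk).and <|
    (h2.eventually (gt_mem_nhds one_pos)).and <| (h2.eventually h3).and self_mem_nhdsWithin).exists
  have hs0 : 0 < s := hs0
  have hpos : (0 : ℝ) < 2 ^ k := zpow_pos two_pos k
  refine mem_hPlus_of_sbtw h (a := x) (b := x + (s : ℝ)) (c := x + ((2 * s : ℝ) : UnitAddCircle))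
    ?_ ?_
  · have := sbtw_add_right x (sbtw_of_lt hs0 (by linarith : s < 2 * s) (by linarith))
    simpa [add_comm x] using this
  · have := sbtw_add_right (h x) (sbtw_of_lt (a := 0) (s := 2 ^ k * s) (t := 2 ^ k * (2 * s))
      (by positivity) (by nlinarith) (by linarith))
    rw [hs, hs']
    simpa [add_comm (h x)] using this

instance : IsCircularAction thompsonT dyadicCircle where
  smul_sbtw h _ _ _ := (IsThompson.mem_hPlus h.2 _ _ _).2

instance : IsPointwiseAction thompsonT dyadicCircle := isPointwiseAction_of_pointwise rfl

instance : IsArcTransitive thompsonT dyadicCircle :=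
  isArcTransitive (R := dyadics) one_mem_dyadics half_mem_dyadics (H := thompsonT)
    (fun _ ha _ hx _ hδ _ hh => hh.isThompson ha hx hδ) (fun _ hr => isThompson_rotation hr)
    Subtype.val Subtype.val_injective (fun a => dyadicCircle_eq ▸ a.2) (fun _ _ _ => Iff.rfl)
    fun h hh => ⟨⟨h, hh⟩, fun _ => rfl⟩

theorem isTopologicalGroup_thompsonT : IsTopologicalGroup thompsonT :=
  isTopologicalGroup_of_pointwise (A := dyadicCircle) rfl

end UnitCircle

namespace UnitCircle

/-! ### The circle homeomorphisms with the pointwise topology -/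

instance : MulAction HPlusPointwise UnitAddCircle where
  smul h x := (show hPlus from h).1 x
  one_smul _ := rfl
  mul_smul _ _ _ := rfl

instance : IsCircularAction HPlusPointwise UnitAddCircle where
  smul_sbtw h _ _ _ := ((show hPlus from h).2 _ _ _).2

instance : IsPointwiseAction HPlusPointwise UnitAddCircle := isPointwiseAction_of_pointwise rfl

instance : Nontrivial UnitAddCircle := ⟨_, _, half_ne_zero⟩

theorem mem_image_top (x : UnitAddCircle) :
    x ∈ ((↑) : ℝ → UnitAddCircle) '' (⊤ : AddSubgroup ℝ) := by
  obtain ⟨t, -, rfl⟩ := exists_lift 0 x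
  exact ⟨t, trivial, rfl⟩

instance : DenseCircularOrder UnitAddCircle where
  exists_sbtw hab := by
    obtain ⟨c, -, h⟩ := exists_mem_sbtw (R := ⊤) trivial (fun _ _ => trivial) (mem_image_top _)
      (mem_image_top _) hab
    exact ⟨c, h⟩

instance : IsArcTransitive HPlusPointwise UnitAddCircle :=
  isArcTransitive (R := ⊤) trivial (fun _ _ => trivial) (H := hPlus)
    (fun _ _ _ _ _ _ _ hh => hh.mem_hPlus) (fun _ _ => rotation_mem_hPlus _) id
    Function.injective_id mem_image_top (fun _ _ _ => Iff.rfl)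
    fun h hh => ⟨(⟨h, hh⟩ : hPlus), fun _ => rfl⟩

theorem isTopologicalGroup_hPlusPointwise : IsTopologicalGroup HPlusPointwise :=
  isTopologicalGroup_of_pointwise (A := UnitAddCircle) rfl

/-- The sets `{g | g • 0 = x}` are uncountably many disjoint nonempty open sets, so the group is not
separable. -/
theorem not_polishSpace_hPlusPointwise : ¬ PolishSpace HPlusPointwise := fun _ => by
  obtain ⟨D, hD, hd⟩ := TopologicalSpace.exists_countable_dense HPlusPointwise
  have := uncountable_circle
  refine Set.not_countable_univ (α := UnitAddCircle)
    ((hD.image fun g => g • (0 : UnitAddCircle)).mono fun x _ => ?_)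
  obtain ⟨g₀, hg₀⟩ := IsArcTransitive.exists_smul_eq (G := HPlusPointwise) 0 x
  obtain ⟨g, hg, hgD⟩ := hd.inter_open_nonempty _
    (IsPointwiseAction.isOpen_smul_eq (G := HPlusPointwise) 0 x) ⟨g₀, hg₀⟩
  exact ⟨g, hgD, hg⟩

/-! ### The circle homeomorphisms with the compact-open topology -/

/-- A circle homeomorphism as a continuous map. -/
def toContinuousMap (h : hPlus) : C(UnitAddCircle, UnitAddCircle) :=
  ⟨(h : UnitAddCircle ≃ₜ UnitAddCircle), h.1.continuous⟩

theorem continuous_toContinuousMap : Continuous toContinuousMap := continuous_induced_dom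

theorem continuous_hPlus_iff {Z : Type*} [TopologicalSpace Z] {f : Z → hPlus} :
    Continuous f ↔ Continuous fun z => toContinuousMap (f z) := continuous_induced_rng

/-- Inversion exchanges subbasic sets: `h⁻¹` maps `K` into `U` iff `h` maps the compact set `Uᶜ`
into the open set `Kᶜ`. -/
instance isTopologicalGroup_hPlus : IsTopologicalGroup hPlus where
  continuous_mul := by
    rw [continuous_hPlus_iff]
    exact ((continuous_toContinuousMap.comp continuous_fst).compCM
      (continuous_toContinuousMap.comp continuous_snd) :)
  continuous_inv := by
    rw [continuous_hPlus_iff, ContinuousMap.continuous_compactOpen]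
    intro K hK U hU
    have : {h : hPlus | Set.MapsTo (toContinuousMap h⁻¹) K U} =
        toContinuousMap ⁻¹' {f | Set.MapsTo f Uᶜ Kᶜ} := by
      ext h
      constructor
      · intro hh x hx hxK
        have := hh hxK
        change h.1.symm (h.1 x) ∈ U at this
        rw [h.1.symm_apply_apply] at this
        exact hx this
      · intro hh x hx
        by_contra hxU
        have := hh hxU
        change h.1 (h.1.symm x) ∈ Kᶜ at this
        rw [h.1.apply_symm_apply] at this
        exact this hx
    rw [this]
    exact (ContinuousMap.isOpen_setOfPred_mapsTo hU.isClosed_compl.isCompact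
      hK.isClosed.isOpen_compl).preimage
      continuous_toContinuousMap

/-- The pair of `h` and `h⁻¹` embeds the group in a Polish space. Orientation is stated as never
reversing a triple: this is a closed condition, and for bijections it is equivalent to preservation.
-/
theorem polishSpace_hPlus : PolishSpace hPlus := by
  let F : hPlus → C(UnitAddCircle, UnitAddCircle) × C(UnitAddCircle, UnitAddCircle) :=
    fun h => (toContinuousMap h, toContinuousMap h⁻¹)
  have hF : Continuous F :=
    continuous_toContinuousMap.prodMk (continuous_toContinuousMap.comp continuous_inv)
  have hind : IsInducing F := IsInducing.of_comp hF continuous_fst ⟨rfl⟩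
  have hinj : Function.Injective F := fun g h hgh =>
    Subtype.ext (Homeomorph.ext fun x => DFunLike.congr_fun (congrArg Prod.fst hgh) x)
  have hrange : Set.range F = {p | p.1.comp p.2 = .id _ ∧ p.2.comp p.1 = .id _ ∧
      ∀ a b c, sbtw a b c → ¬ sbtw (p.1 c) (p.1 b) (p.1 a)} := by
    ext p
    constructor
    · rintro ⟨h, rfl⟩
      exact ⟨ContinuousMap.ext h.1.apply_symm_apply, ContinuousMap.ext h.1.symm_apply_apply,
        fun a b c habc => ((h.2 a b c).2 habc).not_sbtw⟩
    · rintro ⟨h1, h2, h3⟩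
      let h : UnitAddCircle ≃ₜ UnitAddCircle :=
        { toFun := p.1
          invFun := p.2
          left_inv := DFunLike.congr_fun h2
          right_inv := DFunLike.congr_fun h1
          continuous_toFun := p.1.continuous
          continuous_invFun := p.2.continuous }
      refine ⟨⟨h, sbtw_iff_of_forall h.injective fun a b c habc => ?_⟩, rfl⟩
      exact (sbtw_total (h.injective.ne habc.ne_left) (h.injective.ne habc.ne_right)
        (h.injective.ne habc.ne_outer)).resolve_right (h3 a b c habc)
  have : PolishSpace C(UnitAddCircle, UnitAddCircle) := inferInstance
  refine IsClosedEmbedding.polishSpace (f := F) ⟨⟨hind, hinj⟩, ?_⟩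
  rw [hrange]
  simp only [Set.ofPred_and, Set.ofPred_forall]
  refine .inter (isClosed_eq (continuous_fst.compCM continuous_snd) continuous_const) <|
    .inter (isClosed_eq (continuous_snd.compCM continuous_fst) continuous_const) <|
    isClosed_iInter fun a => isClosed_iInter fun b => isClosed_iInter fun c =>
    isClosed_iInter fun _ => ?_
  have hev (x : UnitAddCircle) : Continuous
      fun p : C(UnitAddCircle, UnitAddCircle) × C(UnitAddCircle, UnitAddCircle) => p.1 x :=
    (ContinuousEvalConst.continuous_eval_const x).comp continuous_fst
  exact (isOpen_sbtw.preimage ((hev c).prodMk ((hev b).prodMk (hev a)))).isClosed_compl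

instance : MulAction hPlus UnitAddCircle where
  smul h x := h.1 x
  one_smul _ := rfl
  mul_smul _ _ _ := rfl

instance : ContinuousSMul hPlus UnitAddCircle where
  continuous_smul := ContinuousEval.continuous_eval.comp
    ((continuous_toContinuousMap.comp continuous_fst).prodMk continuous_snd)

theorem isCOrderedSystem_circle : IsCOrderedSystem hPlus UnitAddCircle :=
  ⟨inferInstance, topology_eq, fun g a b c => (g.2 a b c).2⟩

/-- The identity homomorphism to the coarser topology. -/
def toHPlus : HPlusPointwise →* hPlus := MonoidHom.id hPlus

/-- Prescribing the images of the two ends of an arc confines the image of the whole arc, and a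
compact set is covered by finitely many small arcs. -/
theorem continuous_toHPlus : Continuous toHPlus := by
  rw [continuous_hPlus_iff, ContinuousMap.continuous_compactOpen]
  intro K hK U hU
  refine isOpen_iff_mem_nhds.2 fun h₀ hh₀ => ?_
  refine hK.induction_on (p := fun s => {h : HPlusPointwise | Set.MapsTo (h • ·) s U} ∈ 𝓝 h₀)
    ?_ ?_ ?_ ?_
  · simp [Set.mapsTo_empty]
  · exact fun s t hst ht => mem_of_superset ht fun h hh => hh.mono_left hst
  · intro s t hs ht
    filter_upwards [hs, ht] with h h1 h2 using h1.union h2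
  · intro x hx
    obtain ⟨c, d, hcd, hsub⟩ := exists_arc_subset (hU.mem_nhds (show h₀ • x ∈ U from hh₀ hx))
    refine ⟨{z | sbtw (h₀⁻¹ • c) z (h₀⁻¹ • d)}, mem_nhdsWithin_of_mem_nhds <|
      (isOpen_arc _ _).mem_nhds ?_, ?_⟩
    · have := IsCircularAction.smul_sbtw h₀⁻¹ hcd
      rwa [inv_smul_smul] at this
    · have hop (a : UnitAddCircle) : {h : HPlusPointwise | h • h₀⁻¹ • a = a} ∈ 𝓝 h₀ :=
        (IsPointwiseAction.isOpen_smul_eq _ _).mem_nhds (smul_inv_smul h₀ a)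
      filter_upwards [hop c, hop d] with h hc hd z hz
      have := IsCircularAction.smul_sbtw h (show sbtw (h₀⁻¹ • c) z (h₀⁻¹ • d) from hz)
      rw [hc, hd] at this
      exact hsub (Or.inr (Or.inr this))

/-- The rotation by `r` as a member of the group. -/
def hPlusRotation (r : UnitAddCircle) : hPlus := ⟨rotation r, rotation_mem_hPlus r⟩

theorem hPlusRotation_smul (r x : UnitAddCircle) : hPlusRotation r • x = x + r := rfl

theorem continuous_hPlusRotation : Continuous hPlusRotation :=
  continuous_hPlus_iff.2 <| ContinuousMap.continuous_of_continuous_uncurry _ <|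
    show Continuous fun p : UnitAddCircle × UnitAddCircle => p.2 + p.1 by fun_prop

/-- The circle as a system of its group of homeomorphisms. -/
def circleSystem : GSystem hPlus where
  carrier := UnitAddCircle

theorem circleSystem_mapsToAll : circleSystem.MapsToAll := fun Y => by
  let _ : MulAction HPlusPointwise Y.carrier := MulAction.compHom _ toHPlus
  have : ContinuousSMul HPlusPointwise Y.carrier :=
    ⟨show Continuous fun p : HPlusPointwise × Y.carrier => toHPlus p.1 • p.2 from
      (continuous_toHPlus.comp continuous_fst).smul continuous_snd⟩
  obtain ⟨Φ, -, hΦ⟩ := exists_equivariant (G := HPlusPointwise) (A := UnitAddCircle)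
    (Y := Y.carrier)
  let y₀ := Φ (Cut.before 0)
  have hfix : ∀ k : hPlus, k • (0 : UnitAddCircle) = 0 → k • y₀ = y₀ := fun k hk => by
    let k' : HPlusPointwise := k
    have hk' : k'⁻¹ • (0 : UnitAddCircle) = 0 := inv_smul_eq_iff.2 hk.symm
    have h : k' • Cut.before (0 : UnitAddCircle) = Cut.before 0 := by
      have h (a b : UnitAddCircle) : (k' • Cut.before (0 : UnitAddCircle)).lt a b ↔
          (Cut.before (0 : UnitAddCircle)).lt a b := by
        rw [Cut.smul_lt_iff, Cut.before_lt, Cut.before_lt, cutLT, cutLT]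
        nth_rw 1 2 3 [← hk']
        rw [smul_sbtw_iff, smul_left_cancel_iff, (MulAction.injective k'⁻¹).ne_iff]
      exact Cut.ext (fun a b => (h a b).1) fun a b => (h a b).2
    exact (hΦ k' _).symm.trans (congrArg Φ h)
  -- Equivariance holds because `(hPlusRotation (g • t))⁻¹ * (g * hPlusRotation t)` fixes `0`, hence
  -- fixes `y₀`.
  refine ⟨fun t => hPlusRotation t • y₀, continuous_hPlusRotation.smul continuous_const,
    fun g (t : UnitAddCircle) => ?_⟩
  change hPlusRotation (g • t) • y₀ = g • hPlusRotation t • y₀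
  have h := hfix ((hPlusRotation (g • t))⁻¹ * (g * hPlusRotation t)) <| by
    rw [mul_smul, mul_smul, hPlusRotation_smul, inv_smul_eq_iff, hPlusRotation_smul, zero_add,
      zero_add]
  rw [mul_smul, inv_smul_eq_iff, mul_smul] at h
  exact h.symm

/-- Every second arc of a monotone sequence is used, so that the closed arcs share no endpoints. The
complement of an arc is an open arc, and moving its two ends to those of a small arc inside `U`
shrinks it into `U`. -/
theorem hasShrinkableComplements_circle : HasShrinkableComplements hPlus UnitAddCircle := by
  obtain ⟨x, -, hx⟩ := exists_seq_arc half_ne_zero.symm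
  let p := Cut.before ((0 : ℝ) : UnitAddCircle)
  have hlt : ∀ i j, i < j → p.lt (x i) (x j) := fun i j h =>
    (Cut.before_lt _ _ _).2 (Or.inr (hx i j h))
  have hlt' (n : ℕ) : p.lt (x (2 * n)) (x (2 * n + 1)) := hlt _ _ (Nat.lt_succ_self _)
  refine ⟨fun n => closedArc (x (2 * n)) (x (2 * n + 1)), fun n => ?_, ?_, fun n U hU hne => ?_⟩
  · rw [← isOpen_compl_iff, compl_closedArc (p.ne (hlt' n))]
    exact isOpen_arc _ _
  · have hle : ∀ n, ∀ z ∈ closedArc (x (2 * n)) (x (2 * n + 1)),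
        ¬ p.lt z (x (2 * n)) ∧ ¬ p.lt (x (2 * n + 1)) z := by
      rintro n z (rfl | rfl | h)
      · exact ⟨p.irrefl _, p.asymm (hlt' n)⟩
      · exact ⟨p.asymm (hlt' n), p.irrefl _⟩
      · have := p.lt_of_sbtw_left h (hlt' n)
        exact ⟨p.asymm this.1, p.asymm this.2⟩
    rw [pairwise_disjoint_on]
    refine fun m n hmn => Set.disjoint_left.2 fun z hz hz' => ?_
    have h1 := (hle m z hz).2
    have h2 := (hle n z hz').1
    have h3 := hlt (2 * m + 1) (2 * n) (by omega)
    by_cases h : z = x (2 * m + 1)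
    · exact h2 (h ▸ h3)
    · exact h2 (p.trans ((p.not_lt (Ne.symm h)).1 h1) h3)
  · obtain ⟨u, hu⟩ := hne
    obtain ⟨c, d, hcd, hsub⟩ := exists_arc_subset (hU.mem_nhds hu)
    -- Cutting just before the first point of each pair makes both two-point lists increasing.
    obtain ⟨g, hg⟩ := exists_smul_list_eq (G := HPlusPointwise) (Cut.before (x (2 * n + 1)))
      (Cut.before c) [x (2 * n + 1), x (2 * n)] [c, d] rfl
      (List.pairwise_pair.2 ((Cut.before_lt _ _ _).2 (Or.inl ⟨rfl, p.ne (hlt' n)⟩)))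
      (List.pairwise_pair.2 ((Cut.before_lt _ _ _).2 (Or.inl ⟨rfl, hcd.ne_outer⟩)))
    simp only [List.map_cons, List.map_nil, List.cons.injEq, and_true] at hg
    refine ⟨toHPlus g, fun y hy => hsub (Or.inr (Or.inr ?_))⟩
    rw [← Set.mem_compl_iff, compl_closedArc (p.ne (hlt' n))] at hy
    have := IsCircularAction.smul_sbtw g (show sbtw _ y _ from hy)
    rwa [hg.1, hg.2] at this

end UnitCircle

/-! ### The four groups -/

open UnitCircle in
theorem corollary4p5 :
    (IsTopologicalGroup autQo ∧ PolishSpace autQo ∧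
      IntrinsicallyCOrdered autQo ∧ IntrinsicallyTame autQo ∧ ConvexlyIntrinsicallyTame autQo ∧
      HasMetrizableUniversalMinimal autQo) ∧
    (IsTopologicalGroup thompsonT ∧
      IntrinsicallyCOrdered thompsonT ∧ IntrinsicallyTame thompsonT ∧
      ConvexlyIntrinsicallyTame thompsonT) ∧
    (IsTopologicalGroup HPlusPointwise ∧ ¬ PolishSpace HPlusPointwise ∧
      IntrinsicallyCOrdered HPlusPointwise ∧ IntrinsicallyTame HPlusPointwise ∧
      ConvexlyIntrinsicallyTame HPlusPointwise) ∧
    (IsTopologicalGroup hPlus ∧ PolishSpace hPlus ∧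
      IntrinsicallyCOrdered hPlus ∧ IntrinsicallyTame hPlus ∧
      ConvexlyIntrinsicallyTame hPlus) := by
  obtain ⟨-, h1, h2, h3⟩ := cutSystem_intrinsic autQo rationalCircle
  exact ⟨⟨isTopologicalGroup_autQo, polishSpace_autQo, h1, h2, h3,
      ⟨_, cutSystem_metrizable autQo rationalCircle⟩⟩,
    ⟨isTopologicalGroup_thompsonT, (cutSystem_intrinsic thompsonT dyadicCircle).2⟩,
    ⟨isTopologicalGroup_hPlusPointwise, not_polishSpace_hPlusPointwise,
      (cutSystem_intrinsic HPlusPointwise UnitAddCircle).2⟩,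
    ⟨isTopologicalGroup_hPlus, polishSpace_hPlus, circleSystem_mapsToAll.intrinsic
      hasShrinkableComplements_circle isCOrderedSystem_circle⟩⟩
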